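/- **Setting.** Let $(\mathsf X,\mathcal X)$ and $(\mathsf Y,\mathcal Y)$ be measurable spaces, $\mu$ and $\nu$ probability measures on $\mathsf X$, $\lambda$ a measure on $\mathsf Y$, and $\Theta$ a parameter set. For $\theta\in\Theta$ let $Q_\theta(x,dx')=q_\theta(x,x')\,\mu(dx')$ be a Markov kernel on $\mathsf X$ with measurable density $q_\theta\ge 0$, and let $g_\theta\ge0$ be measurable on $\mathsf X\times\mathsf Y$ with $\int g_\theta(x,y)\,\lambda(dy)=1$ for all $x$. Under $\mathbb P_\theta$, $(X_k)_{k\ge0}$ is a Markov chain with initial distribution $\nu$ and kernel $Q_\theta$, and given $(X_k)$ the observations $Y_k$ are independent with densities $g_\theta(X_k,\cdot)$ with respect to $\lambda$. For observations $y_{0:n}=(y_0,\dots,y_n)$ and real functions $s_k$ on $\mathsf X^2$, set (Bayes' formula) $$\gamma_{\theta,n}=\mathbb E_\theta\Big[\sum_{k=0}^{n-1}s_k(X_k,X_{k+1})\,\Big|\,Y_{0:n}=y_{0:n}\Big]=\frac{\mathbb E_\theta\big[\sum_{k=0}^{n-1}s_k(X_k,X_{k+1})\prod_{k=0}^n g_\theta(X_k,y_k)\big]}{\mathbb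 E_\theta\big[\prod_{k=0}^n g_\theta(X_k,y_k)\big]} .$$ **Particle filter.** Let $\varsigma_\theta$ be a probability measure on $\mathsf X$ with $\nu\ll\varsigma_\theta$, and let $R_{k,\theta}$ ($k\ge0$) be Markov proposal kernels on $\mathsf X$, which may depend measurably on $y_{0:k+1}$, with $Q_\theta(x,\cdot)\ll R_{k,\theta}(x,\cdot)$. Fix (jointly) measurable versions of the densities and put $$W_0(x;\theta)=g_\theta(x,y_0)\frac{d\nu}{d\varsigma_\theta}(x),\qquad W_{k}(x,x';\theta)=g_\theta(x',y_k)\,\frac{dQ_\theta(x,\cdot)}{dR_{k-1,\theta}(x,\cdot)}(x')\quad(k\ge1).$$ Given the observations, the filter with $N$ particles is run as follows. The initial particles $\xi_0^{i}$, $1\le i\le N$, are i.i.d. from $\varsigma_\theta$, with weights $\omega^i_0=W_0(\xi_0^i)$. At every time $k$, indices $I_k^1,\dots,I_k^N$ are drawn conditionally i.i.d. with probabilities $\omega_k^j/\sum_i\omega_k^i$ (uniformly on $\{1,\dots,N\}$ if all the weights vanish), giving the resampled trajectories $\hat\xi_{0:k}^{j}=\xi_{0:k}^{I_k^j}$. Then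 $\xi_{0:k+1}^{i}$ is $\hat\xi_{0:k}^{i}$ prolonged by an independent draw from $R_{k,\theta}(\hat\xi_{0:k}^i(k),\cdot)$, with weight $\omega_{k+1}^i$ proportional to $W_{k+1}(\xi_{0:k+1}^i(k),\xi_{0:k+1}^i(k+1);\theta)$. With $k(\Delta)=(k+\Delta)\wedge n$, the fixed-lag estimator is $$\hat\gamma^{N,\Delta}_{\theta,n}=\frac1N\sum_{k=0}^{n-1}\sum_{j=1}^N s_k\big(\hat\xi^{j}_{0:k(\Delta)}(k),\hat\xi^{j}_{0:k(\Delta)}(k+1)\big).$$ The observations $Y=(Y_k)_{k\ge0}$ fed to the filter have an arbitrary law on $\mathsf Y^{\mathbb N}$, which need not belong to the model. $\bar{\mathbb E}^N_\theta$ is the expectation for the joint law of the observations and the particle system, $\mathcal G_n=\sigma(Y_0,\dots,Y_n)$, $\|V\|_{p|\mathcal G_n}=\bar{\mathbb E}^N_\theta[|V|^p\mid\mathcal G_n]^{1/p}$ for $V\in\mathsf L^p$, $\|\cdot\|_\infty$ is the supremum norm, $\mu g_\theta(y)=\int g_\theta(x,y)\,\mu(dx)$ and $\nu g_\theta(y)=\int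 g_\theta(x,y)\,\nu(dx)$. **Assumptions.** (A1) $\sigma_-=\inf_{\theta,x,x'}q_\theta(x,x')>0$ and $\sigma_+=\sup_{\theta,x,x'}q_\theta(x,x')<\infty$; for all $y\in\mathsf Y$, $\sup_{\theta,x}g_\theta(x,y)<\infty$ and $\inf_\theta\mu g_\theta(y)>0$. Put $\rho=1-\sigma_- /\sigma_+$. (A2) $\|W_k(\cdot;\theta)\|_\infty<\infty$ for all $k\ge0$, all $\theta$ and all values of the observations. **Theorem.** There are universal constants $B_p$, depending only on $p$, and $B$ such that, whenever (A1) and (A2) hold, the following is true for all $n\ge0$, $\theta\in\Theta$, lags $\Delta\ge1$, $N\ge1$, and all $s_k(y_{0:n};x,x')$, $0\le k<n$, jointly measurable (they may depend on the observations $y_{0:n}$) and bounded in $(x,x')$ for each $y_{0:n}$. (i) For all integers $p\ge2$ such that $\hat\gamma^{N,\Delta}_{\theta,n}-\gamma_{\theta,n}\in\mathsf L^p$, almost surely on $\{\nu g_\theta(Y_0)>0\}$, $$\|\hat\gamma^{N,\Delta}_{\theta,n}-\gamma_{\theta,n}\|_{p|\mathcal G_n}\le 2\rho^{\Delta}\sum_{k=0}^{n-\Delta}\|s_k\|_\infty+\frac{B_p}{\sqrt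 N(1-\rho)}\sum_{k=0}^{n-1}\|s_k\|_\infty\Big[\frac1{\sigma_-}\sum_{m=1}^{k(\Delta)}\frac{\|W_m(\cdot;\theta)\|_\infty\,\rho^{0\vee(k-m)}}{\mu g_\theta(Y_m)}+\frac{\|W_0(\cdot;\theta)\|_\infty\,\rho^k}{\nu g_\theta(Y_0)}+1\Big].$$ (ii) If $\hat\gamma^{N,\Delta}_{\theta,n}$ is integrable then, almost surely on $\{\nu g_\theta(Y_0)>0\}$, $$\big|\bar{\mathbb E}^N_\theta[\hat\gamma^{N,\Delta}_{\theta,n}\mid\mathcal G_n]-\gamma_{\theta,n}\big|\le 2\rho^{\Delta}\sum_{k=0}^{n-\Delta}\|s_k\|_\infty+\frac{B}{N(1-\rho)^2}\sum_{k=0}^{n-1}\|s_k\|_\infty\Big[\frac1{\sigma_-^2}\sum_{m=1}^{k(\Delta)}\frac{\|W_m(\cdot;\theta)\|_\infty^2\,\rho^{0\vee(k-m)}}{\{\mu g_\theta(Y_m)\}^2}+\frac{\|W_0(\cdot;\theta)\|_\infty^2\,\rho^k}{\{\nu g_\theta(Y_0)\}^2}\Big].$$ (Sums over an empty range are $0$.)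 Moreover (rate), fix $\theta$, an integer $p\ge2$, a sequence $(y_k)_{k\ge0}$ of observations with $\nu g_\theta(y_0)>0$ and measurable functions $s_k$ on $\mathsf X^2$, $k\ge0$, such that $\|s_k\|_\infty$ ($k\ge0$) and $\|W_k(\cdot;\theta)\|_\infty/\mu g_\theta(y_k)$ ($k\ge1$) are bounded in $k$. Let $c>-1/\log\rho$ (meaning $c>0$ if $\rho=0$) and $\Delta_n=\lceil c\log n\rceil$. Then $n\rho^{\Delta_n}\to0$, and there is a constant $C$ such that for all $n\ge2$ and $N\ge1$ the filter run on these observations satisfies $$\mathbb E\big[|\hat\gamma^{N,\Delta_n}_{\theta,n}-\gamma_{\theta,n}|^p\big]^{1/p}\le C\,n\rho^{\Delta_n}+C\,\frac{n\log n}{\sqrt N}.$$ -/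

import Mathlib

open MeasureTheory ProbabilityTheory Finset
open scoped NNReal ENNReal

noncomputable section

namespace FixedLag

/-! ### Generalities -/

/-- The product `a ↦ ⨂ i, κ i a` of finitely many Markov kernels: independent sampling. -/
def piKernel {ι α β : Type*} [Fintype ι] [MeasurableSpace α] [MeasurableSpace β]
    (κ : ι → Kernel α β) [∀ i, IsMarkovKernel (κ i)] : Kernel α (ι → β) where
  toFun a := Measure.pi fun i => κ i a
  measurable' := by
    refine Measurable.measure_of_isPiSystem_of_isProbabilityMeasure
      generateFrom_pi.symm isPiSystem_pi ?_
    rintro _ ⟨t, ht, rfl⟩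
    simp only [Measure.pi_pi]
    exact Finset.measurable_prod _ fun i _ =>
      (κ i).measurable_coe (ht i (Set.mem_univ i))

instance {ι α β : Type*} [Fintype ι] [MeasurableSpace α] [MeasurableSpace β]
    (κ : ι → Kernel α β) [∀ i, IsMarkovKernel (κ i)] : IsMarkovKernel (piKernel κ) :=
  ⟨fun a => by change IsProbabilityMeasure (Measure.pi fun i => κ i a); infer_instance⟩

/-- Given a sequence up to time `k` and a new term, the sequence stopped at time `k + 1`.
A finite sequence `(z₀, …, z_k)` is represented throughout by the infinite sequence that stays
constant after time `k`. -/
def extend {α : Type*} (k : ℕ) (p : (ℕ → α) × α) : ℕ → α :=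
  fun m => if m ≤ k then p.1 m else p.2

lemma measurable_extend {α : Type*} [MeasurableSpace α] (k : ℕ) :
    Measurable (extend (α := α) k) := by
  refine measurable_pi_lambda _ fun m => ?_
  by_cases h : m ≤ k
  · simp only [extend, h, if_true]
    exact (measurable_pi_apply m).comp measurable_fst
  · simp only [extend, h, if_false]
    exact measurable_snd

/-- The initial segment `y_{0:n}`. -/
def upTo {Y : Type*} (n : ℕ) (y : ℕ → Y) : Fin (n + 1) → Y := fun i => y i

lemma measurable_upTo {Y : Type*} [MeasurableSpace Y] (n : ℕ) :
    Measurable (upTo (Y := Y) n) :=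
  measurable_pi_lambda _ fun _ => measurable_pi_apply _

/-- The supremum norm `‖f‖_{X², ∞}`. -/
def supNorm₂ {X : Type*} (f : X → X → ℝ) : ℝ := ⨆ p : X × X, |f p.1 p.2|

/-- Normalised weights `ω_j / Σ_i ω_i`; uniform weights if all the `ω_i` vanish. -/
def normWeight {N : ℕ} (w : Fin N → ℝ≥0) (j : Fin N) : ℝ≥0 :=
  if ∑ i, w i = 0 then (N : ℝ≥0)⁻¹ else w j / ∑ i, w i

lemma measurable_normWeight {N : ℕ} (j : Fin N) :
    Measurable fun w : Fin N → ℝ≥0 => normWeight w j := by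
  have hs : Measurable fun w : Fin N → ℝ≥0 => ∑ i, w i :=
    Finset.measurable_sum _ fun i _ => measurable_pi_apply i
  exact Measurable.ite (hs (measurableSet_singleton 0)) measurable_const
    ((measurable_pi_apply j).div hs)

lemma sum_normWeight {N : ℕ} [NeZero N] (w : Fin N → ℝ≥0) : ∑ j, normWeight w j = 1 := by
  unfold normWeight
  by_cases h : ∑ i, w i = 0
  · simp [h, NeZero.ne N]
  · simp only [h, if_false]
    rw [← Finset.sum_div, div_self h]

/-- Draws one index in `{1, …, N}` with probabilities given by the normalised weights. -/
def select (N : ℕ) : Kernel (Fin N → ℝ≥0) (Fin N) where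
  toFun w := ∑ j, (normWeight w j : ℝ≥0∞) • Measure.dirac j
  measurable' := by
    refine Measure.measurable_of_measurable_coe _ fun s hs => ?_
    simp only [Measure.coe_finsetSum, Finset.sum_apply, Measure.smul_apply, smul_eq_mul]
    exact Finset.measurable_sum _ fun j _ =>
      (measurable_normWeight j).coe_nnreal_ennreal.mul_const _

instance (N : ℕ) [NeZero N] : IsMarkovKernel (select N) :=
  ⟨fun w => ⟨by
    change (∑ j, (normWeight w j : ℝ≥0∞) • Measure.dirac j) Set.univ = 1
    simp only [Measure.coe_finsetSum, Finset.sum_apply, Measure.smul_apply, smul_eq_mul,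
      measure_univ, mul_one]
    exact_mod_cast sum_normWeight w⟩⟩

/-! ### The state space models -/

/-- A parametric family of state space models on the state space `X` with observations in `Y`. -/
structure Model (X Y Θ : Type*) [MeasurableSpace X] [MeasurableSpace Y] where
  /-- the dominating probability measure on the state space -/
  μ : Measure X
  prob_μ : IsProbabilityMeasure μ
  /-- the initial distribution of the latent chain -/
  ν : Measure X
  prob_ν : IsProbabilityMeasure ν
  /-- the transition kernel of the latent chain -/
  Q : Θ → Kernel X X
  markov_Q : ∀ θ, IsMarkovKernel (Q θ)
  /-- the transition density with respect to `μ` -/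
  q : Θ → X → X → ℝ≥0
  measurable_q : ∀ θ, Measurable fun p : X × X => q θ p.1 p.2
  Q_eq : ∀ θ x, Q θ x = μ.withDensity fun x' => (q θ x x' : ℝ≥0∞)
  /-- the reference measure on the observation space -/
  lam : Measure Y
  /-- the density `y ↦ g θ x y` of an observation given the state `x` -/
  g : Θ → X → Y → ℝ≥0
  measurable_g : ∀ θ, Measurable fun p : X × Y => g θ p.1 p.2
  lintegral_g : ∀ θ x, ∫⁻ y, (g θ x y : ℝ≥0∞) ∂lam = 1

attribute [instance] Model.prob_μ Model.prob_ν Model.markov_Q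

namespace Model

variable {X Y Θ : Type*} [MeasurableSpace X] [MeasurableSpace Y] (M : Model X Y Θ)

/-- `σ₋ = inf_θ inf_{x, x'} q_θ(x, x')`. -/
def sigmaMinus : ℝ := ⨅ p : Θ × X × X, (M.q p.1 p.2.1 p.2.2 : ℝ)

/-- `σ₊ = sup_θ sup_{x, x'} q_θ(x, x')`. -/
def sigmaPlus : ℝ := ⨆ p : Θ × X × X, (M.q p.1 p.2.1 p.2.2 : ℝ)

/-- `ρ = 1 - σ₋ / σ₊`. -/
def rho : ℝ := 1 - M.sigmaMinus / M.sigmaPlus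

/-- `μ g_θ(y) = ∫ g_θ(x, y) μ(dx)`. -/
def muG (θ : Θ) (y : Y) : ℝ := ∫ x, (M.g θ x y : ℝ) ∂M.μ

/-- `ν g_θ(y) = ∫ g_θ(x, y) ν(dx)`. -/
def nuG (θ : Θ) (y : Y) : ℝ := ∫ x, (M.g θ x y : ℝ) ∂M.ν

/-- Assumption (A1). -/
structure A1 : Prop where
  sigmaMinus_pos : 0 < M.sigmaMinus
  sigmaPlus_finite : BddAbove (Set.range fun p : Θ × X × X => (M.q p.1 p.2.1 p.2.2 : ℝ))
  sup_g_finite : ∀ y, BddAbove (Set.range fun p : Θ × X => (M.g p.1 p.2 y : ℝ))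
  inf_muG_pos : ∀ y, 0 < ⨅ θ, M.muG θ y

/-- The law of the latent chain `X_{0:n}` under the parameter `θ`. -/
def latentLaw (θ : Θ) : ℕ → Measure (ℕ → X)
  | 0 => M.ν.map fun x _ => x
  | n + 1 => (latentLaw θ n ⊗ₘ (M.Q θ).comap (fun x => x n) (measurable_pi_apply n)).map
      (extend n)

instance (θ : Θ) (n : ℕ) : IsProbabilityMeasure (M.latentLaw θ n) := by
  induction n with
  | zero =>
    exact Measure.isProbabilityMeasure_map
      (measurable_pi_lambda _ fun _ => measurable_id).aemeasurable
  | succ n ih =>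
    exact Measure.isProbabilityMeasure_map (measurable_extend n).aemeasurable

/-- The conditional density `∏_{k ≤ n} g_θ(x_k, y_k)` of `Y_{0:n}` given `X_{0:n}`. -/
def obsDensity (θ : Θ) (n : ℕ) (y : ℕ → Y) (x : ℕ → X) : ℝ≥0 :=
  ∏ k ∈ range (n + 1), M.g θ (x k) (y k)

/-- The likelihood `L_{ν, n}(θ; y_{0:n})`. -/
def likelihood (θ : Θ) (n : ℕ) (y : ℕ → Y) : ℝ≥0∞ :=
  ∫⁻ x, (M.obsDensity θ n y x : ℝ≥0∞) ∂M.latentLaw θ n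

/-- The joint smoothing distribution `φ_{ν, 0:n|n}[y_{0:n}]`, i.e. the conditional distribution
of `X_{0:n}` given `Y_{0:n} = y_{0:n}` under the parameter `θ`, in the version given by Bayes'
formula. -/
def smoothing (θ : Θ) (n : ℕ) (y : ℕ → Y) : Measure (ℕ → X) :=
  (M.likelihood θ n y)⁻¹ •
    (M.latentLaw θ n).withDensity fun x => (M.obsDensity θ n y x : ℝ≥0∞)

/-- The smoothed additive functional
`γ_{θ, n} = E_θ[∑_{k < n} s_k(X_k, X_{k+1}) | Y_{0:n} = y_{0:n}]`. -/
def gamma (θ : Θ) (n : ℕ) (y : ℕ → Y) (s : ℕ → X → X → ℝ) : ℝ :=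
  ∫ x, ∑ k ∈ range n, s k (x k) (x (k + 1)) ∂M.smoothing θ n y

end Model

/-! ### Importance sampling -/

/-- The proposal distributions of the particle filter, with versions of the importance sampling
densities. The proposal at time `k + 1` may depend on the observations `y_{0:k+1}`. -/
structure Proposal {X Y Θ : Type*} [MeasurableSpace X] [MeasurableSpace Y]
    (M : Model X Y Θ) where
  /-- the distribution of the initial particles -/
  init : Θ → Measure X
  prob_init : ∀ θ, IsProbabilityMeasure (init θ)
  /-- the Radon–Nikodym derivative of `ν` with respect to `init θ` -/
  dInit : Θ → X → ℝ≥0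
  measurable_dInit : ∀ θ, Measurable (dInit θ)
  ν_eq : ∀ θ, M.ν = (init θ).withDensity fun x => (dInit θ x : ℝ≥0∞)
  /-- the mutation kernel from time `k` to time `k + 1` -/
  R : (k : ℕ) → Θ → Kernel ((Fin (k + 2) → Y) × X) X
  markov_R : ∀ k θ, IsMarkovKernel (R k θ)
  /-- the Radon–Nikodym derivative of `Q_θ(x, ·)` with respect to `R_k(x, ·)` -/
  dQ : (k : ℕ) → Θ → (Fin (k + 2) → Y) → X → X → ℝ≥0
  measurable_dQ : ∀ k θ,
    Measurable fun p : (Fin (k + 2) → Y) × X × X => dQ k θ p.1 p.2.1 p.2.2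
  Q_eq : ∀ k θ y x, M.Q θ x = (R k θ (y, x)).withDensity fun x' => (dQ k θ y x x' : ℝ≥0∞)

attribute [instance] Proposal.prob_init Proposal.markov_R

namespace Proposal

variable {X Y Θ : Type*} [MeasurableSpace X] [MeasurableSpace Y] {M : Model X Y Θ}
  (P : Proposal M)

/-- The weight function `W_0` at the observation `y`. -/
def W₀ (θ : Θ) (y : Y) (x : X) : ℝ≥0 := M.g θ x y * P.dInit θ x

/-- The weight function `W_{k+1}(x, x') = g_θ(x', y_{k+1}) (dQ_θ(x, ·)/dR_k(x, ·))(x')`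
at the observations `y_{0:k+1}`. -/
def W (k : ℕ) (θ : Θ) (y : Fin (k + 2) → Y) (x x' : X) : ℝ≥0 :=
  M.g θ x' (y (Fin.last (k + 1))) * P.dQ k θ y x x'

/-- `‖W_0(·; θ)‖_{X, ∞}`. -/
def normW₀ (θ : Θ) (y : ℕ → Y) : ℝ := ⨆ x, (P.W₀ θ (y 0) x : ℝ)

/-- `‖W_{k+1}(·; θ)‖_{X², ∞}`. -/
def normW (k : ℕ) (θ : Θ) (y : ℕ → Y) : ℝ :=
  supNorm₂ fun x x' => (P.W k θ (upTo (k + 1) y) x x' : ℝ)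

/-- Assumption (A2): all the weight functions are bounded. -/
structure A2 : Prop where
  zero : ∀ θ y, BddAbove (Set.range fun x => (P.W₀ θ y x : ℝ))
  succ : ∀ k θ y, BddAbove (Set.range fun p : X × X => (P.W k θ y p.1 p.2 : ℝ))

lemma measurable_W₀ (θ : Θ) : Measurable fun p : Y × X => P.W₀ θ p.1 p.2 :=
  ((M.measurable_g θ).comp (measurable_snd.prodMk measurable_fst)).mul
    ((P.measurable_dInit θ).comp measurable_snd)

lemma measurable_W (k : ℕ) (θ : Θ) :
    Measurable fun p : (Fin (k + 2) → Y) × X × X => P.W k θ p.1 p.2.1 p.2.2 :=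
  ((M.measurable_g θ).comp ((measurable_snd.comp measurable_snd).prodMk
    ((measurable_pi_apply _).comp measurable_fst))).mul (P.measurable_dQ k θ)

end Proposal

/-! ### The particle filter -/

/-- The random variables produced at one time step `k`: the current positions
`ξ_{0:k}^{N,i}(k)` of the particles and the indices `I_k^{N,i}` drawn in the resampling. -/
abbrev Step (X : Type*) (N : ℕ) : Type _ := (Fin N → X) × (Fin N → Fin N)

/-- The trajectory `ξ_{0:k}^{N,i}` (meaningful at times `m ≤ k`): the `i`-th particle at time
`k + 1` prolongs the resampled trajectory `ξ_{0:k}^{N, I_k^i}`. -/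
def path {X : Type*} {N : ℕ} (h : ℕ → Step X N) : ℕ → Fin N → ℕ → X
  | 0, i => fun _ => (h 0).1 i
  | k + 1, i => fun m => if m ≤ k then path h k ((h k).2 i) m else (h (k + 1)).1 i

/-- The resampled trajectory `ξ̂_{0:k}^{N,j} = ξ_{0:k}^{N, I_k^j}`. -/
def resampledPath {X : Type*} {N : ℕ} (h : ℕ → Step X N) (k : ℕ) (j : Fin N) : ℕ → X :=
  path h k ((h k).2 j)

/-- `k(Δ) = (k + Δ) ∧ n`. -/
def lagIndex (n Δ k : ℕ) : ℕ := min (k + Δ) n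

/-- The fixed-lag estimator
`γ̂^{N,Δ}_{θ,n} = N⁻¹ ∑_{k < n} ∑_j s_k(ξ̂_{0:k(Δ)}^{N,j}(k), ξ̂_{0:k(Δ)}^{N,j}(k + 1))`. -/
def gammaHat {X : Type*} {N : ℕ} (n Δ : ℕ) (s : ℕ → X → X → ℝ) (h : ℕ → Step X N) : ℝ :=
  (N : ℝ)⁻¹ * ∑ k ∈ range n, ∑ j : Fin N,
    s k (resampledPath h (lagIndex n Δ k) j k) (resampledPath h (lagIndex n Δ k) j (k + 1))

/-- The position at time `k` of the particle selected for the `i`-th place. -/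
def parent {X : Type*} {N : ℕ} (k : ℕ) (i : Fin N) (h : ℕ → Step X N) : X :=
  (h k).1 ((h k).2 i)

lemma measurable_parent {X : Type*} [MeasurableSpace X] {N : ℕ} (k : ℕ) (i : Fin N) :
    Measurable (parent (X := X) k i) := by
  have h : Measurable fun p : (Fin N → X) × Fin N => p.1 p.2 :=
    measurable_from_prod_countable_left fun j => measurable_pi_apply j
  have h2 : Measurable fun h : ℕ → Step X N => ((h k).1, (h k).2 i) :=
    (measurable_fst.comp (measurable_pi_apply k)).prodMk
      ((measurable_pi_apply i).comp (measurable_snd.comp (measurable_pi_apply k)))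
  exact h.comp h2

namespace Proposal

variable {X Y Θ : Type*} [MeasurableSpace X] [MeasurableSpace Y] {M : Model X Y Θ}
  (P : Proposal M) (N : ℕ) [NeZero N] (θ : Θ)

/-- Multinomial resampling at time `0`, given the observations and the initial positions. -/
def resampleInit : Kernel ((ℕ → Y) × (Fin N → X)) (Fin N → Fin N) :=
  piKernel fun _ => (select N).comap (fun p i => P.W₀ θ (p.1 0) (p.2 i))
    (measurable_pi_lambda _ fun i =>
      have h : Measurable fun p : (ℕ → Y) × (Fin N → X) => (p.1 0, p.2 i) :=
        ((measurable_pi_apply 0).comp measurable_fst).prodMk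
          ((measurable_pi_apply i).comp measurable_snd)
      (P.measurable_W₀ θ).comp h)

/-- The first step: independent particles with distribution `init θ`, then resampling. -/
def initStep : Kernel (ℕ → Y) (Step X N) :=
  Kernel.const _ (Measure.pi fun _ => P.init θ) ⊗ₖ P.resampleInit N θ

/-- Mutation from time `k` to time `k + 1`, given the observations and the past: independently,
the `i`-th selected particle moves according to `R_k`. -/
def mutate (k : ℕ) : Kernel ((ℕ → Y) × (ℕ → Step X N)) (Fin N → X) :=
  piKernel fun i => (P.R k θ).comap (fun p => (upTo (k + 1) p.1, parent k i p.2))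
    (((measurable_upTo _).comp measurable_fst).prodMk
      ((measurable_parent k i).comp measurable_snd))

/-- Multinomial resampling at time `k + 1`, given the observations, the past and the new
positions. As the weights are equal after the resampling at time `k`, the new weights are
proportional to the values of the weight function. -/
def resample (k : ℕ) :
    Kernel (((ℕ → Y) × (ℕ → Step X N)) × (Fin N → X)) (Fin N → Fin N) :=
  piKernel fun _ => (select N).comap
    (fun p i => P.W k θ (upTo (k + 1) p.1.1) (parent k i p.1.2) (p.2 i))
    (measurable_pi_lambda _ fun i =>
      have h : Measurable fun p : ((ℕ → Y) × (ℕ → Step X N)) × (Fin N → X) =>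
          (upTo (k + 1) p.1.1, parent k i p.1.2, p.2 i) :=
        ((measurable_upTo _).comp (measurable_fst.comp measurable_fst)).prodMk
          (((measurable_parent k i).comp (measurable_snd.comp measurable_fst)).prodMk
            ((measurable_pi_apply i).comp measurable_snd))
      (P.measurable_W k θ).comp h)

/-- The law of the particle system up to time `n`, given the sequence of observations (it uses
`y_{0:n}` only). -/
def particleLaw : ℕ → Kernel (ℕ → Y) (ℕ → Step X N)
  | 0 => (P.initStep N θ).map fun z _ => z
  | n + 1 => (particleLaw n ⊗ₖ (P.mutate N θ n ⊗ₖ P.resample N θ n)).map (extend n)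

instance : IsMarkovKernel (P.resampleInit N θ) := by
  unfold resampleInit; infer_instance

instance : IsMarkovKernel (P.initStep N θ) := by
  unfold initStep; infer_instance

instance (k : ℕ) : IsMarkovKernel (P.mutate N θ k) := by
  unfold mutate; infer_instance

instance (k : ℕ) : IsMarkovKernel (P.resample N θ k) := by
  unfold resample; infer_instance

instance (n : ℕ) : IsMarkovKernel (P.particleLaw N θ n) := by
  induction n with
  | zero =>
    exact Kernel.IsMarkovKernel.map _ (measurable_pi_lambda _ fun _ => measurable_id)
  | succ n ih =>
    exact Kernel.IsMarkovKernel.map _ (measurable_extend n)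

/-- The joint law of the observations, distributed according to `obs`, and of the particle
system driven by them with the parameter `θ`, up to time `n`. -/
def jointLaw (obs : Measure (ℕ → Y)) (n : ℕ) : Measure ((ℕ → Y) × (ℕ → Step X N)) :=
  obs ⊗ₘ P.particleLaw N θ n

instance (obs : Measure (ℕ → Y)) [IsProbabilityMeasure obs] (n : ℕ) :
    IsProbabilityMeasure (P.jointLaw N θ obs n) := by
  unfold jointLaw; infer_instance

end Proposal

/-- The σ-algebra `G_n` generated by the observations `Y_{0:n}`. -/
@[reducible] def obsSigma (Y S : Type*) [MeasurableSpace Y] (n : ℕ) : MeasurableSpace ((ℕ → Y) × S) :=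
  MeasurableSpace.comap (fun ω => upTo n ω.1) inferInstance

/-- The conditional norm `‖V‖_{p | A} = E[|V|^p | A]^{1/p}`. -/
def condNorm {Ω : Type*} [MeasurableSpace Ω] (Pr : Measure Ω) (A : MeasurableSpace Ω) (p : ℕ)
    (V : Ω → ℝ) (ω : Ω) : ℝ :=
  (condExp A Pr (fun ω' => |V ω'| ^ p) ω) ^ (1 / (p : ℝ))

end FixedLag

end

universe u v w

open FixedLag

/-!
The argument is carried out for a fixed parameter `θ` and a fixed sequence of observations `y`; the
statements conditional on the observations follow because the conditional expectation given
`Y_{0:n}` is integration against the law of the particle system driven by them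
(`Proposal.condExp_obsSigma`).

For one summand, write `F(x) = s_k(x_k, x_{k+1})` and `T = k(Δ)`. The error of its estimator splits
into a bias due to the lag and a sampling error.

*Bias due to the lag.* It is the difference between the smoothed means of `F` given `Y_{0:T}` and
given `Y_{0:n}`. Backward in time, the conditional chain is uniformly mixing, as `q` lies between
`σ₋` and `σ₊`: if `a ≤ E[F | X_T, Y_{0:T}] ≤ c`, one more observation moves both bounds towards the
current smoothed mean and shrinks `c - a` by the factor `ρ` (`Model.Bracket.succ`). This gives
`2 ‖s_k‖ ρ ^ Δ` (`Model.abs_ratio_sub_ratio_le`).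

*Sampling error.* Let `iter m d` be the unnormalised prediction operator over the `d = T - m` steps
from `m` to `T`. The weighted particles at time `m` yield the estimate
`Φ_m(iter m d F) / Φ_m(iter m d 1)` of the smoothed mean (`Proposal.predicted`), and the sampling
error is the telescoping sum of its increments in `m`, plus the error of the last resampling. Given
the trajectories up to time `m`, those up to time `m + 1` are independent and identically
distributed (`Proposal.map_path_path_succ`), and the increment `D` is the error of a
self-normalised importance sampling estimate. With `A` and `B` the empirical means of its centred
numerator and of its denominator, and `E` the expectation of `B`, one has `D B = A`, hence
`D = A / E + D (E - B) / E`. The oscillation of `iter m d F / iter m d 1` bounds `D`, and it is at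
most `2 ‖s_k‖ ρ ^ (k - m)` by forward forgetting (`Model.exists_iter_bracket`); so the moments of
`D` reduce to those of averages of independent bounded variables, which Hoeffding's lemma
controls (`integral_abs_avg_pow_le`, `RatioError.integral_abs_pow_le`). Using the identity twice
leaves only second-order terms besides the centred `A / E`, whence the bias of order `1 / N`
(`RatioError.abs_integral_le`).

The identity `D B = A` and the bound on `D` remain true when all the weights vanish, so this event
needs no separate treatment.
-/

noncomputable section

namespace FixedLag

/-! ### Bounded measurable functions -/

/-- Bounded measurable real functions, the test functions used throughout. -/
structure BddMeas {α : Type*} [MeasurableSpace α] (f : α → ℝ) : Prop where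
  meas : Measurable f
  bdd : ∃ C, ∀ x, |f x| ≤ C

namespace BddMeas

variable {α β : Type*} [MeasurableSpace α] [MeasurableSpace β] {f g : α → ℝ}

lemma const (c : ℝ) : BddMeas fun _ : α => c := ⟨measurable_const, |c|, fun _ => le_rfl⟩

lemma add (hf : BddMeas f) (hg : BddMeas g) : BddMeas fun x => f x + g x := by
  obtain ⟨C, hC⟩ := hf.bdd
  obtain ⟨D, hD⟩ := hg.bdd
  exact ⟨hf.meas.add hg.meas, C + D, fun x => (abs_add_le _ _).trans (add_le_add (hC x) (hD x))⟩

lemma mul (hf : BddMeas f) (hg : BddMeas g) : BddMeas fun x => f x * g x := by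
  obtain ⟨C, hC⟩ := hf.bdd
  obtain ⟨D, hD⟩ := hg.bdd
  refine ⟨hf.meas.mul hg.meas, C * D, fun x => ?_⟩
  rw [abs_mul]
  exact mul_le_mul (hC x) (hD x) (abs_nonneg _) ((abs_nonneg _).trans (hC x))

lemma const_mul (c : ℝ) (hf : BddMeas f) : BddMeas fun x => c * f x := (const c).mul hf

lemma sub (hf : BddMeas f) (hg : BddMeas g) : BddMeas fun x => f x - g x := by
  simpa [sub_eq_add_neg] using hf.add (hg.const_mul (-1))

lemma comp (hf : BddMeas f) {φ : β → α} (hφ : Measurable φ) : BddMeas fun x => f (φ x) := by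
  obtain ⟨C, hC⟩ := hf.bdd
  exact ⟨hf.meas.comp hφ, C, fun x => hC _⟩

lemma sum {ι : Type*} {t : Finset ι} {F : ι → α → ℝ} (h : ∀ i ∈ t, BddMeas (F i)) :
    BddMeas fun x => ∑ i ∈ t, F i x := by
  classical
  induction t using Finset.induction_on with
  | empty => simpa using const (α := α) 0
  | insert i t hi ih =>
    simp only [Finset.sum_insert hi]
    exact (h i (by simp)).add (ih fun j hj => h j (by simp [hj]))

lemma pow (hf : BddMeas f) (n : ℕ) : BddMeas fun x => f x ^ n := by
  induction n with
  | zero => simpa using const (α := α) 1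
  | succ n ih => simpa [pow_succ] using ih.mul hf

lemma abs (hf : BddMeas f) : BddMeas fun x => |f x| := by
  obtain ⟨C, hC⟩ := hf.bdd
  exact ⟨measurable_norm.comp hf.meas, C, fun x => by simpa using hC x⟩

lemma integrable (hf : BddMeas f) (μ : Measure α) [IsFiniteMeasure μ] : Integrable f μ := by
  obtain ⟨C, hC⟩ := hf.bdd
  exact Integrable.of_bound hf.meas.aestronglyMeasurable C (ae_of_all _ fun x => by simpa using hC x)

end BddMeas

/-! ### Moments of averages of independent bounded variables -/

/-- The average of `f` over the points `z i`. -/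
def avg {Z : Type*} {N : ℕ} (f : Z → ℝ) (z : Fin N → Z) : ℝ := (N : ℝ)⁻¹ * ∑ i, f (z i)

lemma avg_sub_const {Z : Type*} {N : ℕ} [NeZero N] {f : Z → ℝ} (c : ℝ) (z : Fin N → Z) :
    avg (fun x => f x - c) z = avg f z - c := by
  have hN : (N : ℝ) ≠ 0 := by exact_mod_cast NeZero.ne N
  simp only [avg, Finset.sum_sub_distrib, Finset.sum_const, Finset.card_univ, Fintype.card_fin,
    nsmul_eq_mul]
  field_simp

section Averages

variable {Z : Type*} [MeasurableSpace Z] {N : ℕ}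

lemma BddMeas.avg {f : Z → ℝ} (hf : BddMeas f) : BddMeas fun z : Fin N → Z => avg f z :=
  (BddMeas.sum fun i _ => hf.comp (measurable_pi_apply i)).const_mul _

variable [NeZero N] (π : Measure Z) [IsProbabilityMeasure π]

lemma integral_avg {f : Z → ℝ} (hf : BddMeas f) :
    ∫ z, avg f z ∂Measure.pi (fun _ : Fin N => π) = ∫ x, f x ∂π := by
  have hN : (N : ℝ) ≠ 0 := by exact_mod_cast NeZero.ne N
  simp only [avg]
  rw [integral_const_mul, integral_finsetSum _
    fun i _ => (hf.comp (measurable_pi_apply i)).integrable _]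
  have h : ∀ i : Fin N, ∫ z, f (z i) ∂Measure.pi (fun _ : Fin N => π) = ∫ x, f x ∂π := by
    intro i
    have hmp := measurePreserving_eval (fun _ : Fin N => π) i
    conv_rhs => rw [← hmp.map_eq]
    exact (integral_map hmp.measurable.aemeasurable hf.meas.aestronglyMeasurable).symm
  simp [h, hN]

/-- Hoeffding's bound for the Laplace transform of an average of centred variables. -/
lemma integral_exp_avg_le {f : Z → ℝ} (hf : Measurable f) {m : ℝ} (hm : ∀ x, |f x| ≤ m)
    (h0 : ∫ x, f x ∂π = 0) (t : ℝ) :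
    ∫ z, Real.exp (t * avg f z) ∂Measure.pi (fun _ : Fin N => π)
      ≤ Real.exp (t ^ 2 * m ^ 2 / (2 * N)) := by
  have hN : (N : ℝ) ≠ 0 := by exact_mod_cast NeZero.ne N
  have hsub := hasSubgaussianMGF_of_mem_Icc (μ := π) (a := -m) (b := m) hf.aemeasurable
    (ae_of_all _ fun x => abs_le.mp (hm x))
  have hle := hsub.mgf_le (t / N)
  simp only [h0, sub_zero, mgf] at hle
  have hc : (((‖m - -m‖₊ / 2) ^ 2 : ℝ≥0) : ℝ) = m ^ 2 := by
    push_cast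
    rw [div_pow, Real.norm_eq_abs, sq_abs]
    ring
  rw [hc] at hle
  have h1 : ∀ z : Fin N → Z, Real.exp (t * avg f z) = ∏ i, Real.exp (t / N * f (z i)) := fun z => by
    rw [← Real.exp_sum, ← Finset.mul_sum, avg]
    congr 1
    field_simp
  simp only [h1]
  rw [integral_fintype_prod_eq_prod (fun (_ : Fin N) x => Real.exp (t / N * f x))]
  calc ∏ _i : Fin N, ∫ x, Real.exp (t / N * f x) ∂π
      ≤ ∏ _i : Fin N, Real.exp (m ^ 2 * (t / N) ^ 2 / 2) :=
        Finset.prod_le_prod (fun _ _ => integral_nonneg fun _ => (Real.exp_pos _).le)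
          fun _ _ => hle
    _ = Real.exp (t ^ 2 * m ^ 2 / (2 * N)) := by
        rw [Finset.prod_const, ← Real.exp_nat_mul, Finset.card_univ, Fintype.card_fin]
        congr 1
        field_simp

/-- The moments of an average of `N` independent centred variables bounded by `m` are those of a
variable of order `m / √N`: the Laplace transform is bounded at `± √N / m`. -/
lemma integral_abs_avg_pow_le {f : Z → ℝ} (hf : Measurable f) {m : ℝ} (hm : ∀ x, |f x| ≤ m)
    (h0 : ∫ x, f x ∂π = 0) {p : ℕ} (hp : p ≠ 0) :
    ∫ z, |avg f z| ^ p ∂Measure.pi (fun _ : Fin N => π) ≤ 4 * p.factorial * (m / √N) ^ p := by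
  obtain ⟨x₀⟩ : Nonempty Z := nonempty_of_isProbabilityMeasure π
  have hm0 : 0 ≤ m := (abs_nonneg _).trans (hm x₀)
  have hN : (0 : ℝ) < N := by exact_mod_cast Nat.pos_of_ne_zero (NeZero.ne N)
  rcases hm0.eq_or_lt with rfl | hmpos
  · have hz : ∀ x, f x = 0 := fun x => abs_nonpos_iff.mp (hm x)
    simp [avg, hz, hp]
  have hb : BddMeas f := ⟨hf, m, hm⟩
  set t := √(N : ℝ) / m with ht
  have hs : 0 < √(N : ℝ) := Real.sqrt_pos.mpr hN
  have htpos : 0 < t := div_pos hs hmpos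
  have hexp : ∀ u : ℝ, u = t ∨ u = -t →
      ∫ z, Real.exp (u * avg f z) ∂Measure.pi (fun _ : Fin N => π) ≤ 2 := by
    intro u hu
    refine (integral_exp_avg_le π hf hm h0 u).trans ?_
    have : u ^ 2 * m ^ 2 / (2 * N) = 1 / 2 := by
      have : u ^ 2 = t ^ 2 := by rcases hu with rfl | rfl <;> ring
      rw [this, ht, div_pow, Real.sq_sqrt hN.le]
      field_simp
    rw [this]
    have h1 : Real.exp (1 / 2) ^ 2 = Real.exp 1 := by
      rw [← Real.exp_nat_mul]; norm_num
    nlinarith [Real.exp_one_lt_d9, Real.exp_pos (1 / 2 : ℝ)]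
  have hint : ∀ u : ℝ, Integrable (fun z : Fin N → Z => Real.exp (u * avg f z))
      (Measure.pi fun _ : Fin N => π) := by
    intro u
    obtain ⟨C, hC⟩ := ((hb.avg (N := N)).const_mul u).bdd
    refine BddMeas.integrable ⟨((hb.avg.const_mul u).meas).exp, Real.exp C, fun z => ?_⟩ _
    rw [Real.abs_exp]
    exact Real.exp_le_exp.mpr ((le_abs_self _).trans (hC z))
  have hpt : ∀ z : Fin N → Z, |avg f z| ^ p
      ≤ p.factorial / t ^ p * (Real.exp (t * avg f z) + Real.exp (-t * avg f z)) := by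
    intro z
    have h1 := Real.pow_div_factorial_le_exp (t * |avg f z|) (by positivity) p
    have h2 : Real.exp (t * |avg f z|) ≤ Real.exp (t * avg f z) + Real.exp (-t * avg f z) := by
      rcases abs_cases (avg f z) with ⟨h, _⟩ | ⟨h, _⟩ <;> rw [h]
      · linarith [Real.exp_pos (-t * avg f z)]
      · rw [mul_neg, ← neg_mul]
        linarith [Real.exp_pos (t * avg f z)]
    have h3 := h1.trans h2
    rw [div_le_iff₀ (by positivity), mul_pow] at h3
    rw [div_mul_eq_mul_div, le_div_iff₀ (by positivity)]
    linarith
  calc ∫ z, |avg f z| ^ p ∂Measure.pi (fun _ : Fin N => π)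
      ≤ ∫ z, p.factorial / t ^ p * (Real.exp (t * avg f z) + Real.exp (-t * avg f z))
          ∂Measure.pi (fun _ : Fin N => π) :=
        integral_mono ((hb.avg.abs.pow p).integrable _)
          (((hint t).add (hint (-t))).const_mul _) hpt
    _ ≤ p.factorial / t ^ p * (2 + 2) := by
        rw [integral_const_mul, integral_add (hint t) (hint (-t))]
        have h1 := hexp t (Or.inl rfl)
        have h2 := hexp (-t) (Or.inr rfl)
        gcongr
    _ = 4 * p.factorial * (m / √N) ^ p := by
        rw [ht, div_pow, div_pow]
        field_simp
        ring

end Averages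

/-! ### Self-normalised averages -/

section Ratio

variable {Z : Type*} [MeasurableSpace Z] {N : ℕ} [NeZero N]

/-- Data for a self-normalised importance sampling estimate with independent draws from `π`:
`D` is its error as an estimate of the ratio `c = ∫ V r dπ / ∫ V dπ`, and `U = V (r - c)`. Of `D`,
only the identity `D * avg V = avg U` is required; where `avg V` vanishes, `D` is thus free up to
the bound `δ`. -/
structure RatioError (π : Measure Z) (V U : Z → ℝ) (vmax vmin δ : ℝ)
    (D : (Fin N → Z) → ℝ) : Prop where
  measV : Measurable V
  measU : Measurable U
  V_nonneg : ∀ x, 0 ≤ V x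
  V_le : ∀ x, V x ≤ vmax
  U_le : ∀ x, |U x| ≤ δ * V x
  vmin_pos : 0 < vmin
  vmin_le : vmin ≤ ∫ x, V x ∂π
  integral_U : ∫ x, U x ∂π = 0
  measD : Measurable D
  D_le : ∀ z, |D z| ≤ δ
  D_mul : ∀ z, D z * avg V z = avg U z

namespace RatioError

variable {π : Measure Z} [IsProbabilityMeasure π] {V U : Z → ℝ} {vmax vmin δ : ℝ}
  {D : (Fin N → Z) → ℝ}

section

omit [NeZero N]

lemma vmax_nonneg (h : RatioError π V U vmax vmin δ D) : 0 ≤ vmax :=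
  have ⟨x⟩ : Nonempty Z := nonempty_of_isProbabilityMeasure π
  (h.V_nonneg x).trans (h.V_le x)

lemma delta_nonneg (h : RatioError π V U vmax vmin δ D) : 0 ≤ δ :=
  have ⟨x⟩ : Nonempty Z := nonempty_of_isProbabilityMeasure π
  (abs_nonneg _).trans (h.D_le fun _ => x)

omit [IsProbabilityMeasure π] in
lemma bddMeas_V (h : RatioError π V U vmax vmin δ D) : BddMeas V :=
  ⟨h.measV, vmax, fun x => by rw [abs_of_nonneg (h.V_nonneg x)]; exact h.V_le x⟩

lemma abs_U_le (h : RatioError π V U vmax vmin δ D) (x : Z) : |U x| ≤ δ * vmax :=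
  (h.U_le x).trans (mul_le_mul_of_nonneg_left (h.V_le x) h.delta_nonneg)

lemma bddMeas_U (h : RatioError π V U vmax vmin δ D) : BddMeas U :=
  ⟨h.measU, δ * vmax, h.abs_U_le⟩

omit [IsProbabilityMeasure π] in
lemma bddMeas_D (h : RatioError π V U vmax vmin δ D) : BddMeas D := ⟨h.measD, δ, h.D_le⟩

lemma abs_V_sub_le (h : RatioError π V U vmax vmin δ D) (x : Z) :
    |V x - ∫ x, V x ∂π| ≤ vmax := by
  have h1 : ∫ x, V x ∂π ≤ vmax := by
    have := integral_mono (h.bddMeas_V.integrable π) ((BddMeas.const vmax).integrable π) h.V_le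
    simpa using this
  have h2 : 0 ≤ ∫ x, V x ∂π := integral_nonneg h.V_nonneg
  rw [abs_le]
  constructor <;> linarith [h.V_nonneg x, h.V_le x]

lemma integral_V_sub (h : RatioError π V U vmax vmin δ D) :
    ∫ x, (V x - ∫ x, V x ∂π) ∂π = 0 := by
  rw [integral_sub (h.bddMeas_V.integrable π) (integrable_const _)]
  simp

end

lemma integral_abs_avg_U_pow_le (h : RatioError π V U vmax vmin δ D) {p : ℕ} (hp : p ≠ 0) :
    ∫ z, |avg U z| ^ p ∂Measure.pi (fun _ : Fin N => π)
      ≤ 4 * p.factorial * (δ * vmax / √N) ^ p :=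
  integral_abs_avg_pow_le π h.measU h.abs_U_le h.integral_U hp

lemma integral_abs_avg_V_sub_pow_le (h : RatioError π V U vmax vmin δ D) {p : ℕ} (hp : p ≠ 0) :
    ∫ z, |avg V z - ∫ x, V x ∂π| ^ p ∂Measure.pi (fun _ : Fin N => π)
      ≤ 4 * p.factorial * (vmax / √N) ^ p := by
  simp_rw [← avg_sub_const]
  exact integral_abs_avg_pow_le π (h.measV.sub_const _) h.abs_V_sub_le h.integral_V_sub hp

/-- Moments of the error of a self-normalised estimate. From `D * avg V = avg U`, with `E = ∫ V dπ`,
`D = avg U / E + D (E - avg V) / E`, so that the random denominator disappears. -/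
lemma integral_abs_pow_le (h : RatioError π V U vmax vmin δ D) {p : ℕ} (hp : p ≠ 0) :
    ∫ z, |D z| ^ p ∂Measure.pi (fun _ : Fin N => π)
      ≤ (8 * p.factorial * (δ * (vmax / vmin) / √N)) ^ p := by
  set E := ∫ x, V x ∂π with hE
  have hEpos : 0 < E := h.vmin_pos.trans_le h.vmin_le
  have hδ := h.delta_nonneg
  have hv := h.vmax_nonneg
  have hvm := h.vmin_pos
  have hbV : BddMeas fun z : Fin N → Z => avg V z - E := h.bddMeas_V.avg.sub (BddMeas.const E)
  have hpt : ∀ z, |D z| ^ p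
      ≤ 2 ^ (p - 1) * ((E ^ p)⁻¹ * |avg U z| ^ p + δ ^ p * (E ^ p)⁻¹ * |avg V z - E| ^ p) := by
    intro z
    have h1 : D z = avg U z / E + D z * (E - avg V z) / E := by
      rw [← h.D_mul z]; field_simp; ring
    have h2 : |D z| ≤ |avg U z| / E + δ * |avg V z - E| / E := by
      conv_lhs => rw [h1]
      refine (abs_add_le _ _).trans ?_
      rw [abs_div, abs_div, abs_mul, abs_of_pos hEpos, abs_sub_comm E]
      gcongr
      exact h.D_le z
    calc |D z| ^ p ≤ (|avg U z| / E + δ * |avg V z - E| / E) ^ p := by gcongr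
      _ ≤ 2 ^ (p - 1) * ((|avg U z| / E) ^ p + (δ * |avg V z - E| / E) ^ p) :=
          add_pow_le (by positivity) (by positivity) p
      _ = _ := by rw [div_pow, div_pow, mul_pow]; ring
  have hi1 := ((h.bddMeas_U.avg (N := N)).abs.pow p).integrable (Measure.pi fun _ : Fin N => π)
  have hi2 := (hbV.abs.pow p).integrable (Measure.pi fun _ : Fin N => π)
  calc ∫ z, |D z| ^ p ∂Measure.pi (fun _ : Fin N => π)
      ≤ ∫ z, 2 ^ (p - 1) * ((E ^ p)⁻¹ * |avg U z| ^ p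
          + δ ^ p * (E ^ p)⁻¹ * |avg V z - E| ^ p) ∂Measure.pi (fun _ : Fin N => π) :=
        integral_mono ((h.bddMeas_D.abs.pow p).integrable _)
          (((hi1.const_mul _).add (hi2.const_mul _)).const_mul _) hpt
    _ ≤ 2 ^ (p - 1) * ((E ^ p)⁻¹ * (4 * p.factorial * (δ * vmax / √N) ^ p)
          + δ ^ p * (E ^ p)⁻¹ * (4 * p.factorial * (vmax / √N) ^ p)) := by
        rw [integral_const_mul, integral_add (hi1.const_mul _) (hi2.const_mul _),
          integral_const_mul, integral_const_mul]
        have := h.integral_abs_avg_U_pow_le (N := N) hp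
        have := h.integral_abs_avg_V_sub_pow_le (N := N) hp
        gcongr
    _ = 2 ^ (p - 1) * 2 * (4 * p.factorial) * (δ * (vmax / E) / √N) ^ p := by
        simp only [div_pow, mul_pow]
        field_simp
        ring
    _ = 2 ^ p * (4 * p.factorial) * (δ * (vmax / E) / √N) ^ p := by
        rw [pow_sub_one_mul hp]
    _ ≤ 2 ^ p * (4 * p.factorial) ^ p * (δ * (vmax / vmin) / √N) ^ p := by
        have h1 : (1 : ℝ) ≤ p.factorial := by exact_mod_cast Nat.one_le_iff_ne_zero.mpr p.factorial_ne_zero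
        have h2 : (4 * p.factorial : ℝ) ≤ (4 * p.factorial) ^ p :=
          le_self_pow₀ (by linarith) hp
        have := h.vmin_le
        gcongr
    _ = (8 * p.factorial * (δ * (vmax / vmin) / √N)) ^ p := by
        rw [← mul_pow, ← mul_pow]; ring

/-- The bias of a self-normalised estimate is of order `1 / N`: iterating the decomposition of
`D` once more, `D = avg U / E + avg U (E - avg V) / E ^ 2 + D (E - avg V) ^ 2 / E ^ 2`, where the
first term is centred. -/
lemma abs_integral_le (h : RatioError π V U vmax vmin δ D) :
    |∫ z, D z ∂Measure.pi (fun _ : Fin N => π)| ≤ 16 * (δ * (vmax / vmin) ^ 2 / N) := by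
  set E := ∫ x, V x ∂π with hE
  have hEpos : 0 < E := h.vmin_pos.trans_le h.vmin_le
  have hv := h.vmax_nonneg
  have hvm := h.vmin_pos
  have hN : (0 : ℝ) < N := by exact_mod_cast Nat.pos_of_ne_zero (NeZero.ne N)
  rcases h.delta_nonneg.eq_or_lt with hδ | hδ
  · have hz : ∀ z, D z = 0 := fun z => abs_nonpos_iff.mp (hδ ▸ h.D_le z)
    simp [hz, ← hδ]
  have hbV : BddMeas fun z : Fin N → Z => avg V z - E := h.bddMeas_V.avg.sub (BddMeas.const E)
  have hbU : BddMeas fun z : Fin N → Z => avg U z := h.bddMeas_U.avg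
  have hpt : ∀ z, |D z - E⁻¹ * avg U z| ≤ (E ^ 2)⁻¹ *
      ((2 * δ)⁻¹ * |avg U z| ^ 2 + 3 / 2 * δ * |avg V z - E| ^ 2) := by
    intro z
    have h1 : D z - E⁻¹ * avg U z
        = (E ^ 2)⁻¹ * (avg U z * (E - avg V z) + D z * (E - avg V z) ^ 2) := by
      rw [← h.D_mul z]; field_simp; ring
    rw [h1, abs_mul, abs_of_pos (inv_pos.mpr (pow_pos hEpos 2))]
    gcongr
    refine (abs_add_le _ _).trans ?_
    rw [abs_mul, abs_mul, abs_pow, abs_sub_comm E]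
    -- the arithmetic-geometric mean inequality for `|avg U| / √δ` and `√δ |avg V - E|`
    have h2 : |avg U z| * |avg V z - E|
        ≤ (2 * δ)⁻¹ * |avg U z| ^ 2 + 1 / 2 * δ * |avg V z - E| ^ 2 := by
      have h4 : (2 * δ)⁻¹ * |avg U z| ^ 2 + 1 / 2 * δ * |avg V z - E| ^ 2
          - |avg U z| * |avg V z - E|
          = (2 * δ)⁻¹ * (|avg U z| - δ * |avg V z - E|) ^ 2 := by
        field_simp
        ring
      have h5 : 0 ≤ (2 * δ)⁻¹ * (|avg U z| - δ * |avg V z - E|) ^ 2 := by positivity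
      linarith
    have h3 : |D z| * |avg V z - E| ^ 2 ≤ δ * |avg V z - E| ^ 2 := by
      gcongr
      exact h.D_le z
    linarith
  have hU0 : ∫ z, E⁻¹ * avg U z ∂Measure.pi (fun _ : Fin N => π) = 0 := by
    rw [integral_const_mul, integral_avg π h.bddMeas_U, h.integral_U, mul_zero]
  have hi1 := (hbU.abs.pow 2).integrable (Measure.pi fun _ : Fin N => π)
  have hi2 := (hbV.abs.pow 2).integrable (Measure.pi fun _ : Fin N => π)
  have hD : ∫ z, D z ∂Measure.pi (fun _ : Fin N => π)
      = ∫ z, (D z - E⁻¹ * avg U z) ∂Measure.pi (fun _ : Fin N => π) := by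
    rw [integral_sub (h.bddMeas_D.integrable _) ((hbU.const_mul _).integrable _), hU0, sub_zero]
  have hsq : (√(N : ℝ)) ^ 2 = N := Real.sq_sqrt hN.le
  calc |∫ z, D z ∂Measure.pi (fun _ : Fin N => π)|
      ≤ ∫ z, |D z - E⁻¹ * avg U z| ∂Measure.pi (fun _ : Fin N => π) := by
        rw [hD]; exact abs_integral_le_integral_abs
    _ ≤ ∫ z, (E ^ 2)⁻¹ * ((2 * δ)⁻¹ * |avg U z| ^ 2 + 3 / 2 * δ * |avg V z - E| ^ 2)
          ∂Measure.pi (fun _ : Fin N => π) :=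
        integral_mono (((h.bddMeas_D.sub (hbU.const_mul _)).abs).integrable _)
          (((hi1.const_mul _).add (hi2.const_mul _)).const_mul _) hpt
    _ ≤ (E ^ 2)⁻¹ * ((2 * δ)⁻¹ * (4 * (2 : ℕ).factorial * (δ * vmax / √N) ^ 2)
          + 3 / 2 * δ * (4 * (2 : ℕ).factorial * (vmax / √N) ^ 2)) := by
        rw [integral_const_mul, integral_add (hi1.const_mul _) (hi2.const_mul _),
          integral_const_mul, integral_const_mul]
        have := h.integral_abs_avg_U_pow_le (N := N) two_ne_zero
        have := h.integral_abs_avg_V_sub_pow_le (N := N) two_ne_zero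
        gcongr
    _ = 16 * (δ * (vmax / E) ^ 2 / N) := by
        simp only [div_pow, mul_pow, hsq, Nat.factorial_two]
        push_cast
        field_simp
        ring
    _ ≤ 16 * (δ * (vmax / vmin) ^ 2 / N) := by
        have := h.vmin_le
        gcongr

end RatioError
end Ratio

/-! ### Consequences of the strong mixing assumption -/

namespace Model

variable {X Y Θ : Type*} [MeasurableSpace X] [MeasurableSpace Y] {M : Model X Y Θ}

namespace A1

lemma sigmaMinus_le (_ : M.A1) (θ : Θ) (x x' : X) : M.sigmaMinus ≤ M.q θ x x' :=
  ciInf_le (f := fun p : Θ × X × X => (M.q p.1 p.2.1 p.2.2 : ℝ))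
    ⟨0, by rintro _ ⟨p, rfl⟩; exact NNReal.coe_nonneg _⟩ (θ, x, x')

lemma le_sigmaPlus (h : M.A1) (θ : Θ) (x x' : X) : (M.q θ x x' : ℝ) ≤ M.sigmaPlus :=
  le_ciSup (f := fun p : Θ × X × X => (M.q p.1 p.2.1 p.2.2 : ℝ)) h.sigmaPlus_finite (θ, x, x')

lemma sigmaMinus_le_sigmaPlus (h : M.A1) (θ : Θ) : M.sigmaMinus ≤ M.sigmaPlus :=
  have ⟨x⟩ : Nonempty X := nonempty_of_isProbabilityMeasure M.μ
  (h.sigmaMinus_le θ x x).trans (h.le_sigmaPlus θ x x)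

lemma sigmaPlus_pos (h : M.A1) (θ : Θ) : 0 < M.sigmaPlus :=
  h.sigmaMinus_pos.trans_le (h.sigmaMinus_le_sigmaPlus θ)

lemma rho_nonneg (h : M.A1) (θ : Θ) : 0 ≤ M.rho :=
  sub_nonneg.mpr ((div_le_one (h.sigmaPlus_pos θ)).mpr (h.sigmaMinus_le_sigmaPlus θ))

lemma one_sub_rho : 1 - M.rho = M.sigmaMinus / M.sigmaPlus := by simp [rho]

lemma one_sub_rho_pos (h : M.A1) (θ : Θ) : 0 < 1 - M.rho := by
  rw [one_sub_rho]
  exact div_pos h.sigmaMinus_pos (h.sigmaPlus_pos θ)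

lemma rho_lt_one (h : M.A1) (θ : Θ) : M.rho < 1 := sub_pos.mp (h.one_sub_rho_pos θ)

lemma one_sub_rho_mul (h : M.A1) (θ : Θ) : (1 - M.rho) * M.sigmaPlus = M.sigmaMinus := by
  rw [one_sub_rho, div_mul_cancel₀ _ (h.sigmaPlus_pos θ).ne']

lemma muG_pos (h : M.A1) (θ : Θ) (y : Y) : 0 < M.muG θ y :=
  (h.inf_muG_pos y).trans_le (ciInf_le (f := fun θ => M.muG θ y)
    ⟨0, by rintro _ ⟨θ, rfl⟩; exact integral_nonneg fun _ => NNReal.coe_nonneg _⟩ θ)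

lemma bddMeas_g (h : M.A1) (θ : Θ) (y : Y) : BddMeas fun x => (M.g θ x y : ℝ) := by
  refine ⟨((M.measurable_g θ).comp (measurable_id.prodMk measurable_const)).coe_nnreal_real,
    ⨆ p : Θ × X, (M.g p.1 p.2 y : ℝ), fun x => ?_⟩
  rw [abs_of_nonneg (NNReal.coe_nonneg _)]
  exact le_ciSup (f := fun p : Θ × X => (M.g p.1 p.2 y : ℝ)) (h.sup_g_finite y) (θ, x)

lemma bddMeas_q (h : M.A1) (θ : Θ) : BddMeas fun p : X × X => (M.q θ p.1 p.2 : ℝ) :=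
  ⟨(M.measurable_q θ).coe_nnreal_real, M.sigmaPlus, fun p => by
    rw [abs_of_nonneg (NNReal.coe_nonneg _)]
    exact h.le_sigmaPlus θ p.1 p.2⟩

lemma bddMeas_q_right (h : M.A1) (θ : Θ) (x : X) : BddMeas fun x' => (M.q θ x x' : ℝ) :=
  (h.bddMeas_q θ).comp (measurable_const.prodMk measurable_id)

/-- Integration against `Q_θ(x, dx') g_θ(x', y)` is comparable, up to the factors `σ₋` and `σ₊`,
to integration against `μ(dx') g_θ(x', y)`. -/
lemma integral_q_mul_g_mul_bounds (h : M.A1) (θ : Θ) (y : Y) (x : X) {w : X → ℝ} (hw : BddMeas w)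
    (hw0 : ∀ x, 0 ≤ w x) :
    M.sigmaMinus * ∫ x', M.g θ x' y * w x' ∂M.μ ≤ ∫ x', M.q θ x x' * (M.g θ x' y * w x') ∂M.μ ∧
    ∫ x', M.q θ x x' * (M.g θ x' y * w x') ∂M.μ
      ≤ M.sigmaPlus * ∫ x', M.g θ x' y * w x' ∂M.μ := by
  have hb := (h.bddMeas_g θ y).mul hw
  have hnn : ∀ x', 0 ≤ M.g θ x' y * w x' := fun x' => mul_nonneg (NNReal.coe_nonneg _) (hw0 x')
  rw [← integral_const_mul, ← integral_const_mul]
  exact ⟨integral_mono ((hb.const_mul _).integrable _)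
      (((h.bddMeas_q_right θ x).mul hb).integrable _)
      fun x' => mul_le_mul_of_nonneg_right (h.sigmaMinus_le θ x x') (hnn x'),
    integral_mono (((h.bddMeas_q_right θ x).mul hb).integrable _) ((hb.const_mul _).integrable _)
      fun x' => mul_le_mul_of_nonneg_right (h.le_sigmaPlus θ x x') (hnn x')⟩

end A1

/-! ### The unnormalised prediction operators -/

/-- One step of the unnormalised filtering recursion on path space: the integral of
`F(x_{0:m}, x')` over `Q_θ(x_m, dx') g_θ(x', y_{m+1})`. -/
def step (M : Model X Y Θ) (θ : Θ) (y : ℕ → Y) (m : ℕ) (F : (ℕ → X) → ℝ) (x : ℕ → X) : ℝ :=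
  ∫ x', M.q θ (x m) x' * (M.g θ x' (y (m + 1)) * F (extend m (x, x'))) ∂M.μ

/-- The composition of the `d` operators `step` at the times `m, …, m + d - 1`. -/
def iter (M : Model X Y Θ) (θ : Θ) (y : ℕ → Y) : ℕ → ℕ → ((ℕ → X) → ℝ) → (ℕ → X) → ℝ
  | _, 0, F => F
  | m, d + 1, F => M.step θ y m (iter M θ y (m + 1) d F)

variable {θ : Θ} {y : ℕ → Y}

lemma bddMeas_integrand (h : M.A1) (m : ℕ) {F : (ℕ → X) → ℝ} (hF : BddMeas F) :
    BddMeas fun p : (ℕ → X) × X =>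
      M.q θ (p.1 m) p.2 * (M.g θ p.2 (y (m + 1)) * F (extend m p)) :=
  ((h.bddMeas_q θ).comp (((measurable_pi_apply m).comp measurable_fst).prodMk
    measurable_snd)).mul (((h.bddMeas_g θ (y (m + 1))).comp measurable_snd).mul
      (hF.comp (measurable_extend m)))

lemma bddMeas_integrand_right (h : M.A1) (m : ℕ) {F : (ℕ → X) → ℝ} (hF : BddMeas F) (x : ℕ → X) :
    BddMeas fun x' => M.q θ (x m) x' * (M.g θ x' (y (m + 1)) * F (extend m (x, x'))) :=
  (bddMeas_integrand (θ := θ) (y := y) h m hF).comp (measurable_const.prodMk measurable_id)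

lemma bddMeas_step (h : M.A1) (m : ℕ) {F : (ℕ → X) → ℝ} (hF : BddMeas F) :
    BddMeas (M.step θ y m F) := by
  have hb := bddMeas_integrand (θ := θ) (y := y) h m hF
  obtain ⟨C, hC⟩ := hb.bdd
  refine ⟨(hb.meas.stronglyMeasurable.integral_prod_right' (ν := M.μ)).measurable, C,
    fun x => ?_⟩
  have := norm_integral_le_of_norm_le_const (μ := M.μ)
    (f := fun x' => M.q θ (x m) x' * (M.g θ x' (y (m + 1)) * F (extend m (x, x'))))
    (ae_of_all _ fun x' => (hC (x, x') : ‖_‖ ≤ C))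
  simpa [step] using this

lemma bddMeas_iter (h : M.A1) (d m : ℕ) {F : (ℕ → X) → ℝ} (hF : BddMeas F) :
    BddMeas (M.iter θ y m d F) := by
  induction d generalizing m with
  | zero => exact hF
  | succ d ih => exact bddMeas_step h m (ih (m + 1))

lemma step_const_mul (m : ℕ) (c : ℝ) (F : (ℕ → X) → ℝ) (x : ℕ → X) :
    M.step θ y m (fun x => c * F x) x = c * M.step θ y m F x := by
  rw [step, step, ← integral_const_mul]
  exact integral_congr_ae (ae_of_all _ fun x' => by ring)

lemma step_sub (h : M.A1) (m : ℕ) {F G : (ℕ → X) → ℝ} (hF : BddMeas F) (hG : BddMeas G)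
    (x : ℕ → X) :
    M.step θ y m (fun x => F x - G x) x = M.step θ y m F x - M.step θ y m G x := by
  rw [step, step, step, ← integral_sub ((bddMeas_integrand_right h m hF x).integrable _)
    ((bddMeas_integrand_right h m hG x).integrable _)]
  exact integral_congr_ae (ae_of_all _ fun x' => by ring)

lemma step_nonneg (m : ℕ) {F : (ℕ → X) → ℝ} (hF : ∀ x, 0 ≤ F x) (x : ℕ → X) :
    0 ≤ M.step θ y m F x :=
  integral_nonneg fun _ =>
    mul_nonneg (NNReal.coe_nonneg _) (mul_nonneg (NNReal.coe_nonneg _) (hF _))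

lemma iter_const_mul (d m : ℕ) (c : ℝ) (F : (ℕ → X) → ℝ) (x : ℕ → X) :
    M.iter θ y m d (fun x => c * F x) x = c * M.iter θ y m d F x := by
  induction d generalizing m x with
  | zero => rfl
  | succ d ih =>
    have : M.iter θ y (m + 1) d (fun x => c * F x) = fun x => c * M.iter θ y (m + 1) d F x :=
      funext (ih (m + 1))
    rw [iter, this, step_const_mul, iter]

lemma iter_sub (h : M.A1) (d m : ℕ) {F G : (ℕ → X) → ℝ} (hF : BddMeas F) (hG : BddMeas G)
    (x : ℕ → X) :
    M.iter θ y m d (fun x => F x - G x) x = M.iter θ y m d F x - M.iter θ y m d G x := by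
  induction d generalizing m x with
  | zero => rfl
  | succ d ih =>
    have : M.iter θ y (m + 1) d (fun x => F x - G x)
        = fun x => M.iter θ y (m + 1) d F x - M.iter θ y (m + 1) d G x := funext (ih (m + 1))
    rw [iter, this, step_sub h m (bddMeas_iter h d _ hF) (bddMeas_iter h d _ hG), iter, iter]

lemma iter_nonneg (d m : ℕ) {F : (ℕ → X) → ℝ} (hF : ∀ x, 0 ≤ F x) (x : ℕ → X) :
    0 ≤ M.iter θ y m d F x := by
  induction d generalizing m x with
  | zero => exact hF x
  | succ d ih => exact step_nonneg m (ih (m + 1)) x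

/-- Factors depending only on the path up to time `m` can be taken out of `iter m d`. -/
lemma iter_mul_of_dependsOn (d m : ℕ) {F G : (ℕ → X) → ℝ} (hF : DependsOn F (Set.Iic m))
    (x : ℕ → X) :
    M.iter θ y m d (fun x => F x * G x) x = F x * M.iter θ y m d G x := by
  induction d generalizing m x with
  | zero => rfl
  | succ d ih =>
    have h1 : M.iter θ y (m + 1) d (fun x => F x * G x)
        = fun x => F x * M.iter θ y (m + 1) d G x :=
      funext (ih (m + 1) (hF.mono (Set.Iic_subset_Iic.mpr m.le_succ)))
    rw [iter, h1, step, iter, step, ← integral_const_mul]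
    refine integral_congr_ae (ae_of_all _ fun x' => ?_)
    have h2 : F (extend m (x, x')) = F x := hF fun i hi => by
      simp [extend, Set.mem_Iic.mp hi]
    simp only [h2]
    ring

lemma dependsOn_iter (d : ℕ) {m j : ℕ} (hj : j ≤ m) {F : (ℕ → X) → ℝ}
    (hF : DependsOn F (Set.Ici j)) : DependsOn (M.iter θ y m d F) (Set.Ici j) := by
  induction d generalizing m with
  | zero => exact hF
  | succ d ih =>
    intro x x' hx
    refine integral_congr_ae (ae_of_all _ fun z => ?_)
    have h2 : M.iter θ y (m + 1) d F (extend m (x, z))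
        = M.iter θ y (m + 1) d F (extend m (x', z)) := ih (Nat.le_succ_of_le hj) fun i hi => by
      simp only [extend, hx i hi]
    simp only [h2, hx m (Set.mem_Ici.mpr hj)]

/-! ### Forgetting in the forward direction -/

lemma A1.integral_g_mul_pos (h : M.A1) (θ : Θ) (y : Y) {w : X → ℝ} (hw : BddMeas w) {l : ℝ}
    (hl : 0 < l) (hlw : ∀ x, l ≤ w x) : 0 < ∫ x, M.g θ x y * w x ∂M.μ := by
  have h1 : ∫ x, M.g θ x y * l ∂M.μ ≤ ∫ x, M.g θ x y * w x ∂M.μ :=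
    integral_mono (((h.bddMeas_g θ _).mul (BddMeas.const l)).integrable _)
      (((h.bddMeas_g θ _).mul hw).integrable _)
      fun x => mul_le_mul_of_nonneg_left (hlw x) (NNReal.coe_nonneg _)
  rw [integral_mul_const] at h1
  exact (mul_pos (h.muG_pos θ y) hl).trans_le h1

/-- The function `iter m d 1` is comparable to a constant, up to a factor `1 - ρ = σ₋ / σ₊`. -/
lemma exists_iter_one_bounds (h : M.A1) (θ : Θ) (y : ℕ → Y) (d m : ℕ) :
    ∃ l > 0, ∀ x, l ≤ M.iter θ y m d (fun _ => 1) x ∧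
      M.iter θ y m d (fun _ => 1) x ≤ l / (1 - M.rho) := by
  have hr := h.one_sub_rho_pos θ
  induction d generalizing m with
  | zero =>
    refine ⟨1, one_pos, fun x => ⟨le_rfl, ?_⟩⟩
    rw [iter, le_div_iff₀ hr]
    linarith [h.rho_nonneg θ]
  | succ d ih =>
    obtain ⟨l, hl, hb⟩ := ih (m + 1)
    set v := M.iter θ y (m + 1) d (fun _ => 1) with hv
    have hbv : BddMeas v := bddMeas_iter h d _ (BddMeas.const 1)
    -- the function `iter (m + 1) d 1` depends only on the path after time `m`
    have hdep : DependsOn v (Set.Ici (m + 1)) :=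
      dependsOn_iter d le_rfl ((dependsOn_const (1 : ℝ)).mono (Set.empty_subset _))
    set w : X → ℝ := fun x' => v fun _ => x' with hw
    have hbw : BddMeas w := hbv.comp (measurable_pi_lambda _ fun _ => measurable_id)
    have hvw : ∀ x x', v (extend m (x, x')) = w x' := fun x x' => hdep fun i hi => by
      have : ¬ i ≤ m := by simpa using hi
      simp [extend, this]
    have hpos : 0 < ∫ x', M.g θ x' (y (m + 1)) * w x' ∂M.μ :=
      h.integral_g_mul_pos θ _ hbw hl fun _ => (hb _).1
    refine ⟨M.sigmaMinus * ∫ x', M.g θ x' (y (m + 1)) * w x' ∂M.μ,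
      mul_pos h.sigmaMinus_pos hpos, fun x => ?_⟩
    have h2 := h.integral_q_mul_g_mul_bounds θ (y (m + 1)) (x m) hbw
      fun x' => hl.le.trans (hb _).1
    rw [iter, step, ← hv]
    simp only [hvw]
    refine ⟨h2.1, h2.2.trans_eq ?_⟩
    rw [eq_div_iff hr.ne', ← h.one_sub_rho_mul θ]
    ring

lemma iter_one_pos (h : M.A1) (θ : Θ) (y : ℕ → Y) (d m : ℕ) (x : ℕ → X) :
    0 < M.iter θ y m d (fun _ => 1) x := by
  obtain ⟨l, hl, hb⟩ := exists_iter_one_bounds h θ y d m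
  exact hl.trans_le (hb x).1

lemma iter_mono (h : M.A1) (d m : ℕ) {F G : (ℕ → X) → ℝ} (hF : BddMeas F) (hG : BddMeas G)
    (hle : ∀ x, F x ≤ G x) (x : ℕ → X) : M.iter θ y m d F x ≤ M.iter θ y m d G x := by
  have := iter_nonneg (M := M) (θ := θ) (y := y) d m (F := fun x => G x - F x)
    (fun x => sub_nonneg.mpr (hle x)) x
  rw [iter_sub h d m hG hF] at this
  linarith

lemma iter_abs_le (h : M.A1) (d m : ℕ) {F : (ℕ → X) → ℝ} (hF : BddMeas F) {S : ℝ}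
    (hS : ∀ x, |F x| ≤ S) (x : ℕ → X) :
    -S * M.iter θ y m d (fun _ => 1) x ≤ M.iter θ y m d F x ∧
      M.iter θ y m d F x ≤ S * M.iter θ y m d (fun _ => 1) x := by
  rw [← iter_const_mul, ← iter_const_mul]
  have hc : ∀ c : ℝ, BddMeas fun _ : ℕ → X => c * 1 := fun c => BddMeas.const _
  exact ⟨iter_mono h d m (hc _) hF (fun x => by linarith [(abs_le.mp (hS x)).1]) x,
    iter_mono h d m hF (hc _) (fun x => by linarith [(abs_le.mp (hS x)).2]) x⟩

/-- An upper bound `c` for the ratio `u / v` improves, under one step of the prediction operator,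
to the convex combination `ρ c + (1 - ρ) e` with the ratio `e` of the integrals of `u` and `v`
against `μ(dx') g(x', y)`. -/
lemma step_ratio_le (h : M.A1) (θ : Θ) (y : Y) (x : X) {u v : X → ℝ} (hu : BddMeas u)
    (hv : BddMeas v) (hv0 : ∀ x, 0 ≤ v x) {c : ℝ} (hc : ∀ x, u x ≤ c * v x)
    {e : ℝ} (he : ∫ x', M.g θ x' y * u x' ∂M.μ = e * ∫ x', M.g θ x' y * v x' ∂M.μ)
    (hec : e ≤ c) :
    ∫ x', M.q θ x x' * (M.g θ x' y * u x') ∂M.μ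
      ≤ (M.rho * c + (1 - M.rho) * e) * ∫ x', M.q θ x x' * (M.g θ x' y * v x') ∂M.μ := by
  have hr := h.one_sub_rho_pos θ
  have hw : BddMeas fun x => c * v x - u x := (hv.const_mul c).sub hu
  have h1 := (h.integral_q_mul_g_mul_bounds θ y x hw fun x => sub_nonneg.mpr (hc x)).1
  have h2 := (h.integral_q_mul_g_mul_bounds θ y x hv hv0).2
  have hg := h.bddMeas_g θ y
  have hq := h.bddMeas_q_right θ x
  have e1 : ∫ x', M.g θ x' y * (c * v x' - u x') ∂M.μ
      = (c - e) * ∫ x', M.g θ x' y * v x' ∂M.μ := by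
    rw [sub_mul, ← he, ← integral_const_mul,
      ← integral_sub (((hg.mul hv).const_mul c).integrable _) ((hg.mul hu).integrable _)]
    exact integral_congr_ae (ae_of_all _ fun x' => by ring)
  have e2 : ∫ x', M.q θ x x' * (M.g θ x' y * (c * v x' - u x')) ∂M.μ
      = c * ∫ x', M.q θ x x' * (M.g θ x' y * v x') ∂M.μ
        - ∫ x', M.q θ x x' * (M.g θ x' y * u x') ∂M.μ := by
    rw [← integral_const_mul, ← integral_sub (((hq.mul (hg.mul hv)).const_mul c).integrable _)
      ((hq.mul (hg.mul hu)).integrable _)]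
    exact integral_congr_ae (ae_of_all _ fun x' => by ring)
  rw [e1, e2, ← h.one_sub_rho_mul θ] at h1
  have h3 := mul_le_mul_of_nonneg_left h2 (mul_nonneg hr.le (sub_nonneg.mpr hec))
  linarith

/-- Given the observations, the latent chain forgets its state at time `m` at the rate `ρ`: the
conditional expectation of `s(X_k, X_{k+1})` given `X_m`, which is the ratio of `iter m d F` to
`iter m d 1`, oscillates by at most `2 S ρ ^ (k - m)`. -/
lemma exists_iter_bracket (h : M.A1) (θ : Θ) (y : ℕ → Y) {F : (ℕ → X) → ℝ} (hF : BddMeas F)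
    {S : ℝ} (hS : ∀ x, |F x| ≤ S) {k : ℕ} (hk : DependsOn F (Set.Ici k)) (d m : ℕ)
    (hkm : k < m + d) :
    ∃ a c : ℝ, c - a ≤ 2 * S * M.rho ^ (k - m) ∧
      ∀ x, a * M.iter θ y m d (fun _ => 1) x ≤ M.iter θ y m d F x ∧
        M.iter θ y m d F x ≤ c * M.iter θ y m d (fun _ => 1) x := by
  have hr := h.one_sub_rho_pos θ
  have htriv : ∀ d m, k ≤ m → ∃ a c : ℝ, c - a ≤ 2 * S * M.rho ^ (k - m) ∧
      ∀ x, a * M.iter θ y m d (fun _ => 1) x ≤ M.iter θ y m d F x ∧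
        M.iter θ y m d F x ≤ c * M.iter θ y m d (fun _ => 1) x := fun d m hle => by
    refine ⟨-S, S, ?_, iter_abs_le h d m hF hS⟩
    rw [Nat.sub_eq_zero_of_le hle, pow_zero]
    linarith
  induction d generalizing m with
  | zero => exact htriv 0 m (by omega)
  | succ d ih =>
    rcases le_or_gt k m with hle | hlt
    · exact htriv _ m hle
    obtain ⟨a, c, hac, hb⟩ := ih (m + 1) (by omega)
    set V := M.iter θ y (m + 1) d (fun _ => 1) with hV
    set U := M.iter θ y (m + 1) d F with hU
    have hbV : BddMeas V := bddMeas_iter h d _ (BddMeas.const 1)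
    have hbU : BddMeas U := bddMeas_iter h d _ hF
    have hdV : DependsOn V (Set.Ici (m + 1)) :=
      dependsOn_iter d le_rfl ((dependsOn_const (1 : ℝ)).mono (Set.empty_subset _))
    have hdU : DependsOn U (Set.Ici (m + 1)) :=
      dependsOn_iter d le_rfl (hk.mono (Set.Ici_subset_Ici.mpr hlt))
    have hcm : Measurable fun (x : X) (_ : ℕ) => x := measurable_pi_lambda _ fun _ => measurable_id
    set v : X → ℝ := fun x' => V fun _ => x' with hv
    set u : X → ℝ := fun x' => U fun _ => x' with hu
    have hbv : BddMeas v := hbV.comp hcm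
    have hbu : BddMeas u := hbU.comp hcm
    have hext : ∀ (G : (ℕ → X) → ℝ), DependsOn G (Set.Ici (m + 1)) → ∀ x x',
        G (extend m (x, x')) = G fun _ => x' := fun G hG x x' => hG fun i hi => by
      have : ¬ i ≤ m := by simpa using hi
      simp [extend, this]
    have hv0 : ∀ x, 0 ≤ v x := fun x => (iter_one_pos h θ y d (m + 1) _).le
    have hgv : 0 < ∫ x', M.g θ x' (y (m + 1)) * v x' ∂M.μ := by
      obtain ⟨l, hl, hlb⟩ := exists_iter_one_bounds h θ y d (m + 1)
      exact h.integral_g_mul_pos θ _ hbv hl fun _ => (hlb _).1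
    set e := (∫ x', M.g θ x' (y (m + 1)) * u x' ∂M.μ) / ∫ x', M.g θ x' (y (m + 1)) * v x' ∂M.μ
      with he
    have heq : ∫ x', M.g θ x' (y (m + 1)) * u x' ∂M.μ
        = e * ∫ x', M.g θ x' (y (m + 1)) * v x' ∂M.μ := (div_mul_cancel₀ _ hgv.ne').symm
    have hg := h.bddMeas_g θ (y (m + 1))
    have hec : e ≤ c := by
      rw [he, div_le_iff₀ hgv, ← integral_const_mul]
      refine integral_mono ((hg.mul hbu).integrable _) (((hg.mul hbv).const_mul c).integrable _)
        fun x' => ?_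
      have := mul_le_mul_of_nonneg_left (hb fun _ => x').2 (NNReal.coe_nonneg (M.g θ x' (y (m + 1))))
      simp only [hu, hv]
      linarith
    have hae : a ≤ e := by
      rw [he, le_div_iff₀ hgv, ← integral_const_mul]
      refine integral_mono (((hg.mul hbv).const_mul a).integrable _) ((hg.mul hbu).integrable _)
        fun x' => ?_
      have := mul_le_mul_of_nonneg_left (hb fun _ => x').1 (NNReal.coe_nonneg (M.g θ x' (y (m + 1))))
      simp only [hu, hv]
      linarith
    refine ⟨M.rho * a + (1 - M.rho) * e, M.rho * c + (1 - M.rho) * e, ?_, fun x => ?_⟩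
    · calc M.rho * c + (1 - M.rho) * e - (M.rho * a + (1 - M.rho) * e) = M.rho * (c - a) := by ring
        _ ≤ M.rho * (2 * S * M.rho ^ (k - (m + 1))) :=
            mul_le_mul_of_nonneg_left hac (h.rho_nonneg θ)
        _ = 2 * S * M.rho ^ (k - m) := by
            rw [show k - m = k - (m + 1) + 1 by omega, pow_succ]; ring
    · simp only [iter, step, ← hU, ← hV, hext U hdU, hext V hdV]
      constructor
      · -- the lower bound is the upper bound for `-u`
        have h1 := step_ratio_le h θ (y (m + 1)) (x m) (u := fun x' => -1 * u x') (c := -a)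
          (hbu.const_mul _) hbv hv0
          (fun x' => by have := (hb fun _ => x').1; simp only [hu, hv]; linarith) (e := -e)
          (by
            rw [neg_mul, ← heq, ← integral_neg]
            exact integral_congr_ae (ae_of_all _ fun x' => by ring))
          (neg_le_neg hae)
        have h2 : ∫ x', M.q θ (x m) x' * (M.g θ x' (y (m + 1)) * (-1 * u x')) ∂M.μ
            = -1 * ∫ x', M.q θ (x m) x' * (M.g θ x' (y (m + 1)) * u x') ∂M.μ := by
          rw [← integral_const_mul]
          exact integral_congr_ae (ae_of_all _ fun x' => by ring)
        rw [h2] at h1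
        linarith
      · exact step_ratio_le h θ (y (m + 1)) (x m) hbu hbv hv0 (fun x' => (hb fun _ => x').2) heq hec

end Model

namespace Model
variable {X Y Θ : Type*} [MeasurableSpace X] [MeasurableSpace Y] {M : Model X Y Θ}
  {θ : Θ} {y : ℕ → Y}

/-! ### The unnormalised smoothing distribution -/

/-- The unnormalised smoothing distribution: `E_θ[F(X_{0:n}) ∏_{k ≤ n} g_θ(X_k, y_k)]`. -/
def joint (M : Model X Y Θ) (θ : Θ) (y : ℕ → Y) (n : ℕ) (F : (ℕ → X) → ℝ) : ℝ :=
  ∫ x, M.obsDensity θ n y x * F x ∂M.latentLaw θ n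

lemma measurable_obsDensity (M : Model X Y Θ) (θ : Θ) (n : ℕ) :
    Measurable fun p : (ℕ → Y) × (ℕ → X) => M.obsDensity θ n p.1 p.2 := by
  refine Finset.measurable_prod _ fun k _ => ?_
  have h : Measurable fun p : (ℕ → Y) × (ℕ → X) => (p.2 k, p.1 k) :=
    ((measurable_pi_apply k).comp measurable_snd).prodMk
      ((measurable_pi_apply k).comp measurable_fst)
  exact (M.measurable_g θ).comp h

lemma bddMeas_obsDensity (h : M.A1) (n : ℕ) :
    BddMeas fun x => (M.obsDensity θ n y x : ℝ) := by
  induction n with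
  | zero => simpa [obsDensity] using (h.bddMeas_g θ (y 0)).comp (measurable_pi_apply 0)
  | succ n ih =>
    have := ih.mul ((h.bddMeas_g θ (y (n + 1))).comp (measurable_pi_apply (n + 1)))
    simpa [obsDensity, Finset.prod_range_succ _ (n + 1)] using this

lemma bddMeas_jointIntegrand (h : M.A1) (n : ℕ) {F : (ℕ → X) → ℝ} (hF : BddMeas F) :
    BddMeas fun x => M.obsDensity θ n y x * F x :=
  (bddMeas_obsDensity h n).mul hF

lemma joint_zero (h : M.A1) {F : (ℕ → X) → ℝ} (hF : BddMeas F) :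
    M.joint θ y 0 F = ∫ x, M.g θ x (y 0) * F (fun _ => x) ∂M.ν := by
  have hm : Measurable fun (x : X) (_ : ℕ) => x := measurable_pi_lambda _ fun _ => measurable_id
  rw [joint, latentLaw, integral_map hm.aemeasurable
    (bddMeas_jointIntegrand h 0 hF).meas.aestronglyMeasurable]
  simp [obsDensity]

lemma joint_succ (h : M.A1) (n : ℕ) {F : (ℕ → X) → ℝ} (hF : BddMeas F) :
    M.joint θ y (n + 1) F = M.joint θ y n (M.step θ y n F) := by
  have hb := (bddMeas_jointIntegrand (θ := θ) (y := y) h (n + 1) hF)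
  rw [joint, latentLaw, integral_map (measurable_extend n).aemeasurable
    hb.meas.aestronglyMeasurable,
    Measure.integral_compProd ((hb.comp (measurable_extend n)).integrable _), joint]
  refine integral_congr_ae (ae_of_all _ fun x => ?_)
  have h1 : ∀ x', (M.obsDensity θ (n + 1) y (extend n (x, x')) : ℝ)
      = M.obsDensity θ n y x * M.g θ x' (y (n + 1)) := fun x' => by
    rw [obsDensity, Finset.prod_range_succ, NNReal.coe_mul, obsDensity]
    have : ∏ k ∈ range (n + 1), M.g θ (extend n (x, x') k) (y k)
        = ∏ k ∈ range (n + 1), M.g θ (x k) (y k) := Finset.prod_congr rfl fun k hk => by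
      simp [extend, Nat.lt_succ_iff.mp (Finset.mem_range.mp hk)]
    rw [this]
    simp [extend]
  simp only [Kernel.comap_apply, M.Q_eq, h1]
  have hq : Measurable fun x' => M.q θ (x n) x' :=
    (M.measurable_q θ).comp (measurable_const.prodMk measurable_id)
  rw [integral_withDensity_eq_integral_smul hq, step, ← integral_const_mul]
  refine integral_congr_ae (ae_of_all _ fun x' => ?_)
  simp only [NNReal.smul_def, smul_eq_mul]
  ring

lemma joint_add (h : M.A1) (d m : ℕ) {F : (ℕ → X) → ℝ} (hF : BddMeas F) :
    M.joint θ y (m + d) F = M.joint θ y m (M.iter θ y m d F) := by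
  induction d generalizing m with
  | zero => rfl
  | succ d ih =>
    rw [show m + (d + 1) = m + 1 + d by ring, ih, joint_succ h m (bddMeas_iter h d _ hF), iter]

lemma joint_const_mul (n : ℕ) (c : ℝ) (F : (ℕ → X) → ℝ) :
    M.joint θ y n (fun x => c * F x) = c * M.joint θ y n F := by
  rw [joint, joint, ← integral_const_mul]
  exact integral_congr_ae (ae_of_all _ fun x' => by ring)

lemma joint_add_fun (h : M.A1) (n : ℕ) {F G : (ℕ → X) → ℝ} (hF : BddMeas F) (hG : BddMeas G) :
    M.joint θ y n (fun x => F x + G x) = M.joint θ y n F + M.joint θ y n G := by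
  rw [joint, joint, joint, ← integral_add ((bddMeas_jointIntegrand h n hF).integrable _)
    ((bddMeas_jointIntegrand h n hG).integrable _)]
  exact integral_congr_ae (ae_of_all _ fun x' => by ring)

lemma joint_mono (h : M.A1) (n : ℕ) {F G : (ℕ → X) → ℝ} (hF : BddMeas F) (hG : BddMeas G)
    (hle : ∀ x, F x ≤ G x) : M.joint θ y n F ≤ M.joint θ y n G :=
  integral_mono ((bddMeas_jointIntegrand h n hF).integrable _)
    ((bddMeas_jointIntegrand h n hG).integrable _)
    fun x => mul_le_mul_of_nonneg_left (hle x) (NNReal.coe_nonneg _)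

lemma joint_one_pos (h : M.A1) (hν : 0 < M.nuG θ (y 0)) (n : ℕ) :
    0 < M.joint θ y n fun _ => 1 := by
  obtain ⟨l, hl, hb⟩ := exists_iter_one_bounds h θ y n 0
  have h1 : M.joint θ y n (fun _ => 1) = M.joint θ y 0 (M.iter θ y 0 n fun _ => 1) := by
    simpa using joint_add (θ := θ) (y := y) h n 0 (F := fun _ => 1) (BddMeas.const 1)
  have h2 : l * M.nuG θ (y 0) = M.joint θ y 0 fun _ => l * 1 := by
    rw [joint_const_mul, joint_zero h (BddMeas.const 1), nuG]
    simp
  rw [h1]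
  refine (mul_pos hl hν).trans_le (h2.trans_le
    (joint_mono h 0 (BddMeas.const _) (bddMeas_iter h n 0 (BddMeas.const 1)) fun x => ?_))
  simpa using (hb x).1

/-- The smoothing distribution is the normalised version of `joint`. -/
lemma integral_smoothing (n : ℕ) (F : (ℕ → X) → ℝ) :
    ∫ x, F x ∂M.smoothing θ n y = M.joint θ y n F / M.joint θ y n fun _ => 1 := by
  have hmeas : Measurable fun x => M.obsDensity θ n y x :=
    (M.measurable_obsDensity θ n).comp (measurable_const.prodMk measurable_id)
  have hL : (M.likelihood θ n y).toReal = M.joint θ y n fun _ => 1 := by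
    simp only [joint, mul_one, likelihood]
    rw [integral_eq_lintegral_of_nonneg_ae (ae_of_all _ fun _ => NNReal.coe_nonneg _)
      hmeas.coe_nnreal_real.aestronglyMeasurable]
    simp
  rw [smoothing, integral_smul_measure, integral_withDensity_eq_integral_smul hmeas,
    ENNReal.toReal_inv, hL, smul_eq_mul, inv_mul_eq_div]
  rfl

lemma gamma_eq (h : M.A1) (n : ℕ) {s : ℕ → X → X → ℝ}
    (hs : ∀ k < n, BddMeas fun x : ℕ → X => s k (x k) (x (k + 1))) :
    M.gamma θ n y s = ∑ k ∈ range n,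
      M.joint θ y n (fun x => s k (x k) (x (k + 1))) / M.joint θ y n fun _ => 1 := by
  rw [gamma, integral_smoothing, ← Finset.sum_div]
  congr 1
  simp only [joint, Finset.mul_sum]
  exact integral_finsetSum _ fun k hk =>
    (bddMeas_jointIntegrand h n (hs k (Finset.mem_range.mp hk))).integrable _

/-! ### Forgetting in the backward direction -/

/-- For every density `b` on the state at time `T`, the ratio of `joint (F b)` to `joint b` lies
between `a` and `c`. In other words, the conditional expectation of `F` given `X_T` and `Y_{0:T}`
does. -/
def Bracket (M : Model X Y Θ) (θ : Θ) (y : ℕ → Y) (F : (ℕ → X) → ℝ) (T : ℕ) (a c : ℝ) : Prop :=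
  ∀ b : X → ℝ, BddMeas b → (∀ x, 0 ≤ b x) →
    a * M.joint θ y T (fun x => b (x T)) ≤ M.joint θ y T (fun x => F x * b (x T)) ∧
    M.joint θ y T (fun x => F x * b (x T)) ≤ c * M.joint θ y T (fun x => b (x T))

lemma bracket_of_abs_le (h : M.A1) {F : (ℕ → X) → ℝ} (hF : BddMeas F) {S : ℝ}
    (hS : ∀ x, |F x| ≤ S) (T : ℕ) : M.Bracket θ y F T (-S) S := by
  intro b hb hb0
  have hbT : BddMeas fun x : ℕ → X => b (x T) := hb.comp (measurable_pi_apply T)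
  rw [← joint_const_mul, ← joint_const_mul]
  exact ⟨joint_mono h T (hbT.const_mul _) (hF.mul hbT) fun x =>
      mul_le_mul_of_nonneg_right (abs_le.mp (hS x)).1 (hb0 _),
    joint_mono h T (hF.mul hbT) (hbT.const_mul _) fun x =>
      mul_le_mul_of_nonneg_right (abs_le.mp (hS x)).2 (hb0 _)⟩

lemma Bracket.ratio_mem {F : (ℕ → X) → ℝ} {T : ℕ} {a c : ℝ} (hB : M.Bracket θ y F T a c)
    (h : M.A1) (hν : 0 < M.nuG θ (y 0)) :
    a ≤ M.joint θ y T F / M.joint θ y T (fun _ => 1) ∧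
      M.joint θ y T F / M.joint θ y T (fun _ => 1) ≤ c := by
  have h1 := hB (fun _ => 1) (BddMeas.const 1) fun _ => zero_le_one
  simp only [mul_one] at h1
  have hpos := joint_one_pos h hν T
  exact ⟨(le_div_iff₀ hpos).mpr h1.1, (div_le_iff₀ hpos).mpr h1.2⟩

/-- One further observation contracts the bracket by the factor `ρ` towards the current ratio:
the density `b` is replaced by its image under the prediction operator, which is bounded below by
`σ₋ ∫ g b dμ`. -/
lemma Bracket.succ {F : (ℕ → X) → ℝ} {T : ℕ} {a c : ℝ} (hB : M.Bracket θ y F T a c)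
    (h : M.A1) (hν : 0 < M.nuG θ (y 0)) (hF : BddMeas F) (hdep : DependsOn F (Set.Iic T)) :
    M.Bracket θ y F (T + 1)
      (M.rho * a + (1 - M.rho) * (M.joint θ y T F / M.joint θ y T fun _ => 1))
      (M.rho * c + (1 - M.rho) * (M.joint θ y T F / M.joint θ y T fun _ => 1)) := by
  intro b hb hb0
  obtain ⟨hae, hec⟩ := hB.ratio_mem h hν
  set e := M.joint θ y T F / M.joint θ y T fun _ => 1 with he
  have hpos := joint_one_pos h hν T
  have hr := h.one_sub_rho_pos θ
  have heq : M.joint θ y T F = e * M.joint θ y T fun _ => 1 := (div_mul_cancel₀ _ hpos.ne').symm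
  have hbT : BddMeas fun x : ℕ → X => b (x (T + 1)) := hb.comp (measurable_pi_apply (T + 1))
  set C := ∫ x', M.g θ x' (y (T + 1)) * b x' ∂M.μ with hC
  set b' : X → ℝ := fun x => ∫ x', M.q θ x x' * (M.g θ x' (y (T + 1)) * b x') ∂M.μ with hb'
  have hbds : ∀ x, M.sigmaMinus * C ≤ b' x ∧ b' x ≤ M.sigmaPlus * C := fun x =>
    h.integral_q_mul_g_mul_bounds θ (y (T + 1)) x hb hb0
  have hstep : ∀ x, M.step θ y T (fun x => b (x (T + 1))) x = b' (x T) := fun x => by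
    simp [step, extend, hb']
  have hC0 : 0 ≤ C := integral_nonneg fun x => mul_nonneg (NNReal.coe_nonneg _) (hb0 x)
  have hbb' : BddMeas b' := by
    have h1 := bddMeas_step (θ := θ) (y := y) h T hbT
    have h2 := h1.comp (measurable_pi_lambda (fun (x : X) (_ : ℕ) => x) fun _ => measurable_id)
    simpa only [hstep] using h2
  have hbb'T : BddMeas fun x : ℕ → X => b' (x T) := hbb'.comp (measurable_pi_apply T)
  have e1 : M.joint θ y (T + 1) (fun x => b (x (T + 1))) = M.joint θ y T fun x => b' (x T) := by
    rw [joint_succ h T hbT]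
    exact congrArg _ (funext hstep)
  have e2 : M.joint θ y (T + 1) (fun x => F x * b (x (T + 1)))
      = M.joint θ y T fun x => F x * b' (x T) := by
    rw [joint_succ h T (hF.mul hbT)]
    refine congrArg _ (funext fun x => ?_)
    have := iter_mul_of_dependsOn (M := M) (θ := θ) (y := y) 1 T hdep
      (G := fun x => b (x (T + 1))) x
    simp only [iter] at this
    rw [this, hstep]
  set J := M.joint θ y T fun _ => 1 with hJ
  have hw := hB (fun x => b' x - M.sigmaMinus * C) (hbb'.sub (BddMeas.const _))
    fun x => sub_nonneg.mpr (hbds x).1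
  have e3 : M.joint θ y T (fun x => b' (x T) - M.sigmaMinus * C)
      = M.joint θ y T (fun x => b' (x T)) - M.sigmaMinus * C * J := by
    have := joint_add_fun (θ := θ) (y := y) h T hbb'T (BddMeas.const (-(M.sigmaMinus * C) * 1))
    rw [joint_const_mul] at this
    simp only [mul_one, ← sub_eq_add_neg] at this
    rw [this]; ring
  have e4 : M.joint θ y T (fun x => F x * (b' (x T) - M.sigmaMinus * C))
      = M.joint θ y T (fun x => F x * b' (x T)) - M.sigmaMinus * C * (e * J) := by
    have := joint_add_fun (θ := θ) (y := y) h T (hF.mul hbb'T)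
      (hF.const_mul (-(M.sigmaMinus * C)))
    rw [joint_const_mul, heq] at this
    rw [sub_eq_add_neg, ← neg_mul, ← this]
    exact congrArg _ (funext fun x => by ring)
  have hup : M.joint θ y T (fun x => b' (x T)) ≤ M.sigmaPlus * C * J := by
    rw [← joint_const_mul]
    exact joint_mono h T hbb'T (BddMeas.const _) fun x => by simpa using (hbds (x T)).2
  -- the constant part of `b'` carries at least the fraction `1 - ρ` of the mass
  have hfrac : (1 - M.rho) * M.joint θ y T (fun x => b' (x T)) ≤ M.sigmaMinus * C * J := by
    refine (mul_le_mul_of_nonneg_left hup hr.le).trans_eq ?_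
    rw [← h.one_sub_rho_mul θ]; ring
  simp only [e3, e4] at hw
  rw [e1, e2]
  have h1 := mul_le_mul_of_nonneg_left hfrac (sub_nonneg.mpr hec)
  have h2 := mul_le_mul_of_nonneg_left hfrac (sub_nonneg.mpr hae)
  constructor
  · linarith [hw.1]
  · linarith [hw.2]

/-- After `d` further observations the bracket has length at most `2 S ρ ^ d`; the brackets are
nested. -/
lemma exists_bracket (h : M.A1) (hν : 0 < M.nuG θ (y 0)) {F : (ℕ → X) → ℝ} (hF : BddMeas F)
    {S : ℝ} (hS : ∀ x, |F x| ≤ S) {T : ℕ} (hdep : DependsOn F (Set.Iic T)) (d : ℕ) :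
    ∃ a c, c - a ≤ 2 * S * M.rho ^ d ∧ M.Bracket θ y F (T + d) a c := by
  induction d with
  | zero => exact ⟨-S, S, by rw [pow_zero]; linarith, bracket_of_abs_le h hF hS T⟩
  | succ d ih =>
    obtain ⟨a, c, hac, hB⟩ := ih
    refine ⟨_, _, ?_, hB.succ h hν hF (hdep.mono (Set.Iic_subset_Iic.mpr (by omega)))⟩
    have := mul_le_mul_of_nonneg_left hac (h.rho_nonneg θ)
    rw [pow_succ]
    linarith

/-- The effect of observations after the lag `d`: conditioning on `Y_{0:n}` instead of `Y_{0:T+d}`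
changes the expectation of a function of `X_{0:T}` by at most `2 S ρ ^ (d + 1)`. -/
lemma abs_ratio_sub_ratio_le (h : M.A1) (hν : 0 < M.nuG θ (y 0)) {F : (ℕ → X) → ℝ}
    (hF : BddMeas F) {S : ℝ} (hS : ∀ x, |F x| ≤ S) {T : ℕ} (hdep : DependsOn F (Set.Iic T))
    {d n : ℕ} (hn : T + d < n) :
    |M.joint θ y (T + d) F / M.joint θ y (T + d) (fun _ => 1)
        - M.joint θ y n F / M.joint θ y n (fun _ => 1)| ≤ 2 * S * M.rho ^ (d + 1) := by
  obtain ⟨a, c, hac, hB⟩ := exists_bracket h hν hF hS hdep d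
  have hdep' := hdep.mono (Set.Iic_subset_Iic.mpr (Nat.le_add_right T d))
  have hB' := hB.succ h hν hF hdep'
  obtain ⟨hae, hec⟩ := hB.ratio_mem h hν
  set e := M.joint θ y (T + d) F / M.joint θ y (T + d) fun _ => 1 with he
  obtain ⟨r, rfl⟩ : ∃ r, n = T + d + 1 + r := ⟨n - (T + d + 1), by omega⟩
  set v := M.iter θ y (T + d + 1) r (fun _ => 1) with hv
  have hbv : BddMeas v := bddMeas_iter h r _ (BddMeas.const 1)
  have hdv : DependsOn v (Set.Ici (T + d + 1)) :=
    dependsOn_iter r le_rfl ((dependsOn_const (1 : ℝ)).mono (Set.empty_subset _))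
  have hr0 := h.rho_nonneg θ
  have hr1 := h.one_sub_rho_pos θ
  have hJ := joint_one_pos h hν (T + d + 1 + r)
  have hb : BddMeas fun x' : X => v fun _ => x' :=
    hbv.comp (measurable_pi_lambda _ fun _ => measurable_id)
  -- `v` is a function of the state at time `T + d + 1`
  have hvx : ∀ G : (ℕ → X) → ℝ, BddMeas G →
      M.joint θ y (T + d + 1) (fun x => G x * v x)
        = M.joint θ y (T + d + 1) (fun x => G x * v fun _ => x (T + d + 1)) := by
    intro G hG
    have hmm : Measurable fun (x : ℕ → X) (_ : ℕ) => x (T + d + 1) :=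
      measurable_pi_lambda _ fun _ => measurable_pi_apply _
    rw [joint_succ h _ (hG.mul hbv), joint_succ h _ (hG.mul (hbv.comp hmm))]
    refine congrArg _ (funext fun x => integral_congr_ae (ae_of_all _ fun x' => ?_))
    have h1 : v (extend (T + d) (x, x')) = v fun _ => extend (T + d) (x, x') (T + d + 1) :=
      hdv fun i hi => by
        have : ¬ i ≤ T + d := by simpa using hi
        simp [extend, this]
    simp only [h1]
  have e1 : M.joint θ y (T + d + 1 + r) F
      = M.joint θ y (T + d + 1) (fun x => F x * v fun _ => x (T + d + 1)) := by
    rw [joint_add h r _ hF, ← hvx F hF]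
    refine congrArg _ (funext fun x => ?_)
    have := iter_mul_of_dependsOn (M := M) (θ := θ) (y := y) r (T + d + 1)
      (hdep.mono (Set.Iic_subset_Iic.mpr (by omega : T ≤ T + d + 1))) (G := fun _ => 1) x
    simpa using this
  have e2 : M.joint θ y (T + d + 1 + r) (fun _ => 1)
      = M.joint θ y (T + d + 1) (fun x => v fun _ => x (T + d + 1)) := by
    have := hvx (fun _ => 1) (BddMeas.const 1)
    simp only [one_mul] at this
    rw [joint_add h r _ (BddMeas.const 1), this]
  have h1 := hB' _ hb fun x => (iter_one_pos h θ y r _ _).le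
  rw [← e1, ← e2] at h1
  have h2 := (le_div_iff₀ hJ).mpr h1.1
  have h3 := (div_le_iff₀ hJ).mpr h1.2
  have h4 := mul_le_mul_of_nonneg_left hac hr0
  have h5 := mul_nonneg hr0 (sub_nonneg.mpr hae)
  have h6 := mul_nonneg hr0 (sub_nonneg.mpr hec)
  have h7 := mul_nonneg hr1.le (sub_nonneg.mpr hae)
  rw [pow_succ, abs_le]
  constructor <;> linarith

end Model

/-! ### Independent sampling in two stages -/

section PiBind

variable {α β : Type*} [MeasurableSpace α] [MeasurableSpace β] {N : ℕ}

lemma piKernel_apply {ι α β : Type*} [Fintype ι] [MeasurableSpace α] [MeasurableSpace β]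
    (κ : ι → Kernel α β) [∀ i, IsMarkovKernel (κ i)] (a : α) :
    piKernel κ a = Measure.pi fun i => κ i a := rfl

/-- Drawing `z i` independently from `π`, then moving each of them independently with `κ`, amounts
to drawing independently from the mixture `κ ∘ₘ π`. -/
lemma pi_bind_piKernel (π : Measure α) [IsProbabilityMeasure π] (κ : Kernel α β)
    [IsMarkovKernel κ] :
    (Measure.pi fun _ : Fin N => π).bind
        (piKernel fun i : Fin N => κ.comap (fun z : Fin N → α => z i) (measurable_pi_apply i))
      = Measure.pi fun _ : Fin N => π.bind κ := by
  refine (Measure.pi_eq fun s hs => ?_).symm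
  rw [Measure.bind_apply (MeasurableSet.univ_pi hs) (Kernel.aemeasurable _)]
  simp only [piKernel_apply, Kernel.comap_apply, Measure.pi_pi]
  have hm : ∀ i, Measurable fun x => κ x (s i) := fun i => κ.measurable_coe (hs i)
  have hind : iIndepFun (fun (i : Fin N) (z : Fin N → α) => κ (z i) (s i))
      (Measure.pi fun _ : Fin N => π) :=
    iIndepFun_pi fun i => (hm i).aemeasurable
  rw [lintegral_prod_eq_prod_lintegral_of_indepFun _ _ hind
    fun i => (hm i).comp (measurable_pi_apply i)]
  refine Finset.prod_congr rfl fun i _ => ?_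
  rw [Measure.bind_apply (hs i) (Kernel.aemeasurable _)]
  have hmp := measurePreserving_eval (fun _ : Fin N => π) i
  conv_rhs => rw [← hmp.map_eq]
  exact (lintegral_map (hm i) hmp.measurable).symm

/-- A bound for the conditional expectation is a bound for the expectation. -/
lemma abs_integral_le_of_map_eq_compProd {Ω : Type*} [MeasurableSpace Ω] {Pr : Measure Ω}
    [IsProbabilityMeasure Pr] {Z₁ : Ω → α} {Z₂ : Ω → β} (h₁ : Measurable Z₁) (h₂ : Measurable Z₂)
    {κ : Kernel α β} [IsMarkovKernel κ]
    (hmap : Pr.map (fun ω => (Z₁ ω, Z₂ ω)) = Pr.map Z₁ ⊗ₘ κ) {D : α × β → ℝ} (hD : BddMeas D)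
    {b : ℝ} (hb : ∀ a, |∫ z, D (a, z) ∂κ a| ≤ b) :
    |∫ ω, D (Z₁ ω, Z₂ ω) ∂Pr| ≤ b := by
  have : IsProbabilityMeasure (Pr.map Z₁) := Measure.isProbabilityMeasure_map h₁.aemeasurable
  have h3 : ∫ ω, D (Z₁ ω, Z₂ ω) ∂Pr = ∫ a, ∫ z, D (a, z) ∂κ a ∂Pr.map Z₁ := by
    rw [← Measure.integral_compProd (hD.integrable _), ← hmap,
      integral_map (h₁.prodMk h₂).aemeasurable hD.meas.aestronglyMeasurable]
  rw [h3]
  simpa using norm_integral_le_of_norm_le_const (μ := Pr.map Z₁) 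
    (f := fun a => ∫ z, D (a, z) ∂κ a) (ae_of_all _ fun a => (hb a : ‖_‖ ≤ b))

end PiBind

/-! ### The genealogy of the particle system -/

section Paths

variable {X : Type*} {N : ℕ}

lemma path_succ (h : ℕ → Step X N) (k : ℕ) (i : Fin N) :
    path h (k + 1) i = extend k (resampledPath h k i, (h (k + 1)).1 i) := rfl

lemma path_self (h : ℕ → Step X N) (k : ℕ) (i : Fin N) : path h k i k = (h k).1 i := by
  cases k with
  | zero => rfl
  | succ k => simp [path]

lemma resampledPath_self (h : ℕ → Step X N) (k : ℕ) (i : Fin N) :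
    resampledPath h k i k = parent k i h := path_self h k _

lemma path_congr {h h' : ℕ → Step X N} (m : ℕ) (hlt : ∀ i < m, h i = h' i)
    (hm : (h m).1 = (h' m).1) : path h m = path h' m := by
  induction m with
  | zero => funext i j; simp [path, hm]
  | succ m ih =>
    have := ih (fun i hi => hlt i (by omega)) (by rw [hlt m (by omega)])
    funext i j
    simp [path, hm, this, hlt m (by omega)]

lemma dependsOn_path (m : ℕ) :
    DependsOn (fun h : ℕ → Step X N => path h m) (Set.Iic m) := fun h h' hh =>
  path_congr m (fun i hi => hh i (Set.mem_Iic.mpr hi.le)) (by rw [hh m (Set.mem_Iic.mpr le_rfl)])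

lemma dependsOn_resampledPath (m : ℕ) :
    DependsOn (fun h : ℕ → Step X N => resampledPath h m) (Set.Iic m) := fun h h' hh => by
  have h1 : path h m = path h' m := dependsOn_path m hh
  funext j
  simp only [resampledPath, h1, hh m (Set.mem_Iic.mpr le_rfl)]

/-- The array of the trajectories created at time `m + 1`, given the past. -/
lemma path_extend (m : ℕ) (h : ℕ → Step X N) (x : Fin N → X) (I : Fin N → Fin N) :
    path (extend m (h, (x, I))) (m + 1) = fun i => extend m (resampledPath h m i, x i) := by
  have h1 : resampledPath (extend m (h, (x, I))) m = resampledPath h m :=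
    dependsOn_resampledPath m fun i hi => by simp [extend, Set.mem_Iic.mp hi]
  funext i
  rw [path_succ, h1]
  simp [extend]

lemma resampledPath_extend (m : ℕ) (h : ℕ → Step X N) (x : Fin N → X) (I : Fin N → Fin N) :
    resampledPath (extend m (h, (x, I))) (m + 1)
      = fun j => extend m (resampledPath h m (I j), x (I j)) := by
  funext j
  rw [resampledPath, path_extend]
  simp [extend]

variable [MeasurableSpace X]

lemma measurable_resampledPath_of {m : ℕ}
    (hp : Measurable fun h : ℕ → Step X N => path h m) :
    Measurable fun h : ℕ → Step X N => resampledPath h m := by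
  refine measurable_pi_lambda _ fun j => ?_
  have h1 : Measurable fun p : (Fin N → ℕ → X) × Fin N => p.1 p.2 :=
    measurable_from_prod_countable_left fun i => measurable_pi_apply i
  have h2 : Measurable fun h : ℕ → Step X N => (path h m, (h m).2 j) :=
    hp.prodMk ((measurable_pi_apply j).comp (measurable_snd.comp (measurable_pi_apply m)))
  exact h1.comp h2

lemma measurable_path (m : ℕ) : Measurable fun h : ℕ → Step X N => path h m := by
  induction m with
  | zero =>
    exact measurable_pi_lambda _ fun i => measurable_pi_lambda _ fun _ =>
      (measurable_pi_apply i).comp (measurable_fst.comp (measurable_pi_apply 0))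
  | succ m ih =>
    refine measurable_pi_lambda _ fun i => ?_
    have h2 : Measurable fun h : ℕ → Step X N => (resampledPath h m i, (h (m + 1)).1 i) :=
      ((measurable_pi_apply i).comp (measurable_resampledPath_of ih)).prodMk
        ((measurable_pi_apply i).comp (measurable_fst.comp (measurable_pi_apply (m + 1))))
    exact (measurable_extend m).comp h2

lemma measurable_resampledPath (m : ℕ) :
    Measurable fun h : ℕ → Step X N => resampledPath h m :=
  measurable_resampledPath_of (measurable_path m)

end Paths

namespace Proposal

variable {X Y Θ : Type*} [MeasurableSpace X] [MeasurableSpace Y] {M : Model X Y Θ}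
  (P : Proposal M) (N : ℕ) [NeZero N] (θ : Θ) (y : ℕ → Y)

/-- The weight at time `m` of a particle with trajectory `x`. -/
def weight : ℕ → (ℕ → X) → ℝ≥0
  | 0, x => P.W₀ θ (y 0) (x 0)
  | m + 1, x => P.W m θ (upTo (m + 1) y) (x m) (x (m + 1))

lemma measurable_weight (m : ℕ) : Measurable (P.weight θ y m) := by
  cases m with
  | zero =>
    have h : Measurable fun x : ℕ → X => (y 0, x 0) :=
      measurable_const.prodMk (measurable_pi_apply 0)
    exact (P.measurable_W₀ θ).comp h
  | succ m =>
    have h : Measurable fun x : ℕ → X => (upTo (m + 1) y, x m, x (m + 1)) :=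
      measurable_const.prodMk ((measurable_pi_apply m).prodMk (measurable_pi_apply (m + 1)))
    exact (P.measurable_W m θ).comp h

end Proposal

/-- The law of one draw from the points `ξ j` with probabilities proportional to `ω (ξ j)`. -/
def sampleFrom {Z : Type*} [MeasurableSpace Z] (N : ℕ) {ω : Z → ℝ≥0} (hω : Measurable ω) :
    Kernel (Fin N → Z) Z where
  toFun ξ := ∑ j, (normWeight (fun i => ω (ξ i)) j : ℝ≥0∞) • Measure.dirac (ξ j)
  measurable' := by
    refine Measure.measurable_of_measurable_coe _ fun s hs => ?_
    simp only [Measure.coe_finsetSum, Finset.sum_apply, Measure.smul_apply, smul_eq_mul]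
    refine Finset.measurable_sum _ fun j _ => Measurable.mul ?_ ?_
    · have h : Measurable fun ξ : Fin N → Z => fun i => ω (ξ i) :=
        measurable_pi_lambda _ fun i => hω.comp (measurable_pi_apply i)
      exact ((measurable_normWeight j).comp h).coe_nnreal_ennreal
    · exact (Measure.measurable_dirac.comp (measurable_pi_apply j)) |> fun h =>
        (Measure.measurable_coe hs).comp h

section SampleFrom

variable {Z : Type*} [MeasurableSpace Z] {N : ℕ} {ω : Z → ℝ≥0} (hω : Measurable ω)

lemma sampleFrom_apply (ξ : Fin N → Z) :
    sampleFrom N hω ξ = (select N fun i => ω (ξ i)).map ξ := by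
  change ∑ j, (normWeight (fun i => ω (ξ i)) j : ℝ≥0∞) • Measure.dirac (ξ j)
    = (∑ j, (normWeight (fun i => ω (ξ i)) j : ℝ≥0∞) • Measure.dirac j).map ξ
  have hm : Measurable ξ := measurable_from_top
  rw [← Measure.mapₗ_apply_of_measurable hm, map_sum]
  refine Finset.sum_congr rfl fun j _ => ?_
  rw [Measure.mapₗ_apply_of_measurable hm, Measure.map_smul, Measure.map_dirac' hm]

instance [NeZero N] : IsMarkovKernel (sampleFrom N hω) :=
  ⟨fun ξ => by
    rw [sampleFrom_apply]
    exact Measure.isProbabilityMeasure_map measurable_from_top.aemeasurable⟩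

lemma pi_sampleFrom [NeZero N] (ξ : Fin N → Z) :
    Measure.pi (fun _ : Fin N => sampleFrom N hω ξ)
      = (Measure.pi fun _ : Fin N => select N fun i => ω (ξ i)).map fun I j => ξ (I j) := by
  have hm : Measurable ξ := measurable_from_top
  have : ∀ i : Fin N, IsProbabilityMeasure ((select N fun i => ω (ξ i)).map ξ) := fun _ =>
    Measure.isProbabilityMeasure_map hm.aemeasurable
  simp only [sampleFrom_apply]
  exact (Measure.pi_map_pi (f := fun _ : Fin N => ξ) fun _ => hm.aemeasurable).symm

lemma integral_sampleFrom (ξ : Fin N → Z) {F : Z → ℝ} (hF : Measurable F) :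
    ∫ x, F x ∂sampleFrom N hω ξ = ∑ j, (normWeight (fun i => ω (ξ i)) j : ℝ) * F (ξ j) := by
  change ∫ x, F x ∂(∑ j, (normWeight (fun i => ω (ξ i)) j : ℝ≥0∞) • Measure.dirac (ξ j)) = _
  rw [integral_finsetSum_measure fun j _ => ?_]
  · refine Finset.sum_congr rfl fun j _ => ?_
    rw [integral_smul_measure, integral_dirac' _ _ hF.stronglyMeasurable]
    simp
  · exact (integrable_dirac' hF.stronglyMeasurable (by simp)).smul_measure (by simp)

end SampleFrom

namespace Proposal

variable {X Y Θ : Type*} [MeasurableSpace X] [MeasurableSpace Y] {M : Model X Y Θ}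
  (P : Proposal M) (N : ℕ) [NeZero N] (θ : Θ) (y : ℕ → Y)

/-- Prolongs a trajectory up to time `m` by a draw from the proposal kernel. -/
def prolong (m : ℕ) : Kernel (ℕ → X) (ℕ → X) where
  toFun x := (P.R m θ (upTo (m + 1) y, x m)).map fun x' => extend m (x, x')
  measurable' := by
    refine Measure.measurable_of_measurable_coe _ fun s hs => ?_
    have hφ : Measurable fun x : ℕ → X => (upTo (m + 1) y, x m) :=
      measurable_const.prodMk (measurable_pi_apply m)
    have h1 : ∀ x : ℕ → X, (P.R m θ (upTo (m + 1) y, x m)).map (fun x' => extend m (x, x')) s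
        = (P.R m θ).comap _ hφ x (Prod.mk x ⁻¹' (extend m ⁻¹' s)) := fun x => by
      have h2 : Measurable fun x' => extend m (x, x') :=
        (measurable_extend m).comp measurable_prodMk_left
      rw [Measure.map_apply h2 hs, Kernel.comap_apply]
      rfl
    simp only [h1]
    exact Kernel.measurable_kernel_prodMk_left (measurable_extend m hs)

lemma prolong_apply (m : ℕ) (x : ℕ → X) :
    P.prolong θ y m x = (P.R m θ (upTo (m + 1) y, x m)).map fun x' => extend m (x, x') := rfl

instance (m : ℕ) : IsMarkovKernel (P.prolong θ y m) :=
  ⟨fun x => by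
    rw [prolong_apply]
    exact Measure.isProbabilityMeasure_map
      ((measurable_extend m).comp measurable_prodMk_left).aemeasurable⟩

/-- The law of one resampled and prolonged trajectory, given the array of the trajectories up to
time `m`. -/
def move (m : ℕ) : Kernel (Fin N → ℕ → X) (ℕ → X) :=
  P.prolong θ y m ∘ₖ sampleFrom N (P.measurable_weight θ y m)

instance (m : ℕ) : IsMarkovKernel (P.move N θ y m) := by unfold move; infer_instance

lemma lintegral_particleLaw_succ (m : ℕ) {G : (ℕ → Step X N) → ℝ≥0∞} (hG : Measurable G) :
    ∫⁻ h, G h ∂P.particleLaw N θ (m + 1) y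
      = ∫⁻ h, ∫⁻ x, ∫⁻ I, G (extend m (h, (x, I))) ∂P.resample N θ m ((y, h), x)
          ∂P.mutate N θ m (y, h) ∂P.particleLaw N θ m y := by
  have hGe : Measurable fun z => G (extend m z) := hG.comp (measurable_extend m)
  rw [particleLaw, Kernel.map_apply _ (measurable_extend m), lintegral_map hG (measurable_extend m),
    Kernel.lintegral_compProd _ _ _ hGe]
  refine lintegral_congr fun h => ?_
  have hGh : Measurable fun z => G (extend m (h, z)) := hGe.comp measurable_prodMk_left
  rw [Kernel.lintegral_compProd _ _ _ hGh]

lemma lintegral_particleLaw_zero {G : (ℕ → Step X N) → ℝ≥0∞} (hG : Measurable G) :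
    ∫⁻ h, G h ∂P.particleLaw N θ 0 y
      = ∫⁻ x, ∫⁻ I, G (fun _ => (x, I)) ∂P.resampleInit N θ (y, x)
          ∂Measure.pi fun _ : Fin N => P.init θ := by
  have hc : Measurable fun (z : Step X N) (_ : ℕ) => z :=
    measurable_pi_lambda _ fun _ => measurable_id
  have hGc : Measurable fun z : Step X N => G fun _ => z := hG.comp hc
  rw [particleLaw, Kernel.map_apply _ hc, lintegral_map hG hc, initStep,
    Kernel.lintegral_compProd _ _ _ hGc, Kernel.const_apply]

/-- The law of the particle system up to time `T` does not depend on the time horizon. -/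
lemma map_particleLaw_of_dependsOn {β : Type*} [MeasurableSpace β] {T n : ℕ} (hn : T ≤ n)
    {Z : (ℕ → Step X N) → β} (hZ : Measurable Z) (hdep : DependsOn Z (Set.Iic T)) :
    (P.particleLaw N θ n y).map Z = (P.particleLaw N θ T y).map Z := by
  induction n, hn using Nat.le_induction with
  | base => rfl
  | succ n hn ih =>
    rw [← ih]
    refine Measure.ext_of_lintegral _ fun f hf => ?_
    have hfZ : Measurable fun h => f (Z h) := hf.comp hZ
    rw [lintegral_map hf hZ, lintegral_map hf hZ, lintegral_particleLaw_succ P N θ y n hfZ]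
    refine lintegral_congr fun h => ?_
    have : ∀ x I, Z (extend n (h, (x, I))) = Z h := fun x I => hdep fun i hi => by
      simp [extend, (Set.mem_Iic.mp hi).trans hn]
    simp [this]

omit [NeZero N] in
lemma weight_extend (m : ℕ) (h : ℕ → Step X N) (i : Fin N) (x : X) :
    P.weight θ y (m + 1) (extend m (resampledPath h m i, x))
      = P.W m θ (upTo (m + 1) y) (parent m i h) x := by
  simp [weight, extend, resampledPath_self]

/-- Given the trajectories up to time `m`, the resampled ones are independent draws among them. -/
lemma map_path_resampledPath {m n : ℕ} (hn : m ≤ n) :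
    (P.particleLaw N θ n y).map (fun h => (path h m, resampledPath h m))
      = (P.particleLaw N θ n y).map (fun h => path h m)
        ⊗ₘ piKernel fun _ : Fin N => sampleFrom N (P.measurable_weight θ y m) := by
  have hmeas : Measurable fun h : ℕ → Step X N => (path h m, resampledPath h m) :=
    (measurable_path m).prodMk (measurable_resampledPath m)
  rw [map_particleLaw_of_dependsOn P N θ y hn hmeas fun h h' hh => by
      rw [Prod.mk.injEq]; exact ⟨dependsOn_path m hh, dependsOn_resampledPath m hh⟩,
    map_particleLaw_of_dependsOn P N θ y hn (measurable_path m) (dependsOn_path m)]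
  refine Measure.ext_of_lintegral _ fun f hf => ?_
  rw [lintegral_map hf hmeas, Measure.lintegral_compProd hf,
    lintegral_map hf.lintegral_kernel_prod_right' (measurable_path m)]
  set g : (Fin N → ℕ → X) → ℝ≥0∞ := fun ξ =>
    ∫⁻ ζ, f (ξ, ζ) ∂(piKernel fun _ : Fin N => sampleFrom N (P.measurable_weight θ y m)) ξ
  have hg : Measurable g := hf.lintegral_kernel_prod_right'
  have hgI : ∀ ξ : Fin N → ℕ → X, g ξ = ∫⁻ I, f (ξ, fun j => ξ (I j))
      ∂Measure.pi fun _ : Fin N => select N fun i => P.weight θ y m (ξ i) := fun ξ => by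
    have hξ : Measurable fun (I : Fin N → Fin N) j => ξ (I j) :=
      measurable_pi_lambda _ fun j => measurable_from_top.comp (measurable_pi_apply j)
    have hfξ : Measurable fun ζ => f (ξ, ζ) := hf.comp measurable_prodMk_left
    simp only [g, piKernel_apply]
    rw [pi_sampleFrom, lintegral_map hfξ hξ]
  have hf' : Measurable fun h : ℕ → Step X N => f (path h m, resampledPath h m) := hf.comp hmeas
  have hg' : Measurable fun h : ℕ → Step X N => g (path h m) := hg.comp (measurable_path m)
  cases m with
  | zero =>
    rw [lintegral_particleLaw_zero P N θ y hf', lintegral_particleLaw_zero P N θ y hg']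
    refine lintegral_congr fun x => ?_
    have h1 : ∀ I : Fin N → Fin N,
        path (fun _ : ℕ => ((x, I) : Step X N)) 0 = fun i _ => x i := fun I => rfl
    simp only [h1, lintegral_const, measure_univ, mul_one, hgI]
    rfl
  | succ m =>
    rw [lintegral_particleLaw_succ P N θ y m hf', lintegral_particleLaw_succ P N θ y m hg']
    refine lintegral_congr fun h => lintegral_congr fun x => ?_
    simp only [resampledPath_extend, path_extend, lintegral_const, measure_univ, mul_one, hgI]
    have h2 : P.resample N θ m ((y, h), x) = Measure.pi fun _ : Fin N => select N fun i =>
        P.weight θ y (m + 1) (extend m (resampledPath h m i, x i)) := by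
      simp only [weight_extend]
      rfl
    rw [h2]

lemma lintegral_path_succ {β : Type*} [MeasurableSpace β] (m : ℕ) {Z : (ℕ → Step X N) → β}
    (hZ : Measurable Z) (hdep : DependsOn Z (Set.Iic m)) {f : β × (Fin N → ℕ → X) → ℝ≥0∞}
    (hf : Measurable f) :
    ∫⁻ h, f (Z h, path h (m + 1)) ∂P.particleLaw N θ (m + 1) y
      = ∫⁻ h, ∫⁻ η, f (Z h, η) ∂Measure.pi fun i => P.prolong θ y m (resampledPath h m i)
          ∂P.particleLaw N θ m y := by
  have hf' : Measurable fun h : ℕ → Step X N => f (Z h, path h (m + 1)) :=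
    hf.comp (hZ.prodMk (measurable_path (m + 1)))
  rw [lintegral_particleLaw_succ P N θ y m hf']
  refine lintegral_congr fun h => ?_
  have h1 : ∀ x I, Z (extend m (h, (x, I))) = Z h := fun x I => hdep fun i hi => by
    simp [extend, Set.mem_Iic.mp hi]
  simp only [path_extend, h1, lintegral_const, measure_univ, mul_one]
  have hm : ∀ i : Fin N, Measurable fun x' => extend m (resampledPath h m i, x') := fun i =>
    (measurable_extend m).comp measurable_prodMk_left
  have hprob : ∀ i : Fin N, IsProbabilityMeasure
      ((P.R m θ (upTo (m + 1) y, parent m i h)).map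
        fun x' => extend m (resampledPath h m i, x')) := fun i =>
    Measure.isProbabilityMeasure_map (hm i).aemeasurable
  have h2 : (Measure.pi fun i => P.prolong θ y m (resampledPath h m i))
      = (P.mutate N θ m (y, h)).map fun x i => extend m (resampledPath h m i, x i) := by
    simp only [prolong_apply, resampledPath_self]
    exact (Measure.pi_map_pi (f := fun i x' => extend m (resampledPath h m i, x'))
      fun i => (hm i).aemeasurable).symm
  have hpm : Measurable fun (x : Fin N → X) i => extend m (resampledPath h m i, x i) :=
    measurable_pi_lambda _ fun i => (hm i).comp (measurable_pi_apply i)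
  have hfZ : Measurable fun η => f (Z h, η) := hf.comp measurable_prodMk_left
  rw [h2, lintegral_map hfZ hpm]

/-- Given the trajectories up to time `m`, those up to time `m + 1` are independent and
identically distributed. -/
lemma map_path_path_succ {m n : ℕ} (hn : m + 1 ≤ n) :
    (P.particleLaw N θ n y).map (fun h => (path h m, path h (m + 1)))
      = (P.particleLaw N θ n y).map (fun h => path h m)
        ⊗ₘ piKernel fun _ : Fin N => P.move N θ y m := by
  have hmeas : Measurable fun h : ℕ → Step X N => (path h m, path h (m + 1)) :=
    (measurable_path m).prodMk (measurable_path (m + 1))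
  rw [map_particleLaw_of_dependsOn P N θ y hn hmeas fun h h' hh => by
      rw [Prod.mk.injEq]
      exact ⟨((dependsOn_path m).mono (Set.Iic_subset_Iic.mpr m.le_succ)) hh,
        dependsOn_path (m + 1) hh⟩,
    map_particleLaw_of_dependsOn P N θ y (Nat.le_of_succ_le hn) (measurable_path m)
      (dependsOn_path m)]
  refine Measure.ext_of_lintegral _ fun f hf => ?_
  set K : Kernel (Fin N → ℕ → X) (Fin N → ℕ → X) := piKernel fun i : Fin N =>
    (P.prolong θ y m).comap (fun z : Fin N → ℕ → X => z i) (measurable_pi_apply i) with hK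
  set S : Kernel (Fin N → ℕ → X) (Fin N → ℕ → X) :=
    piKernel fun _ : Fin N => sampleFrom N (P.measurable_weight θ y m) with hS
  have hmove : ∀ ξ, (piKernel fun _ : Fin N => P.move N θ y m) ξ = (S ξ).bind K := fun ξ => by
    rw [hS, hK, piKernel_apply, piKernel_apply, pi_bind_piKernel]
    simp only [move, Kernel.comp_apply]
  have hΦ : Measurable fun p : (Fin N → ℕ → X) × (Fin N → ℕ → X) =>
      ∫⁻ η, f (p.1, η) ∂K p.2 := by
    have h1 : Measurable fun q : ((Fin N → ℕ → X) × (Fin N → ℕ → X)) × (Fin N → ℕ → X) =>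
        f (q.1.1, q.2) :=
      hf.comp ((measurable_fst.comp measurable_fst).prodMk measurable_snd)
    exact h1.lintegral_kernel_prod_right' (κ := K.comap Prod.snd measurable_snd)
  have hmeasR : Measurable fun h : ℕ → Step X N => (path h m, resampledPath h m) :=
    (measurable_path m).prodMk (measurable_resampledPath m)
  rw [lintegral_map hf hmeas,
    lintegral_path_succ P N θ y m (measurable_path m) (dependsOn_path m) hf,
    Measure.lintegral_compProd hf]
  calc ∫⁻ h, ∫⁻ η, f (path h m, η) ∂Measure.pi fun i => P.prolong θ y m (resampledPath h m i)
          ∂P.particleLaw N θ m y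
      = ∫⁻ p, ∫⁻ η, f (p.1, η) ∂K p.2
          ∂(P.particleLaw N θ m y).map fun h => (path h m, resampledPath h m) :=
        (lintegral_map hΦ hmeasR).symm
    _ = _ := by
        rw [map_path_resampledPath P N θ y le_rfl, Measure.lintegral_compProd hΦ]
        refine lintegral_congr fun ξ => ?_
        have hfξ : Measurable fun η => f (ξ, η) := hf.comp measurable_prodMk_left
        rw [hmove, Measure.lintegral_bind (Kernel.aemeasurable _) hfξ.aemeasurable]

/-- The initial trajectories are independent draws from the initial proposal distribution. -/
lemma map_path_zero (n : ℕ) :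
    (P.particleLaw N θ n y).map (fun h => path h 0)
      = Measure.pi fun _ : Fin N => (P.init θ).map fun x _ => x := by
  rw [map_particleLaw_of_dependsOn P N θ y n.zero_le (measurable_path 0) (dependsOn_path 0)]
  have hc : Measurable fun (x : X) (_ : ℕ) => x := measurable_pi_lambda _ fun _ => measurable_id
  have hprob : ∀ _ : Fin N, IsProbabilityMeasure ((P.init θ).map fun (x : X) (_ : ℕ) => x) :=
    fun _ => Measure.isProbabilityMeasure_map hc.aemeasurable
  rw [← Measure.pi_map_pi (f := fun _ : Fin N => fun (x : X) (_ : ℕ) => x)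
    fun _ => hc.aemeasurable]
  have hcc : Measurable fun (x : Fin N → X) (i : Fin N) (_ : ℕ) => x i :=
    measurable_pi_lambda _ fun i => hc.comp (measurable_pi_apply i)
  refine Measure.ext_of_lintegral _ fun f hf => ?_
  have hf' : Measurable fun h : ℕ → Step X N => f (path h 0) := hf.comp (measurable_path 0)
  rw [lintegral_map hf (measurable_path 0), lintegral_particleLaw_zero P N θ y hf',
    lintegral_map hf hcc]
  have h1 : ∀ (x : Fin N → X) (I : Fin N → Fin N),
      path (fun _ : ℕ => ((x, I) : Step X N)) 0 = fun i _ => x i := fun _ _ => rfl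
  simp [h1]

end Proposal

/-! ### Weighted means of particles -/

/-- The mean of `F` over the points `ξ j` with the normalised weights `ω (ξ j)`. -/
def selMean {Z : Type*} {N : ℕ} (ω : Z → ℝ≥0) (F : Z → ℝ) (ξ : Fin N → Z) : ℝ :=
  ∑ j, (normWeight (fun i => ω (ξ i)) j : ℝ) * F (ξ j)

section SelMean

variable {Z : Type*} {N : ℕ} {ω : Z → ℝ≥0}

lemma selMean_const_mul (c : ℝ) (F : Z → ℝ) (ξ : Fin N → Z) :
    selMean ω (fun x => c * F x) ξ = c * selMean ω F ξ := by
  simp only [selMean, Finset.mul_sum]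
  exact Finset.sum_congr rfl fun j _ => by ring

lemma selMean_sub (F G : Z → ℝ) (ξ : Fin N → Z) :
    selMean ω (fun x => F x - G x) ξ = selMean ω F ξ - selMean ω G ξ := by
  simp only [selMean, ← Finset.sum_sub_distrib]
  exact Finset.sum_congr rfl fun j _ => by ring

lemma selMean_mono {F G : Z → ℝ} (h : ∀ x, F x ≤ G x) (ξ : Fin N → Z) :
    selMean ω F ξ ≤ selMean ω G ξ :=
  Finset.sum_le_sum fun _ _ => mul_le_mul_of_nonneg_left (h _) (NNReal.coe_nonneg _)

lemma selMean_one [NeZero N] (ξ : Fin N → Z) : selMean ω (fun _ => 1) ξ = 1 := by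
  simp only [selMean, mul_one]
  exact_mod_cast sum_normWeight _

lemma le_selMean [NeZero N] {F : Z → ℝ} {l : ℝ} (h : ∀ x, l ≤ F x) (ξ : Fin N → Z) :
    l ≤ selMean ω F ξ := by
  have h1 := selMean_mono (ω := ω) (F := fun _ => l * 1) (G := F) (by simpa using h) ξ
  rwa [selMean_const_mul, selMean_one, mul_one] at h1

lemma selMean_le [NeZero N] {F : Z → ℝ} {l : ℝ} (h : ∀ x, F x ≤ l) (ξ : Fin N → Z) :
    selMean ω F ξ ≤ l := by
  have h1 := selMean_mono (ω := ω) (F := F) (G := fun _ => l * 1) (by simpa using h) ξ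
  rwa [selMean_const_mul, selMean_one, mul_one] at h1

lemma ratio_mem_of_bracket [NeZero N] {u v : Z → ℝ} {l a c : ℝ} (hl : 0 < l)
    (hv : ∀ x, l ≤ v x) (hb : ∀ x, a * v x ≤ u x ∧ u x ≤ c * v x) (ξ : Fin N → Z) :
    a ≤ selMean ω u ξ / selMean ω v ξ ∧ selMean ω u ξ / selMean ω v ξ ≤ c := by
  have hpos : 0 < selMean ω v ξ := hl.trans_le (le_selMean hv ξ)
  rw [le_div_iff₀ hpos, div_le_iff₀ hpos, ← selMean_const_mul, ← selMean_const_mul]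
  exact ⟨selMean_mono (fun x => (hb x).1) ξ, selMean_mono (fun x => (hb x).2) ξ⟩

/-- The defining property of the weighted mean, also valid when all the weights vanish. -/
lemma selMean_mul_avg (F : Z → ℝ) (ξ : Fin N → Z) :
    selMean ω F ξ * avg (fun x => (ω x : ℝ)) ξ = avg (fun x => ω x * F x) ξ := by
  simp only [selMean, avg, normWeight]
  by_cases h : ∑ i, ω (ξ i) = 0
  · have h0 : ∀ i, ω (ξ i) = 0 := fun i =>
      (Finset.sum_eq_zero_iff_of_nonneg fun _ _ => zero_le).mp h i (Finset.mem_univ i)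
    simp [h0]
  · simp only [h, if_false]
    have h' : ∑ i, (ω (ξ i) : ℝ) ≠ 0 := by exact_mod_cast h
    push_cast
    simp only [div_mul_eq_mul_div, ← Finset.sum_div]
    field_simp

variable [MeasurableSpace Z]

lemma measurable_selMean (hω : Measurable ω) {F : Z → ℝ} (hF : Measurable F) :
    Measurable fun ξ : Fin N → Z => selMean ω F ξ := by
  refine Finset.measurable_sum _ fun j _ => Measurable.mul ?_ (hF.comp (measurable_pi_apply j))
  have h : Measurable fun ξ : Fin N → Z => fun i => ω (ξ i) :=
    measurable_pi_lambda _ fun i => hω.comp (measurable_pi_apply i)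
  exact ((measurable_normWeight j).comp h).coe_nnreal_real

/-- The error of the ratio of two weighted means, for independent draws from `π`, is that of a
self-normalised estimate. -/
lemma ratioError_selMean [NeZero N] {π : Measure Z} [IsProbabilityMeasure π] (hω : Measurable ω)
    {wmax : ℝ} (hωle : ∀ x, (ω x : ℝ) ≤ wmax) {u v : Z → ℝ} (hu : BddMeas u) (hv : BddMeas v)
    {l L : ℝ} (hl : 0 < l) (hvl : ∀ x, l ≤ v x) (hvL : ∀ x, v x ≤ L) {a c : ℝ}
    (hb : ∀ x, a * v x ≤ u x ∧ u x ≤ c * v x) {r : ℝ} (hr : 0 < r)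
    (hrl : r * l ≤ ∫ x, ω x * v x ∂π) {e : ℝ} (hae : a ≤ e) (hec : e ≤ c)
    (he : ∫ x, ω x * u x ∂π = e * ∫ x, ω x * v x ∂π) :
    RatioError π (fun x => ω x * v x) (fun x => ω x * (u x - e * v x)) (wmax * L) (r * l) (c - a)
      (fun η : Fin N → Z => selMean ω u η / selMean ω v η - e) := by
  have hωb : BddMeas fun x => (ω x : ℝ) :=
    ⟨hω.coe_nnreal_real, wmax, fun x => by rw [abs_of_nonneg (NNReal.coe_nonneg _)]; exact hωle x⟩
  have hv0 : ∀ x, 0 ≤ v x := fun x => hl.le.trans (hvl x)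
  refine ⟨(hωb.mul hv).meas, (hωb.mul (hu.sub (hv.const_mul e))).meas,
    fun x => mul_nonneg (NNReal.coe_nonneg _) (hv0 x),
    fun x => mul_le_mul (hωle x) (hvL x) (hv0 x) ((NNReal.coe_nonneg (ω x)).trans (hωle x)),
    fun x => ?_, mul_pos hr hl, hrl, ?_,
    ((measurable_selMean hω hu.meas).div (measurable_selMean hω hv.meas)).sub_const _,
    fun η => ?_, fun η => ?_⟩
  · rw [abs_mul, abs_of_nonneg (NNReal.coe_nonneg (ω x))]
    have h1 : |u x - e * v x| ≤ (c - a) * v x := by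
      have h2 := mul_le_mul_of_nonneg_right hae (hv0 x)
      have h3 := mul_le_mul_of_nonneg_right hec (hv0 x)
      rw [abs_le]
      constructor <;> linarith [(hb x).1, (hb x).2]
    nlinarith [NNReal.coe_nonneg (ω x)]
  · have h1 : ∀ x, ω x * (u x - e * v x) = ω x * u x - e * (ω x * v x) := fun x => by ring
    simp only [h1]
    rw [integral_sub ((hωb.mul hu).integrable _) (((hωb.mul hv).const_mul e).integrable _),
      integral_const_mul, he, sub_self]
  · obtain ⟨h1, h2⟩ := ratio_mem_of_bracket (ω := ω) hl hvl hb η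
    rw [abs_le]
    constructor <;> linarith
  · have hpos : 0 < selMean ω v η := hl.trans_le (le_selMean hvl η)
    rw [← selMean_mul_avg, ← selMean_mul_avg, selMean_sub, selMean_const_mul]
    field_simp

end SelMean

/-! ### The error created at one time step -/

namespace Proposal

variable {X Y Θ : Type*} [MeasurableSpace X] [MeasurableSpace Y] {M : Model X Y Θ}
  {P : Proposal M} {N : ℕ} [NeZero N] {θ : Θ} {y : ℕ → Y}

lemma weight_zero_le (h2 : P.A2) (x : ℕ → X) : (P.weight θ y 0 x : ℝ) ≤ P.normW₀ θ y :=
  le_ciSup (f := fun x => (P.W₀ θ (y 0) x : ℝ)) (h2.zero θ (y 0)) (x 0)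

lemma weight_succ_le (h2 : P.A2) (m : ℕ) (x : ℕ → X) :
    (P.weight θ y (m + 1) x : ℝ) ≤ P.normW m θ y := by
  have h := h2.succ m θ (upTo (m + 1) y)
  have h3 := le_ciSup (f := fun p : X × X => |(P.W m θ (upTo (m + 1) y) p.1 p.2 : ℝ)|)
    (by simpa only [abs_of_nonneg (NNReal.coe_nonneg _)] using h) (x m, x (m + 1))
  exact (le_abs_self _).trans h3

lemma bddMeas_weight (h2 : P.A2) (m : ℕ) : BddMeas fun x => (P.weight θ y m x : ℝ) := by
  cases m with
  | zero =>
    exact ⟨(P.measurable_weight θ y 0).coe_nnreal_real, P.normW₀ θ y, fun x => by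
      rw [abs_of_nonneg (NNReal.coe_nonneg _)]; exact weight_zero_le h2 x⟩
  | succ m =>
    exact ⟨(P.measurable_weight θ y _).coe_nnreal_real, P.normW m θ y, fun x => by
      rw [abs_of_nonneg (NNReal.coe_nonneg _)]; exact weight_succ_le h2 m x⟩

/-- The importance weights correct the proposal to the prediction operator. -/
lemma integral_weight_mul_prolong (h2 : P.A2) (m : ℕ) {G : (ℕ → X) → ℝ}
    (hG : BddMeas G) (x : ℕ → X) :
    ∫ x', P.weight θ y (m + 1) x' * G x' ∂P.prolong θ y m x = M.step θ y m G x := by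
  have hm : Measurable fun x' => extend m (x, x') :=
    (measurable_extend m).comp measurable_prodMk_left
  rw [prolong_apply, integral_map hm.aemeasurable
    ((bddMeas_weight h2 (m + 1)).mul hG).meas.aestronglyMeasurable]
  have hd : Measurable fun x' => P.dQ m θ (upTo (m + 1) y) (x m) x' :=
    (P.measurable_dQ m θ).comp
      ((measurable_const (a := upTo (m + 1) y)).prodMk
        ((measurable_const (a := x m)).prodMk measurable_id))
  have hq : Measurable fun x' => M.q θ (x m) x' :=
    (M.measurable_q θ).comp ((measurable_const (a := x m)).prodMk measurable_id)
  have h1 : M.step θ y m G x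
      = ∫ x', M.g θ x' (y (m + 1)) * G (extend m (x, x')) ∂M.Q θ (x m) := by
    rw [M.Q_eq, integral_withDensity_eq_integral_smul hq]
    rfl
  rw [h1, P.Q_eq m θ (upTo (m + 1) y) (x m), integral_withDensity_eq_integral_smul hd]
  refine integral_congr_ae (ae_of_all _ fun x' => ?_)
  simp only [weight, W, extend, le_refl, if_true, NNReal.smul_def, smul_eq_mul, NNReal.coe_mul,
    show ¬ m + 1 ≤ m by omega, if_false, upTo, Fin.val_last]
  ring

lemma integral_weight_mul_init (h : M.A1) (h2 : P.A2) {G : (ℕ → X) → ℝ} (hG : BddMeas G) :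
    ∫ x, P.weight θ y 0 x * G x ∂(P.init θ).map (fun x _ => x) = M.joint θ y 0 G := by
  have hm : Measurable fun (x : X) (_ : ℕ) => x := measurable_pi_lambda _ fun _ => measurable_id
  rw [integral_map hm.aemeasurable ((bddMeas_weight h2 0).mul hG).meas.aestronglyMeasurable,
    Model.joint_zero h hG, P.ν_eq θ, integral_withDensity_eq_integral_smul (P.measurable_dInit θ)]
  refine integral_congr_ae (ae_of_all _ fun x => ?_)
  simp only [weight, W₀, NNReal.smul_def, smul_eq_mul, NNReal.coe_mul]
  ring

lemma integral_weight_mul_move (h : M.A1) (h2 : P.A2) (m : ℕ) {G : (ℕ → X) → ℝ}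
    (hG : BddMeas G) (ξ : Fin N → ℕ → X) :
    ∫ x, P.weight θ y (m + 1) x * G x ∂P.move N θ y m ξ
      = selMean (P.weight θ y m) (M.step θ y m G) ξ := by
  rw [move, Kernel.integral_comp (((bddMeas_weight h2 (m + 1)).mul hG).integrable _)]
  simp only [integral_weight_mul_prolong h2 m hG]
  rw [integral_sampleFrom _ _ (Model.bddMeas_step h m hG).meas]
  rfl

end Proposal

/-- The estimate of the smoothed mean of `F` at the horizon `m + d`, based on the trajectories up
to time `m`: the remaining `d` steps are integrated exactly. -/
def Proposal.predicted {X Y Θ : Type*} [MeasurableSpace X] [MeasurableSpace Y] {M : Model X Y Θ}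
    (P : Proposal M) {N : ℕ} (θ : Θ) (y : ℕ → Y) (m d : ℕ) (F : (ℕ → X) → ℝ)
    (ξ : Fin N → ℕ → X) : ℝ :=
  selMean (P.weight θ y m) (M.iter θ y m d F) ξ
    / selMean (P.weight θ y m) (M.iter θ y m d fun _ => 1) ξ

namespace Proposal

variable {X Y Θ : Type*} [MeasurableSpace X] [MeasurableSpace Y] {M : Model X Y Θ}
  {P : Proposal M} {N : ℕ} [NeZero N] {θ : Θ} {y : ℕ → Y}

lemma predicted_zero (m : ℕ) (F : (ℕ → X) → ℝ) (ξ : Fin N → ℕ → X) :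
    P.predicted θ y m 0 F ξ = selMean (P.weight θ y m) F ξ := by
  simp only [predicted, Model.iter, selMean_one, div_one]

lemma bddMeas_predicted (h : M.A1) (m d : ℕ) {F : (ℕ → X) → ℝ} (hF : BddMeas F) :
    BddMeas fun ξ : Fin N → ℕ → X => P.predicted θ y m d F ξ := by
  obtain ⟨S, hS⟩ := hF.bdd
  obtain ⟨l, hl, hb⟩ := Model.exists_iter_one_bounds h θ y d m
  refine ⟨(measurable_selMean (P.measurable_weight θ y m)
    (Model.bddMeas_iter h d m hF).meas).div (measurable_selMean (P.measurable_weight θ y m)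
    (Model.bddMeas_iter h d m (BddMeas.const 1)).meas), S, fun ξ => abs_le.mpr ?_⟩
  exact ratio_mem_of_bracket hl (fun x => (hb x).1)
    (fun x => Model.iter_abs_le h d m hF hS x) ξ

variable (h : M.A1) (h2 : P.A2) {F : (ℕ → X) → ℝ} (hF : BddMeas F) {S : ℝ}
  (hS : ∀ x, |F x| ≤ S) {k : ℕ} (hk : DependsOn F (Set.Ici k))
include h h2 hF hS hk

/-- The error made at time `m + 1`, given the trajectories `ξ` up to time `m`. -/
lemma exists_ratioError_succ (m d : ℕ) (hkm : k < m + 1 + d) (ξ : Fin N → ℕ → X) :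
    ∃ l δ V U, 0 < l ∧ δ ≤ 2 * S * M.rho ^ (k - (m + 1)) ∧
      RatioError (P.move N θ y m ξ) V U (P.normW m θ y * (l / (1 - M.rho)))
        (M.sigmaMinus * M.muG θ (y (m + 1)) * l) δ
        fun η : Fin N → ℕ → X => P.predicted θ y (m + 1) d F η - P.predicted θ y m (d + 1) F ξ := by
  obtain ⟨l, hl, hv⟩ := Model.exists_iter_one_bounds h θ y d (m + 1)
  obtain ⟨a, c, hac, hb⟩ := Model.exists_iter_bracket h θ y hF hS hk d (m + 1) hkm
  have hbv := Model.bddMeas_iter (θ := θ) (y := y) h d (m + 1) (BddMeas.const (α := ℕ → X) 1)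
  have hbu := Model.bddMeas_iter (θ := θ) (y := y) h d (m + 1) hF
  have hstep : ∀ x, M.sigmaMinus * M.muG θ (y (m + 1)) * l
      ≤ M.step θ y m (M.iter θ y (m + 1) d fun _ => 1) x := by
    intro x
    have hbw : BddMeas fun x' => M.iter θ y (m + 1) d (fun _ => 1) (extend m (x, x')) :=
      hbv.comp ((measurable_extend m).comp measurable_prodMk_left)
    refine le_trans ?_ (h.integral_q_mul_g_mul_bounds θ (y (m + 1)) (x m) hbw
      fun x' => hl.le.trans (hv _).1).1
    rw [mul_assoc]
    refine mul_le_mul_of_nonneg_left ?_ h.sigmaMinus_pos.le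
    rw [Model.muG, ← integral_mul_const]
    exact integral_mono (((h.bddMeas_g θ _).mul (BddMeas.const l)).integrable _)
      (((h.bddMeas_g θ _).mul hbw).integrable _)
      fun x' => mul_le_mul_of_nonneg_left (hv _).1 (NNReal.coe_nonneg _)
  have hr : 0 < M.sigmaMinus * M.muG θ (y (m + 1)) := mul_pos h.sigmaMinus_pos (h.muG_pos θ _)
  have hpos : 0 < selMean (P.weight θ y m)
      (M.step θ y m (M.iter θ y (m + 1) d fun _ => 1)) ξ :=
    (mul_pos hr hl).trans_le (le_selMean hstep ξ)
  -- the bracket for the ratio is inherited by the images under the prediction operator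
  have hb' : ∀ x, a * M.step θ y m (M.iter θ y (m + 1) d fun _ => 1) x
        ≤ M.step θ y m (M.iter θ y (m + 1) d F) x ∧
      M.step θ y m (M.iter θ y (m + 1) d F) x
        ≤ c * M.step θ y m (M.iter θ y (m + 1) d fun _ => 1) x := fun x => by
    rw [← Model.step_const_mul, ← Model.step_const_mul]
    exact ⟨Model.iter_mono (θ := θ) (y := y) h 1 m (hbv.const_mul a) hbu (fun x => (hb x).1) x,
      Model.iter_mono (θ := θ) (y := y) h 1 m hbu (hbv.const_mul c) (fun x => (hb x).2) x⟩
  obtain ⟨hae, hec⟩ := ratio_mem_of_bracket (ω := P.weight θ y m) (mul_pos hr hl) hstep hb' ξ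
  refine ⟨l, c - a, _, _, hl, hac, ratioError_selMean (P.measurable_weight θ y (m + 1))
    (weight_succ_le h2 m) hbu hbv hl (fun x => (hv x).1) (fun x => (hv x).2) hb hr ?_ hae hec ?_⟩
  · rw [integral_weight_mul_move h h2 m hbv]
    exact le_selMean hstep ξ
  · rw [integral_weight_mul_move h h2 m hbu, integral_weight_mul_move h h2 m hbv]
    exact (div_mul_cancel₀ _ hpos.ne').symm

lemma exists_ratioError_zero (hν : 0 < M.nuG θ (y 0)) (d : ℕ) (hkd : k < d) :
    ∃ l δ V U, 0 < l ∧ δ ≤ 2 * S * M.rho ^ k ∧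
      RatioError ((P.init θ).map fun x _ => x) V U (P.normW₀ θ y * (l / (1 - M.rho)))
        (M.nuG θ (y 0) * l) δ
        fun η : Fin N → ℕ → X => P.predicted θ y 0 d F η
          - M.joint θ y d F / M.joint θ y d fun _ => 1 := by
  obtain ⟨l, hl, hv⟩ := Model.exists_iter_one_bounds h θ y d 0
  obtain ⟨a, c, hac, hb⟩ := Model.exists_iter_bracket h θ y hF hS hk d 0 (by omega)
  have hbv := Model.bddMeas_iter (θ := θ) (y := y) h d 0 (BddMeas.const (α := ℕ → X) 1)
  have hbu := Model.bddMeas_iter (θ := θ) (y := y) h d 0 hF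
  have hpos := Model.joint_one_pos h hν d
  have hc : Measurable fun (x : X) (_ : ℕ) => x := measurable_pi_lambda _ fun _ => measurable_id
  have hprob : IsProbabilityMeasure ((P.init θ).map fun (x : X) (_ : ℕ) => x) :=
    Measure.isProbabilityMeasure_map hc.aemeasurable
  have hj : ∀ {G : (ℕ → X) → ℝ}, BddMeas G →
      M.joint θ y d G = M.joint θ y 0 (M.iter θ y 0 d G) := fun hG => by
    simpa using Model.joint_add (θ := θ) (y := y) h d 0 hG
  have hju := hj hF
  have hjv := hj (BddMeas.const 1)
  refine ⟨l, c - a, _, _, hl, by simpa using hac,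
    ratioError_selMean (P.measurable_weight θ y 0)
    (weight_zero_le h2) hbu hbv hl (fun x => (hv x).1) (fun x => (hv x).2) hb hν ?_ ?_ ?_ ?_⟩
  · rw [integral_weight_mul_init h h2 hbv, mul_comm]
    have h3 : l * M.nuG θ (y 0) = M.joint θ y 0 fun _ => l * 1 := by
      rw [Model.joint_const_mul, Model.joint_zero h (BddMeas.const 1), Model.nuG]
      simp
    rw [h3]
    exact Model.joint_mono h 0 (BddMeas.const _) hbv fun x => by simpa using (hv x).1
  · rw [le_div_iff₀ hpos, hju, hjv, ← Model.joint_const_mul]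
    exact Model.joint_mono h 0 (hbv.const_mul _) hbu fun x => (hb x).1
  · rw [div_le_iff₀ hpos, hju, hjv, ← Model.joint_const_mul]
    exact Model.joint_mono h 0 hbu (hbv.const_mul _) fun x => (hb x).2
  · rw [integral_weight_mul_init h h2 hbu, integral_weight_mul_init h h2 hbv, ← hju, ← hjv,
      div_mul_cancel₀ _ hpos.ne']

end Proposal

/-! ### Bounds on the moments and on the bias of bounded variables -/

/-- The bounded variable `f` has `L^p` norm at most `b`. -/
structure NormBound {Ω : Type*} [MeasurableSpace Ω] (Pr : Measure Ω) (p : ℕ) (f : Ω → ℝ) (b : ℝ) :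
    Prop where
  bddMeas : BddMeas f
  nonneg : 0 ≤ b
  le : ∫ ω, |f ω| ^ p ∂Pr ≤ b ^ p

namespace NormBound

variable {Ω : Type*} [MeasurableSpace Ω] {Pr : Measure Ω} [IsProbabilityMeasure Pr] {p : ℕ}
  {f g : Ω → ℝ} {a b : ℝ}

lemma eLpNorm_eq (hf : BddMeas f) (hp : p ≠ 0) :
    eLpNorm f p Pr = ENNReal.ofReal ((∫ ω, |f ω| ^ p ∂Pr) ^ (1 / (p : ℝ))) := by
  obtain ⟨C, hC⟩ := hf.bdd
  have hm : MemLp f p Pr := MemLp.of_bound hf.meas.aestronglyMeasurable C (ae_of_all _ hC)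
  rw [hm.eLpNorm_eq_integral_rpow_norm (by exact_mod_cast hp) (by simp)]
  simp

lemma iff_eLpNorm_le (hf : BddMeas f) (hb : 0 ≤ b) (hp : p ≠ 0) :
    ∫ ω, |f ω| ^ p ∂Pr ≤ b ^ p ↔ eLpNorm f p Pr ≤ ENNReal.ofReal b := by
  rw [eLpNorm_eq hf hp, ENNReal.ofReal_le_ofReal_iff hb, one_div,
    Real.rpow_inv_le_iff_of_pos (integral_nonneg fun _ => by positivity) hb (by positivity),
    Real.rpow_natCast]

lemma add (hf : NormBound Pr p f a) (hg : NormBound Pr p g b) (hp : 1 ≤ p) :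
    NormBound Pr p (fun ω => f ω + g ω) (a + b) := by
  have hp0 : p ≠ 0 := by omega
  refine ⟨hf.bddMeas.add hg.bddMeas, add_nonneg hf.nonneg hg.nonneg, ?_⟩
  rw [iff_eLpNorm_le (hf.bddMeas.add hg.bddMeas) (add_nonneg hf.nonneg hg.nonneg) hp0,
    ENNReal.ofReal_add hf.nonneg hg.nonneg]
  refine (eLpNorm_add_le (f := f) (g := g) hf.bddMeas.meas.aestronglyMeasurable
    hg.bddMeas.meas.aestronglyMeasurable (by exact_mod_cast hp)).trans ?_
  exact add_le_add ((iff_eLpNorm_le hf.bddMeas hf.nonneg hp0).mp hf.le)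
    ((iff_eLpNorm_le hg.bddMeas hg.nonneg hp0).mp hg.le)

lemma sum {ι : Type*} {t : Finset ι} {F : ι → Ω → ℝ} {c : ι → ℝ} (hp : 1 ≤ p)
    (h : ∀ i ∈ t, NormBound Pr p (F i) (c i)) :
    NormBound Pr p (fun ω => ∑ i ∈ t, F i ω) (∑ i ∈ t, c i) := by
  classical
  induction t using Finset.induction_on with
  | empty => exact ⟨by simpa using BddMeas.const 0, by simp, by simp⟩
  | insert i t hi ih =>
    simp only [Finset.sum_insert hi]
    exact (h i (by simp)).add (ih fun j hj => h j (by simp [hj])) hp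

lemma const {c : ℝ} (hc : |c| ≤ b) : NormBound Pr p (fun _ => c) b :=
  ⟨BddMeas.const c, (abs_nonneg c).trans hc, by
    simpa using pow_le_pow_left₀ (abs_nonneg c) hc p⟩

omit [IsProbabilityMeasure Pr] in
lemma mono (hf : NormBound Pr p f a) (hab : a ≤ b) : NormBound Pr p f b :=
  ⟨hf.bddMeas, hf.nonneg.trans hab, hf.le.trans (pow_le_pow_left₀ hf.nonneg hab p)⟩

end NormBound

/-- The bounded variable `f` has a mean of absolute value at most `b`. -/
structure MeanBound {Ω : Type*} [MeasurableSpace Ω] (Pr : Measure Ω) (f : Ω → ℝ) (b : ℝ) :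
    Prop where
  bddMeas : BddMeas f
  le : |∫ ω, f ω ∂Pr| ≤ b

namespace MeanBound

variable {Ω : Type*} [MeasurableSpace Ω] {Pr : Measure Ω} [IsProbabilityMeasure Pr]
  {f g : Ω → ℝ} {a b : ℝ}

lemma add (hf : MeanBound Pr f a) (hg : MeanBound Pr g b) :
    MeanBound Pr (fun ω => f ω + g ω) (a + b) := by
  refine ⟨hf.bddMeas.add hg.bddMeas, ?_⟩
  rw [integral_add (hf.bddMeas.integrable _) (hg.bddMeas.integrable _)]
  exact (abs_add_le _ _).trans (add_le_add hf.le hg.le)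

lemma sum {ι : Type*} {t : Finset ι} {F : ι → Ω → ℝ} {c : ι → ℝ}
    (h : ∀ i ∈ t, MeanBound Pr (F i) (c i)) :
    MeanBound Pr (fun ω => ∑ i ∈ t, F i ω) (∑ i ∈ t, c i) := by
  classical
  induction t using Finset.induction_on with
  | empty => exact ⟨by simpa using BddMeas.const 0, by simp⟩
  | insert i t hi ih =>
    simp only [Finset.sum_insert hi]
    exact (h i (by simp)).add (ih fun j hj => h j (by simp [hj]))

lemma const {c : ℝ} (hc : |c| ≤ b) : MeanBound Pr (fun _ => c) b :=
  ⟨BddMeas.const c, by simpa using hc⟩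

end MeanBound

lemma sum_range_eq_sum_Icc (T : ℕ) (f : ℕ → ℝ) :
    ∑ m ∈ range T, f (m + 1) = ∑ m ∈ Icc 1 T, f m := by
  induction T with
  | zero => simp
  | succ T ih => rw [Finset.sum_range_succ, ih, Finset.sum_Icc_succ_top (by omega)]

/-! ### The error of the estimator of one smoothed mean -/

namespace Proposal

variable {X Y Θ : Type*} [MeasurableSpace X] [MeasurableSpace Y] {M : Model X Y Θ}
  {P : Proposal M} {N : ℕ} [NeZero N] {θ : Θ} {y : ℕ → Y}

/-- The mean of `F` over the resampled trajectories is its weighted mean before the resampling,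
the predicted mean with no remaining steps, plus a resampling error; between the predicted mean
and the smoothed mean, the error is the telescoping sum of the errors made at each time. -/
lemma avg_resampledPath_sub (T : ℕ) (F : (ℕ → X) → ℝ) (e : ℝ) (h : ℕ → Step X N) :
    avg F (resampledPath h T) - e
      = (avg F (resampledPath h T) - selMean (P.weight θ y T) F (path h T))
        + (∑ m ∈ range T, (P.predicted θ y (m + 1) (T - (m + 1)) F (path h (m + 1))
            - P.predicted θ y m (T - (m + 1) + 1) F (path h m))
          + (P.predicted θ y 0 T F (path h 0) - e)) := by
  have h1 : ∀ m ∈ range T, P.predicted θ y (m + 1) (T - (m + 1)) F (path h (m + 1))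
      - P.predicted θ y m (T - (m + 1) + 1) F (path h m)
      = P.predicted θ y (m + 1) (T - (m + 1)) F (path h (m + 1))
        - P.predicted θ y m (T - m) F (path h m) := fun m hm => by
    rw [show T - (m + 1) + 1 = T - m by have := Finset.mem_range.mp hm; omega]
  rw [Finset.sum_congr rfl h1,
    Finset.sum_range_sub (fun m => P.predicted θ y m (T - m) F (path h m)), Nat.sub_self,
    predicted_zero, Nat.sub_zero]
  ring

section Resampling

variable {F : (ℕ → X) → ℝ} (hF : BddMeas F) {S : ℝ} (hS : ∀ x, |F x| ≤ S) {T n : ℕ} (hT : T ≤ n)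
include hF

lemma bddMeas_selMean_weight (T : ℕ) :
    BddMeas fun ξ : Fin N → ℕ → X => selMean (P.weight θ y T) F ξ := by
  obtain ⟨S, hS⟩ := hF.bdd
  exact ⟨measurable_selMean (P.measurable_weight θ y T) hF.meas, S, fun ξ => abs_le.mpr
    ⟨le_selMean (fun x => (abs_le.mp (hS x)).1) ξ, selMean_le (fun x => (abs_le.mp (hS x)).2) ξ⟩⟩

lemma bddMeas_resamplingError : BddMeas fun p : (Fin N → ℕ → X) × (Fin N → ℕ → X) =>
    avg F p.2 - selMean (P.weight θ y T) F p.1 :=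
  (hF.avg.comp measurable_snd).sub ((bddMeas_selMean_weight hF T).comp measurable_fst)

include hT

lemma meanBound_resampling : MeanBound (P.particleLaw N θ n y)
    (fun h => avg F (resampledPath h T) - selMean (P.weight θ y T) F (path h T)) 0 := by
  have hD := bddMeas_resamplingError (P := P) (N := N) (θ := θ) (y := y) (T := T) hF
  refine ⟨hD.comp ((measurable_path T).prodMk (measurable_resampledPath T)),
    abs_integral_le_of_map_eq_compProd (measurable_path T) (measurable_resampledPath T)
      (map_path_resampledPath P N θ y hT) hD fun ξ => ?_⟩
  simp only [piKernel_apply]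
  rw [integral_sub (hF.avg.integrable _) (integrable_const _), integral_avg _ hF,
    integral_sampleFrom _ _ hF.meas]
  simp [selMean]

include hS

lemma normBound_resampling {p : ℕ} (hp : p ≠ 0) : NormBound (P.particleLaw N θ n y) p
    (fun h => avg F (resampledPath h T) - selMean (P.weight θ y T) F (path h T))
    (8 * p.factorial * S / √N) := by
  have hD := bddMeas_resamplingError (P := P) (N := N) (θ := θ) (y := y) (T := T) hF
  obtain ⟨x₀⟩ : Nonempty X := nonempty_of_isProbabilityMeasure M.μ
  have hS0 : 0 ≤ S := (abs_nonneg _).trans (hS fun _ => x₀)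
  refine ⟨hD.comp ((measurable_path T).prodMk (measurable_resampledPath T)), by positivity, ?_⟩
  refine (le_abs_self _).trans (abs_integral_le_of_map_eq_compProd (measurable_path T)
    (measurable_resampledPath T) (map_path_resampledPath P N θ y hT) (hD.abs.pow p) fun ξ => ?_)
  rw [abs_of_nonneg (integral_nonneg fun _ => by positivity), piKernel_apply]
  have hc : selMean (P.weight θ y T) F ξ
      = ∫ x, F x ∂sampleFrom N (P.measurable_weight θ y T) ξ :=
    (integral_sampleFrom _ _ hF.meas).symm
  simp only [← avg_sub_const, hc]
  set π := sampleFrom N (P.measurable_weight θ y T) ξ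
  have hb : ∀ x, |F x - ∫ x, F x ∂π| ≤ 2 * S := fun x => by
    have h1 : |∫ x, F x ∂π| ≤ S := by
      simpa using norm_integral_le_of_norm_le_const (μ := π) (f := F)
        (ae_of_all _ fun x => (hS x : ‖_‖ ≤ S))
    linarith [abs_sub (F x) (∫ x, F x ∂π), hS x]
  have h0 : ∫ x, (F x - ∫ x, F x ∂π) ∂π = 0 := by
    rw [integral_sub (hF.integrable π) (integrable_const _)]
    simp
  refine (integral_abs_avg_pow_le π (hF.meas.sub_const _) hb h0 hp).trans ?_
  have h1 : (1 : ℝ) ≤ p.factorial := by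
    exact_mod_cast Nat.one_le_iff_ne_zero.mpr p.factorial_ne_zero
  calc 4 * p.factorial * (2 * S / √N) ^ p ≤ (4 * p.factorial) ^ p * (2 * S / √N) ^ p := by
        gcongr
        exact le_self_pow₀ (by linarith) hp
    _ = (8 * p.factorial * S / √N) ^ p := by
        rw [← mul_pow]; ring

end Resampling

lemma normW_nonneg (h2 : P.A2) (m : ℕ) : 0 ≤ P.normW m θ y := by
  have ⟨x₀⟩ : Nonempty X := nonempty_of_isProbabilityMeasure M.μ
  exact (NNReal.coe_nonneg _).trans (weight_succ_le h2 m fun _ => x₀)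

lemma normW₀_nonneg (h2 : P.A2) : 0 ≤ P.normW₀ θ y := by
  have ⟨x₀⟩ : Nonempty X := nonempty_of_isProbabilityMeasure M.μ
  exact (NNReal.coe_nonneg _).trans (weight_zero_le h2 fun _ => x₀)

section Errors

variable (h : M.A1) (h2 : P.A2) {F : (ℕ → X) → ℝ} (hF : BddMeas F) {S : ℝ}
  (hS : ∀ x, |F x| ≤ S) {k : ℕ} (hk : DependsOn F (Set.Ici k)) {n : ℕ}

include h

lemma bddMeas_predicted_sub {F : (ℕ → X) → ℝ} (hF : BddMeas F) (m d : ℕ) :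
    BddMeas fun p : (Fin N → ℕ → X) × (Fin N → ℕ → X) =>
      P.predicted θ y (m + 1) d F p.2 - P.predicted θ y m (d + 1) F p.1 :=
  ((bddMeas_predicted h (m + 1) d hF).comp measurable_snd).sub
    ((bddMeas_predicted h m (d + 1) hF).comp measurable_fst)

include h2 hF hS hk

lemma normBound_step {m d : ℕ} (hmn : m + 1 ≤ n) (hkm : k < m + 1 + d) {p : ℕ} (hp : p ≠ 0) :
    NormBound (P.particleLaw N θ n y) p
      (fun h => P.predicted θ y (m + 1) d F (path h (m + 1)) - P.predicted θ y m (d + 1) F (path h m))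
      (16 * p.factorial / (√N * (1 - M.rho)) * (S * (1 / M.sigmaMinus *
        (P.normW m θ y * M.rho ^ (k - (m + 1)) / M.muG θ (y (m + 1)))))) := by
  have hD := bddMeas_predicted_sub (P := P) (N := N) (θ := θ) (y := y) h hF m d
  have hr := h.one_sub_rho_pos θ
  have hr0 := h.rho_nonneg θ
  have hμ := h.muG_pos θ (y (m + 1))
  have hσ := h.sigmaMinus_pos
  have hw := normW_nonneg (θ := θ) (y := y) h2 m
  obtain ⟨x₀⟩ : Nonempty X := nonempty_of_isProbabilityMeasure M.μ
  have hS0 : 0 ≤ S := (abs_nonneg _).trans (hS fun _ => x₀)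
  refine ⟨((bddMeas_predicted h (m + 1) d hF).comp (measurable_path (m + 1))).sub
      ((bddMeas_predicted h m (d + 1) hF).comp (measurable_path m)), by positivity, ?_⟩
  refine (le_abs_self _).trans (abs_integral_le_of_map_eq_compProd (measurable_path m)
    (measurable_path (m + 1)) (map_path_path_succ P N θ y hmn) (hD.abs.pow p) fun ξ => ?_)
  rw [abs_of_nonneg (integral_nonneg fun _ => by positivity), piKernel_apply]
  obtain ⟨l, δ, V, U, hl, hδ, hR⟩ :=
    exists_ratioError_succ (y := y) (θ := θ) h h2 hF hS hk m d hkm ξ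
  refine (hR.integral_abs_pow_le hp).trans ?_
  have hδ0 := hR.delta_nonneg
  calc (8 * p.factorial * (δ * (P.normW m θ y * (l / (1 - M.rho))
          / (M.sigmaMinus * M.muG θ (y (m + 1)) * l)) / √N)) ^ p
      ≤ (8 * p.factorial * (2 * S * M.rho ^ (k - (m + 1)) * (P.normW m θ y * (l / (1 - M.rho))
          / (M.sigmaMinus * M.muG θ (y (m + 1)) * l)) / √N)) ^ p := by gcongr
    _ = _ := by
        congr 1
        field_simp
        ring

lemma meanBound_step {m d : ℕ} (hmn : m + 1 ≤ n) (hkm : k < m + 1 + d) :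
    MeanBound (P.particleLaw N θ n y)
      (fun h => P.predicted θ y (m + 1) d F (path h (m + 1)) - P.predicted θ y m (d + 1) F (path h m))
      (32 / (N * (1 - M.rho) ^ 2) * (S * (1 / M.sigmaMinus ^ 2 *
        (P.normW m θ y ^ 2 * M.rho ^ (k - (m + 1)) / M.muG θ (y (m + 1)) ^ 2)))) := by
  have hD := bddMeas_predicted_sub (P := P) (N := N) (θ := θ) (y := y) h hF m d
  have hr := h.one_sub_rho_pos θ
  have hr0 := h.rho_nonneg θ
  have hμ := h.muG_pos θ (y (m + 1))
  have hσ := h.sigmaMinus_pos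
  refine ⟨((bddMeas_predicted h (m + 1) d hF).comp (measurable_path (m + 1))).sub
      ((bddMeas_predicted h m (d + 1) hF).comp (measurable_path m)),
    abs_integral_le_of_map_eq_compProd (measurable_path m)
    (measurable_path (m + 1)) (map_path_path_succ P N θ y hmn) hD fun ξ => ?_⟩
  rw [piKernel_apply]
  obtain ⟨l, δ, V, U, hl, hδ, hR⟩ :=
    exists_ratioError_succ (y := y) (θ := θ) h h2 hF hS hk m d hkm ξ
  refine hR.abs_integral_le.trans ?_
  calc 16 * (δ * (P.normW m θ y * (l / (1 - M.rho))
          / (M.sigmaMinus * M.muG θ (y (m + 1)) * l)) ^ 2 / N)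
      ≤ 16 * (2 * S * M.rho ^ (k - (m + 1)) * (P.normW m θ y * (l / (1 - M.rho))
          / (M.sigmaMinus * M.muG θ (y (m + 1)) * l)) ^ 2 / N) := by gcongr
    _ = _ := by
        field_simp
        ring

variable (hν : 0 < M.nuG θ (y 0))
include hν

lemma normBound_init {d : ℕ} (hkd : k < d) {p : ℕ} (hp : p ≠ 0) :
    NormBound (P.particleLaw N θ n y) p
      (fun h => P.predicted θ y 0 d F (path h 0) - M.joint θ y d F / M.joint θ y d fun _ => 1)
      (16 * p.factorial / (√N * (1 - M.rho)) *
        (S * (P.normW₀ θ y * M.rho ^ k / M.nuG θ (y 0)))) := by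
  have hD : BddMeas fun ξ : Fin N → ℕ → X =>
      P.predicted θ y 0 d F ξ - M.joint θ y d F / M.joint θ y d fun _ => 1 :=
    (bddMeas_predicted h 0 d hF).sub (BddMeas.const _)
  have hr := h.one_sub_rho_pos θ
  have hr0 := h.rho_nonneg θ
  have hw := normW₀_nonneg (θ := θ) (y := y) h2
  obtain ⟨x₀⟩ : Nonempty X := nonempty_of_isProbabilityMeasure M.μ
  have hS0 : 0 ≤ S := (abs_nonneg _).trans (hS fun _ => x₀)
  have hprob : IsProbabilityMeasure ((P.init θ).map fun (x : X) (_ : ℕ) => x) :=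
    Measure.isProbabilityMeasure_map (measurable_pi_lambda _ fun _ => measurable_id).aemeasurable
  refine ⟨hD.comp (measurable_path 0), by positivity, ?_⟩
  obtain ⟨l, δ, V, U, hl, hδ, hR⟩ :=
    exists_ratioError_zero (N := N) (y := y) (θ := θ) h h2 hF hS hk hν d hkd
  have hp1 := hR.integral_abs_pow_le hp
  rw [← map_path_zero P N θ y n, integral_map (measurable_path 0).aemeasurable
    (hD.abs.pow p).meas.aestronglyMeasurable] at hp1
  refine hp1.trans ?_
  have hδ0 := hR.delta_nonneg
  calc (8 * p.factorial * (δ * (P.normW₀ θ y * (l / (1 - M.rho))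
          / (M.nuG θ (y 0) * l)) / √N)) ^ p
      ≤ (8 * p.factorial * (2 * S * M.rho ^ k * (P.normW₀ θ y * (l / (1 - M.rho))
          / (M.nuG θ (y 0) * l)) / √N)) ^ p := by gcongr
    _ = _ := by
        congr 1
        field_simp
        ring

lemma meanBound_init {d : ℕ} (hkd : k < d) :
    MeanBound (P.particleLaw N θ n y)
      (fun h => P.predicted θ y 0 d F (path h 0) - M.joint θ y d F / M.joint θ y d fun _ => 1)
      (32 / (N * (1 - M.rho) ^ 2) *
        (S * (P.normW₀ θ y ^ 2 * M.rho ^ k / M.nuG θ (y 0) ^ 2))) := by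
  have hD : BddMeas fun ξ : Fin N → ℕ → X =>
      P.predicted θ y 0 d F ξ - M.joint θ y d F / M.joint θ y d fun _ => 1 :=
    (bddMeas_predicted h 0 d hF).sub (BddMeas.const _)
  have hr := h.one_sub_rho_pos θ
  have hr0 := h.rho_nonneg θ
  have hprob : IsProbabilityMeasure ((P.init θ).map fun (x : X) (_ : ℕ) => x) :=
    Measure.isProbabilityMeasure_map (measurable_pi_lambda _ fun _ => measurable_id).aemeasurable
  refine ⟨hD.comp (measurable_path 0), ?_⟩
  obtain ⟨l, δ, V, U, hl, hδ, hR⟩ :=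
    exists_ratioError_zero (N := N) (y := y) (θ := θ) h h2 hF hS hk hν d hkd
  have hp1 := hR.abs_integral_le
  rw [← map_path_zero P N θ y n, integral_map (measurable_path 0).aemeasurable
    hD.meas.aestronglyMeasurable] at hp1
  refine hp1.trans ?_
  calc 16 * (δ * (P.normW₀ θ y * (l / (1 - M.rho)) / (M.nuG θ (y 0) * l)) ^ 2 / N)
      ≤ 16 * (2 * S * M.rho ^ k * (P.normW₀ θ y * (l / (1 - M.rho))
          / (M.nuG θ (y 0) * l)) ^ 2 / N) := by gcongr
    _ = _ := by
        field_simp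
        ring

/-- The sampling error for the smoothed mean of `F` at the horizon `T`. -/
lemma normBound_error {T : ℕ} (hkT : k < T) (hT : T ≤ n) {p : ℕ} (hp : 1 ≤ p) :
    NormBound (P.particleLaw N θ n y) p
      (fun h => avg F (resampledPath h T) - M.joint θ y T F / M.joint θ y T fun _ => 1)
      (16 * p.factorial / (√N * (1 - M.rho)) * (S * (1 / M.sigmaMinus *
        ∑ m ∈ Icc 1 T, P.normW (m - 1) θ y * M.rho ^ (k - m) / M.muG θ (y m)
          + P.normW₀ θ y * M.rho ^ k / M.nuG θ (y 0) + 1))) := by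
  have hp0 : p ≠ 0 := by omega
  have hr := h.one_sub_rho_pos θ
  have hr0 := h.rho_nonneg θ
  obtain ⟨x₀⟩ : Nonempty X := nonempty_of_isProbabilityMeasure M.μ
  have hS0 : 0 ≤ S := (abs_nonneg _).trans (hS fun _ => x₀)
  have hN : (0 : ℝ) < N := by exact_mod_cast Nat.pos_of_ne_zero (NeZero.ne N)
  have h1 := (normBound_resampling (P := P) (N := N) (θ := θ) (y := y) hF hS hT hp0).mono
    (b := 16 * p.factorial / (√N * (1 - M.rho)) * S) (by
      rw [div_mul_eq_mul_div, div_le_div_iff₀ (by positivity) (by positivity)]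
      have : 0 ≤ 8 * p.factorial * S * √N := by positivity
      nlinarith)
  have h3 := NormBound.sum hp fun m (hm : m ∈ range T) =>
    normBound_step (N := N) (y := y) (θ := θ) (n := n) (m := m) (d := T - (m + 1)) h h2 hF hS hk
      (by have := Finset.mem_range.mp hm; omega) (by omega) hp0
  have h4 := normBound_init (N := N) (y := y) (θ := θ) (n := n) h h2 hF hS hk hν hkT hp0
  have h5 := h1.add (h3.add h4 hp) hp
  simp only [← avg_resampledPath_sub] at h5
  refine h5.mono (le_of_eq ?_)
  rw [← sum_range_eq_sum_Icc T
    (fun m => P.normW (m - 1) θ y * M.rho ^ (k - m) / M.muG θ (y m))]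
  simp only [Nat.add_sub_cancel, ← Finset.mul_sum]
  ring

/-- The bias for the smoothed mean of `F` at the horizon `T`. -/
lemma meanBound_error {T : ℕ} (hkT : k < T) (hT : T ≤ n) :
    MeanBound (P.particleLaw N θ n y)
      (fun h => avg F (resampledPath h T) - M.joint θ y T F / M.joint θ y T fun _ => 1)
      (32 / (N * (1 - M.rho) ^ 2) * (S * (1 / M.sigmaMinus ^ 2 *
        ∑ m ∈ Icc 1 T, P.normW (m - 1) θ y ^ 2 * M.rho ^ (k - m) / M.muG θ (y m) ^ 2
          + P.normW₀ θ y ^ 2 * M.rho ^ k / M.nuG θ (y 0) ^ 2))) := by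
  have h1 := meanBound_resampling (P := P) (N := N) (θ := θ) (y := y) hF hT
  have h3 := MeanBound.sum fun m (hm : m ∈ range T) =>
    meanBound_step (N := N) (y := y) (θ := θ) (n := n) (m := m) (d := T - (m + 1)) h h2 hF hS hk
      (by have := Finset.mem_range.mp hm; omega) (by omega)
  have h4 := meanBound_init (N := N) (y := y) (θ := θ) (n := n) h h2 hF hS hk hν hkT
  have h5 := h1.add (h3.add h4)
  simp only [← avg_resampledPath_sub] at h5
  convert h5 using 1
  rw [← sum_range_eq_sum_Icc T
    (fun m => P.normW (m - 1) θ y ^ 2 * M.rho ^ (k - m) / M.muG θ (y m) ^ 2)]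
  simp only [Nat.add_sub_cancel, ← Finset.mul_sum]
  ring

end Errors

end Proposal

/-! ### The error of the fixed-lag estimator for given observations -/

lemma supNorm₂_nonneg {X : Type*} (f : X → X → ℝ) : 0 ≤ supNorm₂ f :=
  Real.iSup_nonneg fun _ => abs_nonneg _

lemma abs_le_supNorm₂ {X : Type*} {f : X → X → ℝ}
    (h : BddAbove (Set.range fun z : X × X => |f z.1 z.2|)) (x x' : X) : |f x x'| ≤ supNorm₂ f :=
  le_ciSup h (x, x')

section Increments

variable {X : Type*}

lemma dependsOn_pair_Ici (f : X → X → ℝ) (k : ℕ) :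
    DependsOn (fun x : ℕ → X => f (x k) (x (k + 1))) (Set.Ici k) := fun x x' h => by
  simp only [h k (Set.mem_Ici.mpr le_rfl), h (k + 1) (Set.mem_Ici.mpr k.le_succ)]

lemma dependsOn_pair_Iic (f : X → X → ℝ) (k : ℕ) :
    DependsOn (fun x : ℕ → X => f (x k) (x (k + 1))) (Set.Iic (k + 1)) := fun x x' h => by
  simp only [h k (Set.mem_Iic.mpr k.le_succ), h (k + 1) (Set.mem_Iic.mpr le_rfl)]

lemma bddMeas_pair [MeasurableSpace X] {f : X → X → ℝ}
    (hm : Measurable fun z : X × X => f z.1 z.2)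
    (hb : BddAbove (Set.range fun z : X × X => |f z.1 z.2|)) (k : ℕ) :
    BddMeas fun x : ℕ → X => f (x k) (x (k + 1)) := by
  have h1 : Measurable fun x : ℕ → X => (x k, x (k + 1)) :=
    (measurable_pi_apply k).prodMk (measurable_pi_apply (k + 1))
  exact ⟨hm.comp h1, supNorm₂ f, fun _ => abs_le_supNorm₂ hb _ _⟩

lemma gammaHat_eq_sum_avg {N : ℕ} (n Δ : ℕ) (s : ℕ → X → X → ℝ) (h : ℕ → Step X N) :
    gammaHat n Δ s h = ∑ k ∈ range n,
      avg (fun x : ℕ → X => s k (x k) (x (k + 1))) (resampledPath h (lagIndex n Δ k)) := by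
  simp only [gammaHat, avg, Finset.mul_sum]

end Increments

namespace Proposal

variable {X Y Θ : Type*} [MeasurableSpace X] [MeasurableSpace Y] {M : Model X Y Θ}
  {P : Proposal M}

/-- The bias due to the lag: the smoothed mean of `s_k(X_k, X_{k+1})` at the horizon `k(Δ)`
differs from the one at the horizon `n` only if `k + Δ < n`. -/
lemma abs_lag_bias_le (h : M.A1) {θ : Θ} {y : ℕ → Y} (hν : 0 < M.nuG θ (y 0)) {n Δ k : ℕ}
    (hΔ : 1 ≤ Δ) {f : X → X → ℝ} (hm : Measurable fun z : X × X => f z.1 z.2)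
    (hb : BddAbove (Set.range fun z : X × X => |f z.1 z.2|)) :
    |M.joint θ y (lagIndex n Δ k) (fun x => f (x k) (x (k + 1)))
        / M.joint θ y (lagIndex n Δ k) (fun _ => 1)
      - M.joint θ y n (fun x => f (x k) (x (k + 1))) / M.joint θ y n (fun _ => 1)|
      ≤ if k + Δ < n then 2 * supNorm₂ f * M.rho ^ Δ else 0 := by
  split_ifs with hlt
  · have h1 := Model.abs_ratio_sub_ratio_le h hν (bddMeas_pair hm hb k)
      (fun _ => abs_le_supNorm₂ hb _ _) (dependsOn_pair_Iic f k) (d := Δ - 1) (n := n) (by omega)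
    rwa [show k + 1 + (Δ - 1) = lagIndex n Δ k by unfold lagIndex; omega,
      show Δ - 1 + 1 = Δ by omega] at h1
  · rw [show lagIndex n Δ k = n by unfold lagIndex; omega, sub_self, abs_zero]

lemma sum_lag_bias_le {ρ : ℝ} (hρ : 0 ≤ ρ) {X : Type*} (s : ℕ → X → X → ℝ) (n Δ : ℕ) :
    ∑ k ∈ range n, (if k + Δ < n then 2 * supNorm₂ (s k) * ρ ^ Δ else 0)
      ≤ 2 * ρ ^ Δ * ∑ k ∈ range (n + 1 - Δ), supNorm₂ (s k) := by
  rw [← Finset.sum_filter, Finset.mul_sum]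
  have hsub : (range n).filter (fun k => k + Δ < n) ⊆ range (n + 1 - Δ) := fun k hk => by
    simp only [Finset.mem_filter, Finset.mem_range] at hk ⊢
    omega
  refine (Finset.sum_le_sum_of_subset_of_nonneg hsub fun k _ _ => ?_).trans_eq
    (Finset.sum_congr rfl fun k _ => by ring)
  have := supNorm₂_nonneg (s k)
  positivity

variable {N : ℕ} [NeZero N] {θ : Θ} {y : ℕ → Y} (h : M.A1) (h2 : P.A2)
  (hν : 0 < M.nuG θ (y 0)) {n Δ : ℕ} (hΔ : 1 ≤ Δ) {s : ℕ → X → X → ℝ}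
  (hm : ∀ k < n, Measurable fun z : X × X => s k z.1 z.2)
  (hb : ∀ k < n, BddAbove (Set.range fun z : X × X => |s k z.1 z.2|))
include h hm hb

omit [NeZero N] in
lemma gammaHat_sub_gamma (hist : ℕ → Step X N) :
    gammaHat n Δ s hist - M.gamma θ n y s = ∑ k ∈ range n,
      ((avg (fun x : ℕ → X => s k (x k) (x (k + 1))) (resampledPath hist (lagIndex n Δ k))
          - M.joint θ y (lagIndex n Δ k) (fun x => s k (x k) (x (k + 1)))
            / M.joint θ y (lagIndex n Δ k) fun _ => 1)
        + (M.joint θ y (lagIndex n Δ k) (fun x => s k (x k) (x (k + 1)))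
            / M.joint θ y (lagIndex n Δ k) (fun _ => 1)
          - M.joint θ y n (fun x => s k (x k) (x (k + 1))) / M.joint θ y n (fun _ => 1))) := by
  rw [gammaHat_eq_sum_avg, Model.gamma_eq h n fun k hk => bddMeas_pair (hm k hk) (hb k hk) k,
    ← Finset.sum_sub_distrib]
  exact Finset.sum_congr rfl fun k _ => by ring

include h2 hν hΔ

/-- The `L^p` error of the fixed-lag estimator, for given observations. -/
theorem normBound_gammaHat_sub_gamma {p : ℕ} (hp : 1 ≤ p) :
    NormBound (P.particleLaw N θ n y) p (fun hist => gammaHat n Δ s hist - M.gamma θ n y s)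
      (2 * M.rho ^ Δ * ∑ k ∈ range (n + 1 - Δ), supNorm₂ (s k)
        + 16 * p.factorial / (√(N : ℝ) * (1 - M.rho)) * ∑ k ∈ range n, supNorm₂ (s k)
          * (1 / M.sigmaMinus * ∑ m ∈ Icc 1 (lagIndex n Δ k),
                P.normW (m - 1) θ y * M.rho ^ (k - m) / M.muG θ (y m)
              + P.normW₀ θ y * M.rho ^ k / M.nuG θ (y 0) + 1)) := by
  simp only [gammaHat_sub_gamma h hm hb]
  refine (NormBound.sum hp fun k hk => (normBound_error (n := n) (T := lagIndex n Δ k) h h2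
    (bddMeas_pair (hm k (Finset.mem_range.mp hk)) (hb k (Finset.mem_range.mp hk)) k)
    (fun _ => abs_le_supNorm₂ (hb k (Finset.mem_range.mp hk)) _ _)
    (dependsOn_pair_Ici (s k) k) hν (by have := Finset.mem_range.mp hk; unfold lagIndex; omega)
    (by unfold lagIndex; omega) hp).add (NormBound.const (abs_lag_bias_le h hν hΔ
      (hm k (Finset.mem_range.mp hk)) (hb k (Finset.mem_range.mp hk)))) hp).mono ?_
  rw [Finset.sum_add_distrib, ← Finset.mul_sum, add_comm]
  exact add_le_add (sum_lag_bias_le (h.rho_nonneg θ) s n Δ) le_rfl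

/-- The bias of the fixed-lag estimator, for given observations. -/
theorem abs_integral_gammaHat_sub_gamma_le :
    |∫ hist, gammaHat n Δ s hist ∂P.particleLaw N θ n y - M.gamma θ n y s|
      ≤ 2 * M.rho ^ Δ * ∑ k ∈ range (n + 1 - Δ), supNorm₂ (s k)
        + 32 / (N * (1 - M.rho) ^ 2) * ∑ k ∈ range n, supNorm₂ (s k)
          * (1 / M.sigmaMinus ^ 2 * ∑ m ∈ Icc 1 (lagIndex n Δ k),
                P.normW (m - 1) θ y ^ 2 * M.rho ^ (k - m) / M.muG θ (y m) ^ 2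
              + P.normW₀ θ y ^ 2 * M.rho ^ k / M.nuG θ (y 0) ^ 2) := by
  have h1 := MeanBound.sum fun k hk => (meanBound_error (P := P) (N := N) (n := n)
    (T := lagIndex n Δ k) h h2
    (bddMeas_pair (hm k (Finset.mem_range.mp hk)) (hb k (Finset.mem_range.mp hk)) k)
    (fun _ => abs_le_supNorm₂ (hb k (Finset.mem_range.mp hk)) _ _)
    (dependsOn_pair_Ici (s k) k) hν (by have := Finset.mem_range.mp hk; unfold lagIndex; omega)
    (by unfold lagIndex; omega)).add (MeanBound.const (abs_lag_bias_le (n := n) (k := k) h hν hΔ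
      (hm k (Finset.mem_range.mp hk)) (hb k (Finset.mem_range.mp hk))))
  simp only [← gammaHat_sub_gamma h hm hb] at h1
  have hbm : BddMeas fun hist : ℕ → Step X N => gammaHat n Δ s hist := by
    simpa using h1.bddMeas.add (BddMeas.const (M.gamma θ n y s))
  have h3 := h1.le
  rw [integral_sub (hbm.integrable _) (integrable_const _)] at h3
  simp only [integral_const, probReal_univ, one_smul] at h3
  refine h3.trans ?_
  rw [Finset.sum_add_distrib, ← Finset.mul_sum, add_comm]
  exact add_le_add (sum_lag_bias_le (h.rho_nonneg θ) s n Δ) le_rfl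

end Proposal

lemma NormBound.rpow_le {Ω : Type*} [MeasurableSpace Ω] {Pr : Measure Ω} {p : ℕ} {f : Ω → ℝ}
    {b : ℝ} (h : NormBound Pr p f b) (hp : p ≠ 0) :
    (∫ ω, |f ω| ^ p ∂Pr) ^ (1 / (p : ℝ)) ≤ b := by
  rw [one_div, Real.rpow_inv_le_iff_of_pos (integral_nonneg fun _ => by positivity) h.nonneg
    (by positivity), Real.rpow_natCast]
  exact h.le

/-! ### Conditioning on the observations -/

section UpTo

variable {Y : Type*} {n : ℕ}

lemma upTo_eq_iff {y y' : ℕ → Y} : upTo n y = upTo n y' ↔ ∀ k ≤ n, y k = y' k :=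
  ⟨fun h k hk => congrFun h ⟨k, Nat.lt_succ_of_le hk⟩,
    fun h => funext fun i => h i (Nat.le_of_lt_succ i.2)⟩

lemma upTo_congr_of_le {y y' : ℕ → Y} {m : ℕ} (hmn : m ≤ n) (h : upTo n y = upTo n y') :
    upTo m y = upTo m y' :=
  upTo_eq_iff.mpr fun k hk => upTo_eq_iff.mp h k (hk.trans hmn)

/-- The sequence that prolongs `z_0, …, z_n` by its last term. -/
def prolongSeq (n : ℕ) (z : Fin (n + 1) → Y) : ℕ → Y :=
  fun k => z ⟨min k n, by omega⟩

lemma upTo_prolongSeq (z : Fin (n + 1) → Y) : upTo n (prolongSeq n z) = z := by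
  funext i
  simp only [upTo, prolongSeq]
  congr 1
  ext
  simp [Nat.le_of_lt_succ i.2]

lemma measurable_prolongSeq [MeasurableSpace Y] (n : ℕ) :
    Measurable (prolongSeq (Y := Y) n) :=
  measurable_pi_lambda _ fun _ => measurable_pi_apply _

end UpTo

namespace Proposal

variable {X Y Θ : Type*} [MeasurableSpace X] [MeasurableSpace Y] {M : Model X Y Θ}
  {P : Proposal M} {N : ℕ} [NeZero N] {θ : Θ}

lemma particleLaw_congr {n : ℕ} {y y' : ℕ → Y} (h : upTo n y = upTo n y') :
    P.particleLaw N θ n y = P.particleLaw N θ n y' := by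
  induction n with
  | zero =>
    refine Measure.ext_of_lintegral _ fun f hf => ?_
    have h0 : y 0 = y' 0 := upTo_eq_iff.mp h 0 le_rfl
    rw [lintegral_particleLaw_zero P N θ y hf, lintegral_particleLaw_zero P N θ y' hf]
    refine lintegral_congr fun x => ?_
    have h1 : P.resampleInit N θ (y, x) = P.resampleInit N θ (y', x) := by
      simp only [resampleInit, piKernel_apply, Kernel.comap_apply, h0]
    rw [h1]
  | succ n ih =>
    refine Measure.ext_of_lintegral _ fun f hf => ?_
    rw [lintegral_particleLaw_succ P N θ y n hf, lintegral_particleLaw_succ P N θ y' n hf,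
      ih (upTo_congr_of_le n.le_succ h)]
    refine lintegral_congr fun hist => ?_
    have h1 : P.mutate N θ n (y, hist) = P.mutate N θ n (y', hist) := by
      simp only [mutate, piKernel_apply, Kernel.comap_apply, h]
    have h2 : ∀ x, P.resample N θ n ((y, hist), x) = P.resample N θ n ((y', hist), x) := fun x => by
      simp only [resample, piKernel_apply, Kernel.comap_apply, h]
    simp only [h1, h2]

/-- The conditional expectation given the observations is the integral with respect to the law of
the particle system driven by them. -/
lemma condExp_obsSigma (obs : Measure (ℕ → Y)) [IsProbabilityMeasure obs] (n : ℕ)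
    {V : (ℕ → Y) × (ℕ → Step X N) → ℝ} (hV : Measurable V)
    (hVn : ∀ y y' hist, upTo n y = upTo n y' → V (y, hist) = V (y', hist))
    (hint : Integrable V (P.jointLaw N θ obs n)) :
    condExp (obsSigma Y (ℕ → Step X N) n) (P.jointLaw N θ obs n) V
      =ᵐ[P.jointLaw N θ obs n] fun ω => ∫ hist, V (ω.1, hist) ∂P.particleLaw N θ n ω.1 := by
  set G : (ℕ → Y) → ℝ := fun y => ∫ hist, V (y, hist) ∂P.particleLaw N θ n y with hG
  have hGm : StronglyMeasurable G := hV.stronglyMeasurable.integral_kernel_prod_right'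
  have hmeas : Measurable fun ω : (ℕ → Y) × (ℕ → Step X N) => upTo n ω.1 :=
    (measurable_upTo n).comp measurable_fst
  have hm : obsSigma Y (ℕ → Step X N) n
      ≤ (inferInstance : MeasurableSpace ((ℕ → Y) × (ℕ → Step X N))) := hmeas.comap_le
  have hGcongr : ∀ y, G y = G (prolongSeq n (upTo n y)) := fun y => by
    have h1 : upTo n y = upTo n (prolongSeq n (upTo n y)) := (upTo_prolongSeq _).symm
    simp only [hG]
    rw [← particleLaw_congr h1]
    exact integral_congr_ae (ae_of_all _ fun hist => hVn _ _ _ h1)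
  have hGint : Integrable G obs := by
    have h1 : Integrable V ((Kernel.const Unit obs
        ⊗ₖ Kernel.prodMkLeft Unit (P.particleLaw N θ n)) ()) := hint
    simpa using h1.integral_compProd
  have hGfst : Integrable (fun ω : (ℕ → Y) × (ℕ → Step X N) => G ω.1) (P.jointLaw N θ obs n) := by
    have h1 : (P.jointLaw N θ obs n).map Prod.fst = obs := Measure.fst_compProd _ _
    rw [← h1] at hGint
    exact hGint.comp_measurable measurable_fst
  refine (ae_eq_condExp_of_forall_setIntegral_eq hm hint (fun s _ _ => hGfst.integrableOn)
    (fun s hs _ => ?_) ?_).symm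
  · obtain ⟨t, ht, rfl⟩ := hs
    have hA : MeasurableSet {y : ℕ → Y | upTo n y ∈ t} := measurable_upTo n ht
    have hset : (fun ω : (ℕ → Y) × (ℕ → Step X N) => upTo n ω.1) ⁻¹' t
        = {y : ℕ → Y | upTo n y ∈ t} ×ˢ Set.univ := by ext; simp
    rw [hset, jointLaw, Measure.setIntegral_compProd hA MeasurableSet.univ hGfst.integrableOn,
      Measure.setIntegral_compProd hA MeasurableSet.univ hint.integrableOn]
    simp [hG]
  · have h1 : (fun ω : (ℕ → Y) × (ℕ → Step X N) => G ω.1)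
        = (fun z => G (prolongSeq n z)) ∘ fun ω : (ℕ → Y) × (ℕ → Step X N) => upTo n ω.1 :=
      funext fun ω => hGcongr ω.1
    have h2 : Measurable[obsSigma Y (ℕ → Step X N) n]
        fun ω : (ℕ → Y) × (ℕ → Step X N) => G ω.1 := by
      rw [h1]
      exact (hGm.measurable.comp (measurable_prolongSeq n)).comp (comap_measurable _)
    exact h2.stronglyMeasurable.aestronglyMeasurable

end Proposal

section Measurability

variable {X Y Θ : Type*} [MeasurableSpace X] [MeasurableSpace Y] {n : ℕ}
  {s : ℕ → (Fin (n + 1) → Y) → X → X → ℝ}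
  (hs : ∀ k < n, Measurable fun z : (Fin (n + 1) → Y) × X × X => s k z.1 z.2.1 z.2.2)
include hs

lemma measurable_gammaHat {N : ℕ} (Δ : ℕ) : Measurable fun ω : (ℕ → Y) × (ℕ → Step X N) =>
    gammaHat n Δ (fun k => s k (upTo n ω.1)) ω.2 := by
  refine (Finset.measurable_sum _ fun k hk => Finset.measurable_sum _ fun j _ => ?_).const_mul _
  have hr : ∀ i, Measurable fun ω : (ℕ → Y) × (ℕ → Step X N) =>
      resampledPath ω.2 (lagIndex n Δ k) j i := fun i =>
    (measurable_pi_apply i).comp ((measurable_pi_apply j).comp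
      ((measurable_resampledPath (lagIndex n Δ k)).comp measurable_snd))
  have h1 : Measurable fun ω : (ℕ → Y) × (ℕ → Step X N) => (upTo n ω.1,
      resampledPath ω.2 (lagIndex n Δ k) j k, resampledPath ω.2 (lagIndex n Δ k) j (k + 1)) :=
    ((measurable_upTo n).comp measurable_fst).prodMk ((hr k).prodMk (hr (k + 1)))
  exact (hs k (Finset.mem_range.mp hk)).comp h1

lemma Model.measurable_gamma (M : Model X Y Θ) (θ : Θ) :
    Measurable fun y : ℕ → Y => M.gamma θ n y fun k => s k (upTo n y) := by
  have hF : Measurable fun p : (ℕ → Y) × (ℕ → X) =>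
      ∑ k ∈ range n, s k (upTo n p.1) (p.2 k) (p.2 (k + 1)) := by
    refine Finset.measurable_sum _ fun k hk => ?_
    have h1 : Measurable fun p : (ℕ → Y) × (ℕ → X) => (upTo n p.1, p.2 k, p.2 (k + 1)) :=
      ((measurable_upTo n).comp measurable_fst).prodMk
        (((measurable_pi_apply k).comp measurable_snd).prodMk
          ((measurable_pi_apply (k + 1)).comp measurable_snd))
    exact (hs k (Finset.mem_range.mp hk)).comp h1
  have hd := (M.measurable_obsDensity θ n).coe_nnreal_real
  simp only [gamma, integral_smoothing, joint]
  exact ((hd.mul hF).stronglyMeasurable.integral_prod_right').measurable.div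
    ((hd.mul measurable_const).stronglyMeasurable.integral_prod_right').measurable

end Measurability

lemma Model.gamma_congr {X Y Θ : Type*} [MeasurableSpace X] [MeasurableSpace Y] (M : Model X Y Θ)
    (θ : Θ) {n : ℕ} {y y' : ℕ → Y} (h : upTo n y = upTo n y') (s : ℕ → X → X → ℝ) :
    M.gamma θ n y s = M.gamma θ n y' s := by
  have h1 : ∀ x, M.obsDensity θ n y x = M.obsDensity θ n y' x := fun x =>
    Finset.prod_congr rfl fun k hk => by
      rw [upTo_eq_iff.mp h k (Nat.lt_succ_iff.mp (Finset.mem_range.mp hk))]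
  simp only [gamma, smoothing, likelihood, h1]

/-! ### Lags of logarithmic order -/

lemma tendsto_mul_pow_ceil_log {ρ c : ℝ} (h0 : 0 ≤ ρ) (h1 : ρ < 1) (hc : -1 / Real.log ρ < c) :
    Filter.Tendsto (fun n : ℕ => (n : ℝ) * ρ ^ ⌈c * Real.log n⌉₊) Filter.atTop (nhds 0) := by
  rcases h0.eq_or_lt with rfl | hpos
  · -- here `log 0 = 0`, so that the hypothesis says `0 < c`
    have hc0 : 0 < c := by simpa using hc
    refine tendsto_const_nhds.congr' ?_
    filter_upwards [Filter.eventually_ge_atTop 2] with n hn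
    have hlog : 0 < Real.log n := Real.log_pos (by exact_mod_cast hn)
    have : ⌈c * Real.log n⌉₊ ≠ 0 := (Nat.ceil_pos.mpr (mul_pos hc0 hlog)).ne'
    simp [this]
  have hlog : Real.log ρ < 0 := Real.log_neg hpos h1
  have hexp : 1 + c * Real.log ρ < 0 := by
    rw [div_lt_iff_of_neg hlog] at hc
    linarith
  have hlim : Filter.Tendsto (fun n : ℕ => ((n : ℝ)) ^ (1 + c * Real.log ρ)) Filter.atTop
      (nhds 0) := by
    have := (tendsto_rpow_neg_atTop (neg_pos.mpr hexp)).comp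
      (tendsto_natCast_atTop_atTop (R := ℝ))
    simpa [Function.comp_def] using this
  refine squeeze_zero' (Filter.Eventually.of_forall fun n => by positivity) ?_ hlim
  filter_upwards [Filter.eventually_ge_atTop 1] with n hn
  have hn0 : (0 : ℝ) < n := by exact_mod_cast hn
  calc (n : ℝ) * ρ ^ ⌈c * Real.log n⌉₊ = n * ρ ^ (⌈c * Real.log n⌉₊ : ℝ) := by
        rw [Real.rpow_natCast]
    _ ≤ n * ρ ^ (c * Real.log n) := by
        gcongr ?_ * ?_
        exact Real.rpow_le_rpow_of_exponent_ge hpos h1.le (Nat.le_ceil _)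
    _ = (n : ℝ) ^ (1 + c * Real.log ρ) := by
        rw [Real.rpow_add hn0, Real.rpow_one, Real.rpow_def_of_pos hpos, Real.rpow_def_of_pos hn0]
        congr 2
        ring

lemma neg_one_div_log_nonneg {ρ : ℝ} (h0 : 0 ≤ ρ) (h1 : ρ < 1) : 0 ≤ -1 / Real.log ρ :=
  div_nonneg_of_nonpos (by norm_num) (Real.log_nonpos h0 h1.le)

/-- The forgetting factors up to the horizon `T` sum to at most `1 / (1 - ρ)` before the time
`k`, and to at most `T - k` after it. -/
lemma sum_pow_sub_le {ρ : ℝ} (h0 : 0 ≤ ρ) (h1 : ρ < 1) (k Δ T : ℕ) (hT : T ≤ k + Δ) :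
    ∑ m ∈ Icc 1 T, ρ ^ (k - m) ≤ 1 / (1 - ρ) + Δ := by
  have hsub : Icc 1 T ⊆ Icc 1 k ∪ Ioc k (k + Δ) := fun m hm => by
    simp only [Finset.mem_union, Finset.mem_Icc, Finset.mem_Ioc] at hm ⊢
    omega
  have hdisj : Disjoint (Icc 1 k) (Ioc k (k + Δ)) := Finset.disjoint_left.mpr fun m hm hm' => by
    simp only [Finset.mem_Icc, Finset.mem_Ioc] at hm hm'
    omega
  refine (Finset.sum_le_sum_of_subset_of_nonneg hsub fun _ _ _ => by positivity).trans ?_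
  rw [Finset.sum_union hdisj]
  refine add_le_add ?_ ?_
  · have h2 : ∑ m ∈ Icc 1 k, ρ ^ (k - m) = ∑ j ∈ range k, ρ ^ j := by
      rw [← sum_range_eq_sum_Icc k (fun m => ρ ^ (k - m)), ← Finset.sum_range_reflect]
      exact Finset.sum_congr rfl fun m hm => by
        have := Finset.mem_range.mp hm
        congr 1
        omega
    rw [h2, one_div, ← tsum_geometric_of_lt_one h0 h1]
    exact (summable_geometric_of_lt_one h0 h1).sum_le_tsum _ fun _ _ => by positivity
  · refine (Finset.sum_le_card_nsmul _ _ 1 fun m _ => pow_le_one₀ h0 h1.le).trans_eq ?_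
    simp

namespace Proposal

variable {X Y Θ : Type*} [MeasurableSpace X] [MeasurableSpace Y] {M : Model X Y Θ}
  {P : Proposal M}

/-- For uniformly bounded summands and weights, a lag of order `log n` gives an error of order
`n ρ ^ Δ + n log n / √N`. -/
lemma exists_rate (h : M.A1) (h2 : P.A2) (θ : Θ) (y : ℕ → Y) (s : ℕ → X → X → ℝ) (p : ℕ)
    (c a b : ℝ) (hp : 2 ≤ p) (hν : 0 < M.nuG θ (y 0))
    (hm : ∀ k, Measurable fun z : X × X => s k z.1 z.2) (ha : ∀ k x x', |s k x x'| ≤ a)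
    (hb : ∀ m, P.normW m θ y / M.muG θ (y (m + 1)) ≤ b) (hc : 0 < c) :
    ∃ C : ℝ, ∀ (n N : ℕ) [NeZero N], 2 ≤ n →
      (∫ h, |gammaHat n ⌈c * Real.log n⌉₊ s h - M.gamma θ n y s| ^ p
          ∂P.particleLaw N θ n y) ^ (1 / (p : ℝ))
        ≤ C * (n * M.rho ^ ⌈c * Real.log n⌉₊) + C * (n * Real.log n / √(N : ℝ)) := by
  obtain ⟨x₀⟩ : Nonempty X := nonempty_of_isProbabilityMeasure M.μ
  have ha0 : 0 ≤ a := (abs_nonneg _).trans (ha 0 x₀ x₀)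
  have hb0 : 0 ≤ b := (div_nonneg (normW_nonneg h2 0) (h.muG_pos θ (y (0 + 1))).le).trans (hb 0)
  have hr := h.one_sub_rho_pos θ
  have hr0 := h.rho_nonneg θ
  have hr1 := h.rho_lt_one θ
  have hσ := h.sigmaMinus_pos
  have hlog2 : 0 < Real.log 2 := Real.log_pos one_lt_two
  set w := P.normW₀ θ y / M.nuG θ (y 0) with hw
  have hw0 : 0 ≤ w := div_nonneg (normW₀_nonneg h2) hν.le
  have hsup : ∀ k, supNorm₂ (s k) ≤ a := fun k => Real.iSup_le (fun z => ha k z.1 z.2) ha0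
  set D := 1 / M.sigmaMinus * (b * (1 / (1 - M.rho) / Real.log 2 + (c + 1 / Real.log 2)))
    + (w + 1) / Real.log 2 with hD
  have hD0 : 0 ≤ D := by positivity
  refine ⟨2 * a + 16 * p.factorial / (1 - M.rho) * (a * D), fun n N _ hn => ?_⟩
  have hlogn : Real.log 2 ≤ Real.log n :=
    Real.log_le_log two_pos (by exact_mod_cast hn)
  have hlogn0 : 0 < Real.log n := hlog2.trans_le hlogn
  have hN : (0 : ℝ) < √(N : ℝ) :=
    Real.sqrt_pos.mpr (by exact_mod_cast Nat.pos_of_ne_zero (NeZero.ne N))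
  set Δ := ⌈c * Real.log n⌉₊ with hΔdef
  have hΔ : 1 ≤ Δ := Nat.ceil_pos.mpr (mul_pos hc hlogn0)
  have h1log : 1 ≤ Real.log n / Real.log 2 := (one_le_div hlog2).mpr hlogn
  have hΔle : (Δ : ℝ) ≤ (c + 1 / Real.log 2) * Real.log n := by
    have := (Nat.ceil_lt_add_one (mul_pos hc hlogn0).le).le
    rw [add_mul, one_div_mul_eq_div]
    linarith
  have hinner : ∀ k, 1 / M.sigmaMinus * ∑ m ∈ Icc 1 (lagIndex n Δ k),
        P.normW (m - 1) θ y * M.rho ^ (k - m) / M.muG θ (y m)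
      + P.normW₀ θ y * M.rho ^ k / M.nuG θ (y 0) + 1 ≤ D * Real.log n := by
    intro k
    have e1 : ∑ m ∈ Icc 1 (lagIndex n Δ k),
        P.normW (m - 1) θ y * M.rho ^ (k - m) / M.muG θ (y m)
        ≤ b * (1 / (1 - M.rho) + Δ) := by
      calc ∑ m ∈ Icc 1 (lagIndex n Δ k),
            P.normW (m - 1) θ y * M.rho ^ (k - m) / M.muG θ (y m)
          ≤ ∑ m ∈ Icc 1 (lagIndex n Δ k), b * M.rho ^ (k - m) := by
            refine Finset.sum_le_sum fun m hmm => ?_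
            have h1m := (Finset.mem_Icc.mp hmm).1
            have := hb (m - 1)
            rw [Nat.sub_add_cancel h1m] at this
            rw [mul_div_right_comm]
            gcongr
        _ ≤ b * (1 / (1 - M.rho) + Δ) := by
            rw [← Finset.mul_sum]
            gcongr
            exact sum_pow_sub_le hr0 hr1 k Δ _ (min_le_left _ _)
    have e2 : P.normW₀ θ y * M.rho ^ k / M.nuG θ (y 0) ≤ w := by
      rw [mul_div_right_comm]
      exact mul_le_of_le_one_right hw0 (pow_le_one₀ hr0 hr1.le)
    have e3 : 1 / (1 - M.rho) ≤ 1 / (1 - M.rho) / Real.log 2 * Real.log n := by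
      rw [div_mul_eq_mul_div, mul_div_assoc]
      exact le_mul_of_one_le_right (by positivity) h1log
    have e4 : w + 1 ≤ (w + 1) / Real.log 2 * Real.log n := by
      rw [div_mul_eq_mul_div, mul_div_assoc]
      exact le_mul_of_one_le_right (by positivity) h1log
    have e5 : b * (1 / (1 - M.rho) + Δ)
        ≤ b * ((1 / (1 - M.rho) / Real.log 2 + (c + 1 / Real.log 2)) * Real.log n) := by
      gcongr
      linarith
    have e6 := mul_le_mul_of_nonneg_left (e1.trans e5) (one_div_pos.mpr hσ).le
    rw [hD]
    linarith
  refine ((normBound_gammaHat_sub_gamma (N := N) (n := n) h h2 hν hΔ (fun k _ => hm k)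
    (fun k _ => ⟨a, by rintro _ ⟨z, rfl⟩; exact ha k z.1 z.2⟩)
    (by omega : 1 ≤ p)).rpow_le (by omega)).trans ?_
  have t1 : ∑ k ∈ range (n + 1 - Δ), supNorm₂ (s k) ≤ n * a := by
    refine (Finset.sum_le_card_nsmul _ _ a fun k _ => hsup k).trans ?_
    rw [Finset.card_range, nsmul_eq_mul]
    gcongr
    omega
  have t2 : ∑ k ∈ range n, supNorm₂ (s k)
      * (1 / M.sigmaMinus * ∑ m ∈ Icc 1 (lagIndex n Δ k),
            P.normW (m - 1) θ y * M.rho ^ (k - m) / M.muG θ (y m)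
          + P.normW₀ θ y * M.rho ^ k / M.nuG θ (y 0) + 1)
      ≤ n * (a * (D * Real.log n)) := by
    refine (Finset.sum_le_card_nsmul _ _ (a * (D * Real.log n)) fun k _ => ?_).trans_eq
      (by rw [Finset.card_range, nsmul_eq_mul])
    exact (mul_le_mul_of_nonneg_left (hinner k) (supNorm₂_nonneg _)).trans
      (mul_le_mul_of_nonneg_right (hsup k) (by positivity))
  calc _ ≤ 2 * M.rho ^ Δ * (n * a)
        + 16 * p.factorial / (√(N : ℝ) * (1 - M.rho)) * (n * (a * (D * Real.log n))) := by gcongr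
    _ = 2 * a * (n * M.rho ^ Δ)
        + 16 * p.factorial / (1 - M.rho) * (a * D) * (n * Real.log n / √(N : ℝ)) := by
        field_simp
    _ ≤ _ := by
        have k1 : 0 ≤ 16 * p.factorial / (1 - M.rho) * (a * D) := by positivity
        gcongr
        · linarith
        · linarith

end Proposal

end FixedLag

end

theorem theorem3p3 :
    ∃ (Bp : ℕ → ℝ) (B : ℝ),
      ∀ (X : Type u) (Y : Type v) (Θ : Type w) [MeasurableSpace X] [MeasurableSpace Y]
        (M : Model X Y Θ) (P : Proposal M), M.A1 → P.A2 →
      -- the bounds conditional on the observations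
      (∀ (obs : Measure (ℕ → Y)) [IsProbabilityMeasure obs] (n : ℕ) (θ : Θ) (Δ : ℕ) (_ : 1 ≤ Δ)
        (N : ℕ) [NeZero N] (s : ℕ → (Fin (n + 1) → Y) → X → X → ℝ)
        (_ : ∀ k < n, Measurable fun z : (Fin (n + 1) → Y) × X × X => s k z.1 z.2.1 z.2.2)
        (_ : ∀ k < n, ∀ y, BddAbove (Set.range fun z : X × X => |s k y z.1 z.2|)),
        -- (i)
        (∀ p : ℕ, 2 ≤ p →
          MemLp (fun ω : (ℕ → Y) × (ℕ → Step X N) =>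
              gammaHat n Δ (fun k => s k (upTo n ω.1)) ω.2
                - M.gamma θ n ω.1 (fun k => s k (upTo n ω.1)))
            p (P.jointLaw N θ obs n) →
          ∀ᵐ ω ∂P.jointLaw N θ obs n, 0 < M.nuG θ (ω.1 0) →
            condNorm (P.jointLaw N θ obs n) (obsSigma Y (ℕ → Step X N) n) p
                (fun ω' => gammaHat n Δ (fun k => s k (upTo n ω'.1)) ω'.2
                  - M.gamma θ n ω'.1 (fun k => s k (upTo n ω'.1))) ω
              ≤ 2 * M.rho ^ Δ * ∑ k ∈ range (n + 1 - Δ), supNorm₂ (s k (upTo n ω.1))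
                + Bp p / (√(N : ℝ) * (1 - M.rho))
                  * ∑ k ∈ range n, supNorm₂ (s k (upTo n ω.1))
                    * (1 / M.sigmaMinus
                        * ∑ m ∈ Icc 1 (lagIndex n Δ k),
                            P.normW (m - 1) θ ω.1 * M.rho ^ (k - m) / M.muG θ (ω.1 m)
                      + P.normW₀ θ ω.1 * M.rho ^ k / M.nuG θ (ω.1 0) + 1)) ∧
        -- (ii)
        (Integrable (fun ω : (ℕ → Y) × (ℕ → Step X N) =>
              gammaHat n Δ (fun k => s k (upTo n ω.1)) ω.2) (P.jointLaw N θ obs n) →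
          ∀ᵐ ω ∂P.jointLaw N θ obs n, 0 < M.nuG θ (ω.1 0) →
            |condExp (obsSigma Y (ℕ → Step X N) n) (P.jointLaw N θ obs n)
                (fun ω' => gammaHat n Δ (fun k => s k (upTo n ω'.1)) ω'.2) ω
              - M.gamma θ n ω.1 (fun k => s k (upTo n ω.1))|
              ≤ 2 * M.rho ^ Δ * ∑ k ∈ range (n + 1 - Δ), supNorm₂ (s k (upTo n ω.1))
                + B / (N * (1 - M.rho) ^ 2)
                  * ∑ k ∈ range n, supNorm₂ (s k (upTo n ω.1))
                    * (1 / M.sigmaMinus ^ 2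
                        * ∑ m ∈ Icc 1 (lagIndex n Δ k),
                            P.normW (m - 1) θ ω.1 ^ 2 * M.rho ^ (k - m) / M.muG θ (ω.1 m) ^ 2
                      + P.normW₀ θ ω.1 ^ 2 * M.rho ^ k / M.nuG θ (ω.1 0) ^ 2))) ∧
      -- the rate for a lag of logarithmic order, for a fixed sequence of observations
      (∀ (θ : Θ) (y : ℕ → Y) (s : ℕ → X → X → ℝ) (p : ℕ) (c a b : ℝ), 2 ≤ p →
        0 < M.nuG θ (y 0) →
        (∀ k, Measurable fun z : X × X => s k z.1 z.2) →
        (∀ k x x', |s k x x'| ≤ a) →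
        (∀ m, P.normW m θ y / M.muG θ (y (m + 1)) ≤ b) →
        -1 / Real.log M.rho < c →
        Filter.Tendsto (fun n : ℕ => (n : ℝ) * M.rho ^ ⌈c * Real.log n⌉₊)
          Filter.atTop (nhds 0) ∧
        ∃ C : ℝ, ∀ (n N : ℕ) [NeZero N], 2 ≤ n →
          (∫ h, |gammaHat n ⌈c * Real.log n⌉₊ s h - M.gamma θ n y s| ^ p
              ∂P.particleLaw N θ n y) ^ (1 / (p : ℝ))
            ≤ C * (n * M.rho ^ ⌈c * Real.log n⌉₊)
              + C * (n * Real.log n / √(N : ℝ))) := by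
  refine ⟨fun p => 16 * p.factorial, 32, fun X Y Θ _ _ M P h h2 =>
    ⟨fun obs _ n θ Δ hΔ N _ s hs hb => ⟨fun p hp hV => ?_, fun hint => ?_⟩,
      fun θ y s p c a b hp hν hm ha hb hc => ⟨?_, ?_⟩⟩⟩
  · have hmeas := (measurable_gammaHat (N := N) hs Δ).sub
      ((Model.measurable_gamma hs M θ).comp (measurable_fst (β := ℕ → Step X N)))
    have hint : Integrable (fun ω : (ℕ → Y) × (ℕ → Step X N) =>
        |gammaHat n Δ (fun k => s k (upTo n ω.1)) ω.2
          - M.gamma θ n ω.1 (fun k => s k (upTo n ω.1))| ^ p) (P.jointLaw N θ obs n) := by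
      simpa using hV.integrable_norm_pow (by omega)
    filter_upwards [Proposal.condExp_obsSigma obs n ((measurable_norm.comp hmeas).pow_const p)
      (fun y y' hist hy => by
        simp only [Function.comp_apply, Pi.sub_apply, hy, M.gamma_congr θ hy]) hint] with ω hω hν
    simp only [condNorm]
    refine (congrArg (· ^ (1 / (p : ℝ))) hω).trans_le ?_
    have hs' : ∀ k < n, Measurable fun z : X × X => s k (upTo n ω.1) z.1 z.2 := fun k hk =>
      (hs k hk).comp measurable_prodMk_left
    exact (Proposal.normBound_gammaHat_sub_gamma (N := N) (y := ω.1)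
      (s := fun k => s k (upTo n ω.1)) h h2 hν hΔ hs' (fun k hk => hb k hk _)
      (by omega : 1 ≤ p)).rpow_le (by omega)
  · filter_upwards [Proposal.condExp_obsSigma obs n (measurable_gammaHat (N := N) hs Δ)
      (fun y y' hist hy => by simp only [hy]) hint] with ω hω hν
    rw [hω]
    have hs' : ∀ k < n, Measurable fun z : X × X => s k (upTo n ω.1) z.1 z.2 := fun k hk =>
      (hs k hk).comp measurable_prodMk_left
    exact Proposal.abs_integral_gammaHat_sub_gamma_le (N := N) (y := ω.1)
      (s := fun k => s k (upTo n ω.1)) h h2 hν hΔ hs' (fun k hk => hb k hk _)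
  · exact tendsto_mul_pow_ceil_log (h.rho_nonneg θ) (h.rho_lt_one θ) hc
  · exact Proposal.exists_rate h h2 θ y s p c a b hp hν hm ha hb
      ((neg_one_div_log_nonneg (h.rho_nonneg θ) (h.rho_lt_one θ)).trans_lt hc)
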